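/- **Setting.** Let $H\in(0,1)\setminus\{\frac12\}$ and let $B=(B_t)_{t\in\mathbb R}$ be a two-sided fractional Brownian motion with Hurst parameter $H$ (continuous centred Gaussian, $\mathbb E(B_sB_t)=\frac12(|s|^{2H}+|t|^{2H}-|t-s|^{2H})$) on a probability space. For $\epsilon\in(0,1]$ let $$y^\epsilon_t=\frac{\sigma}{\epsilon^{H}}\int_{-\infty}^t e^{-(t-s)/\epsilon}\,dB_s ,$$ a pathwise Riemann–Stieltjes integral, i.e. $\int_{-\infty}^t e^{-(t-s)/\epsilon}dB_s=B_t-\frac1\epsilon\int_{-\infty}^te^{-(t-s)/\epsilon}B_s\,ds$, where $\sigma$ is chosen such that $y^1_0\sim\mu:=N(0,1)$; this is the fast stationary fractional Ornstein–Uhlenbeck process. Let $H_l$ be the monic Hermite polynomials, orthogonal in $L^2(\mu)$, and for $G\in L^2(\mu)$ let $c_l(G)=\frac1{l!}\langle G,H_l\rangle_{L^2(\mu)}$. The Hermite rank of $G$ is the smallest $m$ with $c_m(G)\neq0$. Put $H^*(m)=m(H-1)+1$ and $$\alpha(\epsilon,h)=\begin{cases}\epsilon^{-1/2},&h<\frac12,\\(\epsilon|\ln\epsilon|)^{-1/2},&h=\frac12,\\\epsilon^{h-1},&h>\frac12.\end{cases}$$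 $G$ satisfies the fast chaos decay condition with parameter $q\in\mathbb N$ if $\sum_{l\ge0}|c_l(G)|\sqrt{l!}\,(2q-1)^{l/2}<\infty$. **Assumption.** $G_1,\dots,G_N:\mathbb R\to\mathbb R$ are continuous, $G_k\in L^{p_k}(\mu)$ with $p_k\in(2,\infty]$, and $G_k$ has Hermite rank $m_k\ge1$. Moreover: 1. there is an integer $q\ge4$ such that every $G_k$ satisfies the fast chaos decay condition with parameter $q$; 2. $(\frac12-\frac1{p_k})+(H^*(m_l)-\frac1{p_l})>1$ for all $k,l$ with $H^*(m_k)\le\frac12<H^*(m_l)$; 3. $H^*(m_k)-\frac1{p_k}>\frac12$ whenever $H^*(m_k)>\frac12$; 4. for each $k$, either $H^*(m_k)<0$ or $H^*(m_k)>\frac12$. Write $\alpha_k(\epsilon)=\alpha(\epsilon,H^*(m_k))$ and $\theta_k=H^*(m_k)\vee\frac12$. **Proposition.** (a) For every $p\in[1,q]$ and all $i,j\in\{1,\dots,N\}$ there is a constant $C$ such that for all $\epsilon\in(0,1]$ and $t\ge0$ $$\Big\|\alpha_i(\epsilon)\alpha_j(\epsilon)\int_0^t\int_0^sG_i(y^\epsilon_s)G_j(y^\epsilon_r)\,dr\,ds\Big\|_{L^p}\le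 C\,t^{\theta_i+\theta_j}.$$ (b) Consequently, let $T>0$ and $\frac13<\gamma<\min_{1\le k\le N}\theta_k-\frac1{2q}$. For $\epsilon\in(0,1]$ let $$X^{k,\epsilon}_t=\alpha_k(\epsilon)\int_0^tG_k(y^\epsilon_s)\,ds,\qquad \mathbb X^{i,j,\epsilon}_{s,t}=\int_s^t(X^{i,\epsilon}_v-X^{i,\epsilon}_s)\,dX^{j,\epsilon}_v=\alpha_i(\epsilon)\alpha_j(\epsilon)\int_s^t\int_s^vG_i(y^\epsilon_u)G_j(y^\epsilon_v)\,du\,dv .$$ Then $(X^\epsilon,\mathbb X^\epsilon)$ takes values in the rough path space $\mathscr C^\gamma([0,T];\mathbb R^N)$, the set of pairs $(X,\mathbb X)$ with $\mathbb X_{s,t}-\mathbb X_{s,u}-\mathbb X_{u,t}=(X_u-X_s)\otimes(X_t-X_u)$, $|X_t-X_s|\lesssim|t-s|^\gamma$ and $|\mathbb X_{s,t}|\lesssim|t-s|^{2\gamma}$, with the distance $$|X_0-Y_0|+\sup_{s\ne t}\frac{|(X_t-X_s)-(Y_t-Y_s)|}{|t-s|^\gamma}+\sup_{s\neq t}\frac{|\mathbb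 X_{s,t}-\mathbb Y_{s,t}|}{|t-s|^{2\gamma}},$$ and the family $\{(X^\epsilon,\mathbb X^\epsilon):\epsilon\in(0,1]\}$ is tight in $\mathscr C^\gamma([0,T];\mathbb R^N)$: for every $\delta>0$ there is a compact $K\subset\mathscr C^\gamma([0,T];\mathbb R^N)$ with $\mathbb P\big((X^\epsilon,\mathbb X^\epsilon)\notin K\big)\le\delta$ for all $\epsilon\in(0,1]$. -/

import Mathlib

open MeasureTheory ProbabilityTheory
open scoped ENNReal Nat

noncomputable section

/-- `H*(m) = m (H - 1) + 1`. -/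
def hStar (H : ℝ) (m : ℕ) : ℝ := m * (H - 1) + 1

/-- The monic (probabilists') Hermite polynomial of degree `l`, as a function on `ℝ`. -/
def hermiteFun (l : ℕ) (x : ℝ) : ℝ := Polynomial.aeval x (Polynomial.hermite l)

/-- The Hermite coefficient `c_l = ⟨G, H_l⟩ / l!`, the inner product being that of `L²(μ)`
with `μ = N(0,1)`. -/
def hermiteCoeff (G : ℝ → ℝ) (l : ℕ) : ℝ :=
  (1 / (l ! : ℝ)) * ∫ x, G x * hermiteFun l x ∂(gaussianReal 0 1)

/-- The Hermite rank of `G`: the smallest `m` with `c_m ≠ 0`. (If all coefficients vanish the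
value is `0`, so that `1 ≤ hermiteRank G` excludes this case as well as `c_0 ≠ 0`.) -/
def hermiteRank (G : ℝ → ℝ) : ℕ := sInf {m | hermiteCoeff G m ≠ 0}

/-- The scaling constant `α(ε, h)`, where `h` stands for `H*(m)`. -/
def scalingConst (ε h : ℝ) : ℝ :=
  if h < 1 / 2 then 1 / √ε
  else if h = 1 / 2 then 1 / √(ε * |Real.log ε|)
  else ε ^ (h - 1)

/-- The fast chaos decay condition with parameter `q`:
`G ∈ L²(μ)` and `∑ |c_l| √(l!) (2q - 1)^(l/2) < ∞`. -/
def FastChaosDecay (G : ℝ → ℝ) (q : ℕ) : Prop :=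
  MemLp G 2 (gaussianReal 0 1) ∧
    Summable fun l : ℕ => |hermiteCoeff G l| * √(l ! : ℝ) * (2 * (q : ℝ) - 1) ^ ((l : ℝ) / 2)

/-- The functional limit assumptions on `G_1, …, G_N`, with integrability exponents
`r_k ∈ (2, ∞]` and chaos decay parameter `q` (here `1/∞ = 0`). A function satisfying the chaos
decay condition is almost everywhere equal to a continuous one, and it is this continuous
representative that is considered. The index `k` is a high rank index if `H*(m_k) ≤ 1/2` and
a low rank index otherwise; a minimum over an empty set of indices imposes no condition. -/
structure MultiScaleAssumption (H : ℝ) {N : ℕ} (G : Fin N → ℝ → ℝ) (r : Fin N → ℝ≥0∞) (q : ℕ) :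
    Prop where
  continuous : ∀ k, Continuous (G k)
  two_lt : ∀ k, 2 < r k
  memLp : ∀ k, MemLp (G k) (r k) (gaussianReal 0 1)
  one_le_rank : ∀ k, 1 ≤ hermiteRank (G k)
  four_le : 4 ≤ q
  decay : ∀ k, FastChaosDecay (G k) q
  young : ∀ k l, hStar H (hermiteRank (G k)) ≤ 1 / 2 → 1 / 2 < hStar H (hermiteRank (G l)) →
    1 < (1 / 2 - (r k)⁻¹.toReal) + (hStar H (hermiteRank (G l)) - (r l)⁻¹.toReal)
  low_rank : ∀ k, 1 / 2 < hStar H (hermiteRank (G k)) →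
    1 / 2 < hStar H (hermiteRank (G k)) - (r k)⁻¹.toReal
  gap : ∀ k, hStar H (hermiteRank (G k)) < 0 ∨ 1 / 2 < hStar H (hermiteRank (G k))

/-- `B` is a two-sided fractional Brownian motion with Hurst parameter `H`: a continuous centred
Gaussian process indexed by `ℝ` with covariance `(|s|^{2H} + |t|^{2H} - |t - s|^{2H}) / 2`. -/
structure IsFractionalBrownianMotion {Ω : Type*} [MeasurableSpace Ω] (H : ℝ) (B : ℝ → Ω → ℝ)
    (P : Measure Ω) : Prop where
  measurable : ∀ t, Measurable (B t)
  continuous : ∀ ω, Continuous fun t => B t ω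
  gaussian : IsGaussianProcess B P
  mean_zero : ∀ t, ∫ ω, B t ω ∂P = 0
  covariance : ∀ s t, ∫ ω, B s ω * B t ω ∂P =
    (|s| ^ (2 * H) + |t| ^ (2 * H) - |t - s| ^ (2 * H)) / 2

/-- The stationary fractional Ornstein-Uhlenbeck process at speed `1/ε`,
`y^ε_t = σ ε^{-H} ∫_{-∞}^t e^{-(t-s)/ε} dB_s`. The integral of the smooth integrand against the
continuous path `B` is the pathwise Riemann-Stieltjes integral, that is, after integration by
parts, `B_t - ε⁻¹ ∫_{-∞}^t e^{-(t-s)/ε} B_s ds`. -/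
def fastFOU {Ω : Type*} (H σ ε : ℝ) (B : ℝ → Ω → ℝ) (t : ℝ) (ω : Ω) : ℝ :=
  σ / ε ^ H * (B t ω - (1 / ε) * ∫ s in Set.Iic t, Real.exp (-(t - s) / ε) * B s ω)

/-- `α_k(ε) = α(ε, H*(m_k))`, for `G_k` of Hermite rank `m_k`. -/
def alphaOf (H : ℝ) (g : ℝ → ℝ) (ε : ℝ) : ℝ := scalingConst ε (hStar H (hermiteRank g))

/-- The exponent `H*(m) ∨ 1/2`, where `m` is the Hermite rank of `g`. -/
def thetaOf (H : ℝ) (g : ℝ → ℝ) : ℝ := max (hStar H (hermiteRank g)) (1 / 2)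

/-- The space `𝒞^γ([0,T]; ℝ^N)` of rough paths `(X, 𝕏)` of regularity `γ`. The second order
process is indexed by all of `[0,T]²`, its values at `(t, s)` with `s < t` being determined by
those at `(s, t)` through Chen's relation. -/
@[ext]
structure RoughPath (N : ℕ) (T γ : ℝ) where
  path : Set.Icc (0 : ℝ) T → Fin N → ℝ
  area : Set.Icc (0 : ℝ) T → Set.Icc (0 : ℝ) T → Fin N → Fin N → ℝ
  chen : ∀ s u t i j, area s t i j - area s u i j - area u t i j =
    (path u i - path s i) * (path t j - path u j)
  holder_path : ∃ C : ℝ, ∀ s t, ‖path t - path s‖ ≤ C * |(t : ℝ) - s| ^ γ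
  holder_area : ∃ C : ℝ, ∀ s t, ‖area s t‖ ≤ C * |(t : ℝ) - s| ^ (2 * γ)

namespace RoughPath

variable {N : ℕ} {T γ : ℝ}

/-- The inhomogeneous `γ`-Hölder rough path distance
`|X_0 - Y_0| + sup_{s ≠ t} |X_{s,t} - Y_{s,t}| / |t-s|^γ
  + sup_{s ≠ t} |𝕏_{s,t} - 𝕐_{s,t}| / |t-s|^{2γ}`
(the distance of the initial values, which vanishes for paths that start at `0`, makes it
separate points; it is written as a supremum over the times equal to `0`). -/
def roughDist (X Y : RoughPath N T γ) : ℝ≥0∞ :=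
  (⨆ (s : Set.Icc (0 : ℝ) T) (_ : (s : ℝ) = 0), edist (X.path s) (Y.path s)) +
  (⨆ (s : Set.Icc (0 : ℝ) T) (t : Set.Icc (0 : ℝ) T) (_ : s ≠ t), edist (X.path t - X.path s) (Y.path t - Y.path s) /
    ENNReal.ofReal (|(t : ℝ) - s| ^ γ)) +
  (⨆ (s : Set.Icc (0 : ℝ) T) (t : Set.Icc (0 : ℝ) T) (_ : s ≠ t), edist (X.area s t) (Y.area s t) /
    ENNReal.ofReal (|(t : ℝ) - s| ^ (2 * γ)))

lemma roughDist_self (X : RoughPath N T γ) : roughDist X X = 0 := by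
  simp [roughDist]

lemma roughDist_comm (X Y : RoughPath N T γ) : roughDist X Y = roughDist Y X := by
  simp only [roughDist, edist_comm]

lemma roughDist_triangle (X Y Z : RoughPath N T γ) :
    roughDist X Z ≤ roughDist X Y + roughDist Y Z := by
  have key : ∀ a b c a' b' c' : ℝ≥0∞,
      a + b + c + (a' + b' + c') = (a + a') + (b + b') + (c + c') := by intros; abel
  unfold roughDist
  rw [key]
  refine add_le_add (add_le_add ?_ ?_) ?_
  · refine iSup₂_le fun s h => (edist_triangle _ (Y.path s) _).trans (add_le_add ?_ ?_)
    · exact le_iSup₂_of_le s h le_rfl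
    · exact le_iSup₂_of_le s h le_rfl
  · refine iSup_le fun s => iSup₂_le fun t h => ?_
    refine (ENNReal.div_le_div_right (edist_triangle _ (Y.path t - Y.path s) _) _).trans ?_
    rw [ENNReal.add_div]
    exact add_le_add (le_iSup_of_le s (le_iSup₂_of_le t h le_rfl))
      (le_iSup_of_le s (le_iSup₂_of_le t h le_rfl))
  · refine iSup_le fun s => iSup₂_le fun t h => ?_
    refine (ENNReal.div_le_div_right (edist_triangle _ (Y.area s t) _) _).trans ?_
    rw [ENNReal.add_div]
    exact add_le_add (le_iSup_of_le s (le_iSup₂_of_le t h le_rfl))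
      (le_iSup_of_le s (le_iSup₂_of_le t h le_rfl))

lemma area_self (X : RoughPath N T γ) (s : Set.Icc (0 : ℝ) T) : X.area s s = 0 := by
  ext i j
  have := X.chen s s s i j
  simp only [Pi.zero_apply]
  linarith

lemma eq_of_roughDist_eq_zero {X Y : RoughPath N T γ} (h : roughDist X Y = 0) : X = Y := by
  simp only [roughDist, add_eq_zero, ENNReal.iSup_eq_zero, ENNReal.div_eq_zero_iff,
    ENNReal.ofReal_ne_top, or_false, edist_eq_zero] at h
  obtain ⟨⟨h0, h1⟩, h2⟩ := h
  refine RoughPath.ext ?_ ?_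
  · funext t
    have hz : (0 : ℝ) ∈ Set.Icc (0 : ℝ) T := ⟨le_rfl, t.2.1.trans t.2.2⟩
    have e0 := h0 ⟨0, hz⟩ rfl
    by_cases ht : (⟨0, hz⟩ : Set.Icc (0 : ℝ) T) = t
    · rw [← ht]; exact e0
    · have e1 := h1 _ _ ht
      rw [e0] at e1
      exact sub_left_injective e1
  · funext s t
    by_cases hst : s = t
    · subst hst; rw [area_self, area_self]
    · exact h2 _ _ hst

instance : EMetricSpace (RoughPath N T γ) where
  edist := roughDist
  edist_self := roughDist_self
  edist_comm := roughDist_comm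
  edist_triangle := roughDist_triangle
  eq_of_edist_eq_zero := eq_of_roughDist_eq_zero

end RoughPath

/-- Tightness of a family of random elements of a topological space `S`: for every `δ > 0` there
is a compact set outside of which every member of the family lies with probability at most `δ`
(`P` of the complement being the outer measure, no measurability issue arises). -/
def IsTightFamily {Ω ι S : Type*} [MeasurableSpace Ω] [TopologicalSpace S] (P : Measure Ω)
    (X : ι → Ω → S) : Prop :=
  ∀ δ : ℝ≥0∞, 0 < δ → ∃ K : Set S, IsCompact K ∧ ∀ e, P {ω | X e ω ∉ K} ≤ δ

end

/-! ### Polynomials in independent standard Gaussian variables -/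

/-! By self-similarity of `B`, the process `t ↦ y^ε` at time `ε t + d` is a stationary Gaussian
process whose law depends neither on `ε` nor on `d`, and `α_k(ε) ε ((t-s)/ε)^{θ_k} = (t-s)^{θ_k}`.
Everything reduces to the growth in `T` of moments of single and iterated integrals over `[0,T]` of
functions of one unit-speed process (`IsFOULike`). Representing it by a curve in `L²(ℝ)` of
Mandelbrot-Van Ness type gives two decay estimates: the projection of its value at `t` on the past
up to `s` has norm `O((t-s)^{H-1})`, and for `H > 1/2` correlations are `O(|t-s|^{2H-2})`.

Inequalities are proved for finitely many times and passed to the limit by Fatou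
(`LpBdd.of_tendsto`). Gram-Schmidt (`exists_cholesky`) transports the problem to a standard Gaussian
vector, where chaos elements are polynomials and conditioning on the past is conditioning on the
first coordinates. Gaussian integration by parts gives hypercontractivity
(`expect_wickSum_rpow_le`), and fast chaos decay allows the chaoses to be summed in `L^{2q}`.

Low rank, `H* > 1/2`: hypercontractivity reduces the norm to a variance, a double integral of
`|t-s|^{m(2H-2)} = |t-s|^{2H*-2}`, which is of order `T^{2H*}`. High rank, `H* < 0`: cut time into
blocks of length about one. Conditioning a Wick power of degree `l ≥ m` replaces its vector by the
projection on the past, so conditional expectations of blocks decay like `j^{m(H-1)}`, a summable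
sequence because `H* < 0`. Block sums are then martingales up to a bounded remainder, which gives
`√T`; summation by parts makes the iterated sum a martingale transform plus a sum of bounded
products, which gives `T` (`bdd_iterated_sum`).

If both ranks are high this bounds the iterated integral. Otherwise `θ_i + θ_j > 1`, and halving the
interval with Chen's relation, as in the sewing lemma, derives the iterated bound from the two
single ones (`exists_lpBdd_iterInt_of_one_lt`).

For (b), Markov's inequality at dyadic times and a chaining argument that respects Chen's relation
bound a `g`-Hölder norm with some `g > γ`, uniformly in `ε`. Balls for that norm are compact in the
`γ`-distance by an Arzelà-Ascoli argument (`isCompact_holderBall`). -/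

lemma integrable_pow_gaussianReal (k : ℕ) : Integrable (fun x : ℝ => x ^ k) (gaussianReal 0 1) := by
  rcases Nat.eq_zero_or_pos k with rfl | hk
  · simp
  have h := (memLp_id_gaussianReal (μ := 0) (v := 1) (k : NNReal)).integrable_norm_pow hk.ne'
  exact h.mono' (by fun_prop) (ae_of_all _ fun x => (norm_pow x k).le)

/-- The density satisfies `φ' = -x φ`, so integration by parts moves the extra factor `x` onto a
derivative of `x ^ (k + 1)`. -/
lemma integral_pow_add_two_gaussianReal (k : ℕ) :
    ∫ x, x ^ (k + 1) * x ∂(gaussianReal 0 1) = (k + 1) * ∫ x, x ^ k ∂(gaussianReal 0 1) := by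
  have hi : ∀ k : ℕ, Integrable (fun x : ℝ => x ^ k * gaussianPDFReal 0 1 x) := by
    intro k
    have h := integrable_pow_gaussianReal k
    rw [gaussianReal_of_var_ne_zero _ one_ne_zero,
      integrable_withDensity_iff (measurable_gaussianPDF 0 1) (ae_of_all _ fun x => gaussianPDF_lt_top)] at h
    simpa [toReal_gaussianPDF] using h
  simp only [integral_gaussianReal_eq_integral_smul one_ne_zero, smul_eq_mul]
  have hd : ∀ x, HasDerivAt (gaussianPDFReal 0 1) (-x * gaussianPDFReal 0 1 x) x := by
    intro x
    have h1 : HasDerivAt (fun x : ℝ => -x ^ 2 / 2) (-x) x := by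
      have := ((hasDerivAt_id x).pow 2).neg.div_const 2
      convert! this using 1
      simp only [id_eq, Nat.cast_ofNat]; ring
    have := (h1.exp).const_mul ((√(2 * Real.pi))⁻¹)
    convert! this using 1
    · ext y; simp [gaussianPDFReal]
    · simp [gaussianPDFReal]; ring
  have hu : ∀ x : ℝ, HasDerivAt (fun x => x ^ (k + 1)) ((k + 1 : ℕ) * x ^ k) x :=
    fun x => by simpa using hasDerivAt_pow (k + 1) x
  have := integral_mul_deriv_eq_deriv_mul_of_integrable (u := fun x : ℝ => x ^ (k + 1))
    (v := gaussianPDFReal 0 1) (fun x _ => hu x) (fun x _ => hd x)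
    (by convert! (hi (k + 2)).neg using 1; ext x; simp; ring)
    (by convert! (hi k).const_mul ((k : ℝ) + 1) using 1; ext x; simp; ring) (hi (k + 1))
  calc ∫ x, gaussianPDFReal 0 1 x * (x ^ (k + 1) * x)
      = - ∫ x, x ^ (k + 1) * (-x * gaussianPDFReal 0 1 x) := by
        rw [← integral_neg]; congr 1; ext x; ring
    _ = ∫ x, ((k + 1 : ℕ) * x ^ k) * gaussianPDFReal 0 1 x := by rw [this, neg_neg]
    _ = _ := by rw [← integral_const_mul]; congr 1; ext x; push_cast; ring

/-- The standard Gaussian measure on `ι → ℝ`. -/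
noncomputable abbrev gaussPi (ι : Type*) [Fintype ι] : Measure (ι → ℝ) :=
  Measure.pi fun _ => gaussianReal 0 1

namespace GaussPoly

open MvPolynomial

variable {ι : Type*} [Fintype ι]

lemma eval_monomial_eq_prod (x : ι → ℝ) (s : ι →₀ ℕ) (a : ℝ) :
    eval x (monomial s a) = a * ∏ i, x i ^ s i := by
  rw [eval_monomial, Finsupp.prod_fintype]; simp

lemma integrable_eval (p : MvPolynomial ι ℝ) : Integrable (fun x => eval x p) (gaussPi ι) := by
  induction p using MvPolynomial.induction_on' with
  | monomial s a =>
    simp only [eval_monomial_eq_prod]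
    exact (Integrable.fintype_prod (f := fun i x => x ^ s i)
      fun i => integrable_pow_gaussianReal _).const_mul a
  | add p q hp hq => simp only [map_add]; exact hp.add hq

/-- The expectation of a polynomial in standard Gaussian variables. -/
noncomputable def expect : MvPolynomial ι ℝ →ₗ[ℝ] ℝ where
  toFun p := ∫ x, eval x p ∂gaussPi ι
  map_add' p q := by simpa using integral_add (integrable_eval p) (integrable_eval q)
  map_smul' c p := by simp [smul_eval, integral_const_mul]

lemma expect_apply (p : MvPolynomial ι ℝ) : expect p = ∫ x, eval x p ∂gaussPi ι := rfl

lemma expect_C_mul (c : ℝ) (p : MvPolynomial ι ℝ) : expect (C c * p) = c * expect p := by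
  rw [← smul_eq_C_mul, map_smul, smul_eq_mul]

lemma expect_one : expect (1 : MvPolynomial ι ℝ) = 1 := by simp [expect_apply]

lemma expect_monomial (s : ι →₀ ℕ) (a : ℝ) :
    expect (monomial s a) = a * ∏ i, ∫ x, x ^ s i ∂(gaussianReal 0 1) := by
  simp only [expect_apply, eval_monomial_eq_prod, integral_const_mul]
  rw [integral_fintype_prod_eq_prod (fun i x => x ^ s i)]

/-- Gaussian integration by parts. -/
lemma expect_X_mul (i : ι) (p : MvPolynomial ι ℝ) : expect (X i * p) = expect (pderiv i p) := by
  classical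
  induction p using MvPolynomial.induction_on' with
  | monomial s a =>
    rw [pderiv_monomial, X, monomial_mul, one_mul, expect_monomial, expect_monomial,
      ← Finset.mul_prod_erase _ _ (Finset.mem_univ i),
      ← Finset.mul_prod_erase (a := i) _ _ (Finset.mem_univ i)]
    have h : ∀ j ∈ Finset.univ.erase i, (Finsupp.single i 1 + s : ι →₀ ℕ) j = (s - Finsupp.single i 1 : ι →₀ ℕ) j := by
      intro j hj
      simp [(Finset.ne_of_mem_erase hj).symm]
    rw [Finset.prod_congr rfl fun j hj => by rw [h j hj]]
    simp only [Finsupp.coe_add, Pi.add_apply, Finsupp.single_eq_same, Finsupp.coe_tsub,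
      Pi.sub_apply]
    -- For exponent `0` the truncated subtraction is harmless: the left side contains the vanishing
    -- first moment, the right side the factor `s i = 0`.
    rcases hs : s i with _ | k
    · simp [integral_id_gaussianReal]
    · have e : ∫ x, x ^ (1 + (k + 1)) ∂(gaussianReal 0 1) =
          (k + 1) * ∫ x, x ^ k ∂(gaussianReal 0 1) := by
        rw [← integral_pow_add_two_gaussianReal]
        congr 1; ext x; ring
      rw [e]
      simp; ring
  | add p q hp hq => rw [mul_add, map_add, map_add, map_add, hp, hq]

/-- The linear form `x ↦ ⟨u, x⟩`. -/
noncomputable def lin (u : ι → ℝ) : MvPolynomial ι ℝ := ∑ a, C (u a) * X a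

lemma eval_lin (u x : ι → ℝ) : eval x (lin u) = u ⬝ᵥ x := by simp [lin, dotProduct]

lemma pderiv_lin (u : ι → ℝ) (a : ι) : pderiv a (lin u) = C (u a) := by
  classical
  simp [lin, pderiv_X, Pi.single_apply]

lemma expect_lin_mul (u : ι → ℝ) (p : MvPolynomial ι ℝ) :
    expect (lin u * p) = ∑ a, u a * expect (pderiv a p) := by
  simp only [lin, Finset.sum_mul, map_sum, mul_assoc, expect_C_mul, expect_X_mul]

/-- The Wick power `:⟨u, x⟩ ^ n:`, i.e. the Hermite polynomial with variance `⟨u, u⟩`. -/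
noncomputable def wick (u : ι → ℝ) : ℕ → MvPolynomial ι ℝ
  | 0 => 1
  | 1 => lin u
  | (n + 2) => lin u * wick u (n + 1) - C ((n + 1 : ℝ) * (u ⬝ᵥ u)) * wick u n

lemma wick_zero (u : ι → ℝ) : wick u 0 = 1 := by rw [wick]

/-- One recursion for all `n`: at `n = 0` the truncated index `n - 1` comes with coefficient `0`. -/
lemma wick_succ (u : ι → ℝ) (n : ℕ) :
    wick u (n + 1) = lin u * wick u n - C ((n : ℝ) * (u ⬝ᵥ u)) * wick u (n - 1) := by
  cases n with
  | zero => simp [wick]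
  | succ n => rw [wick]; simp

lemma pderiv_wick_succ (u : ι → ℝ) (a : ι) (n : ℕ) :
    pderiv a (wick u (n + 1)) = C ((n + 1 : ℝ) * u a) * wick u n := by
  induction n using Nat.strong_induction_on with
  | _ n ih =>
    rcases n with _ | _ | n
    · simp [wick, pderiv_lin]
    · have h1 : wick u 1 = lin u := by rw [wick]
      rw [wick_succ]
      simp [wick_zero, h1, pderiv_lin]
      ring
    · rw [wick_succ u (n + 1 + 1), map_sub, pderiv_mul, pderiv_C_mul, ih (n + 1) (by omega),
        pderiv_lin, show n + 1 + 1 - 1 = n + 1 from rfl, ih n (by omega)]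
      have := wick_succ u (n + 1)
      simp only [Nat.add_sub_cancel] at this
      rw [this]
      simp only [map_mul, map_add, map_natCast, Nat.cast_add, Nat.cast_one, map_one]
      ring

lemma pderiv_wick (u : ι → ℝ) (a : ι) (n : ℕ) :
    pderiv a (wick u n) = C ((n : ℝ) * u a) * wick u (n - 1) := by
  cases n with
  | zero => simp [wick_zero]
  | succ n => rw [pderiv_wick_succ]; simp

/-- Integrate by parts against the factor `lin u` of the recursion: the derivative that falls on
`wick u n` produces exactly the correction term and cancels, so only the derivative of `p` remains.
Orthogonality of the chaoses and hypercontractivity both come from this identity. -/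
lemma expect_wick_succ_mul (u : ι → ℝ) (n : ℕ) (p : MvPolynomial ι ℝ) :
    expect (wick u (n + 1) * p) = ∑ a, u a * expect (wick u n * pderiv a p) := by
  have h : ∀ a, u a * expect (pderiv a (wick u n * p)) =
      n * expect (wick u (n - 1) * p) * (u a * u a) + u a * expect (wick u n * pderiv a p) := by
    intro a
    rw [pderiv_mul, map_add, pderiv_wick, mul_assoc, expect_C_mul]
    ring
  rw [wick_succ, sub_mul, map_sub, mul_assoc, expect_lin_mul, mul_assoc, expect_C_mul,
    Finset.sum_congr rfl fun a _ => h a, Finset.sum_add_distrib, ← Finset.mul_sum]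
  simp only [dotProduct]
  ring

lemma expect_wick_succ (u : ι → ℝ) (n : ℕ) : expect (wick u (n + 1)) = 0 := by
  have := expect_wick_succ_mul u n 1
  simpa using this

lemma expect_wick_mul_wick (u v : ι → ℝ) (n : ℕ) :
    expect (wick u n * wick v n) = n ! * (u ⬝ᵥ v) ^ n := by
  induction n with
  | zero => simp [wick_zero, expect_one]
  | succ n ih =>
    rw [expect_wick_succ_mul]
    have h : ∀ a, u a * expect (wick u n * pderiv a (wick v (n + 1))) =
        ((n + 1) * expect (wick u n * wick v n)) * (u a * v a) := by
      intro a
      rw [pderiv_wick_succ, mul_left_comm, expect_C_mul]; ring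
    rw [Finset.sum_congr rfl fun a _ => h a, ← Finset.mul_sum, ih, Nat.factorial_succ]
    simp only [dotProduct]
    push_cast; ring

lemma expect_wick_mul_wick_of_lt (u v : ι → ℝ) {m n : ℕ} (h : m < n) :
    expect (wick u n * wick v m) = 0 := by
  induction m generalizing n with
  | zero =>
    obtain ⟨n, rfl⟩ := Nat.exists_eq_add_of_lt h
    simp only [wick_zero, mul_one, zero_add, expect_wick_succ]
  | succ m ih =>
    obtain ⟨n, rfl⟩ : ∃ k, n = k + 1 := ⟨n - 1, by omega⟩
    rw [expect_wick_succ_mul]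
    refine Finset.sum_eq_zero fun a _ => ?_
    rw [pderiv_wick_succ, mul_left_comm, expect_C_mul, ih (by omega)]; simp

/-- A linear combination of Wick powers of degree `n`. -/
noncomputable def wickSum {κ : Type*} [Fintype κ] (w : κ → ℝ) (u : κ → ι → ℝ) (n : ℕ) :
    MvPolynomial ι ℝ := ∑ i, C (w i) * wick (u i) n

lemma pderiv_wickSum_succ {κ : Type*} [Fintype κ] (w : κ → ℝ) (u : κ → ι → ℝ) (n : ℕ) (a : ι) :
    pderiv a (wickSum w u (n + 1)) = C (n + 1 : ℝ) * wickSum (fun i => w i * u i a) u n := by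
  simp only [wickSum, map_sum, pderiv_C_mul, pderiv_wick_succ, Finset.mul_sum]
  refine Finset.sum_congr rfl fun i _ => ?_
  simp only [map_mul]; ring

/-- Apply the previous integration by parts to one factor `F`. With `E_a` the chaos element of
degree `n` and weights `w i * u i a`, one has `∂_a F = (n + 1) E_a`, and the second `E_a` comes from
the factor that was integrated by parts. The result contains squares, to which Hölder applies
without loss of sign. -/
lemma expect_wickSum_pow {κ : Type*} [Fintype κ] (w : κ → ℝ) (u : κ → ι → ℝ) (n k : ℕ) :
    expect (wickSum w u (n + 1) ^ (k + 2)) = (k + 1) * (n + 1) *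
      ∑ a, expect (wickSum w u (n + 1) ^ k * wickSum (fun i => w i * u i a) u n ^ 2) := by
  set F := wickSum w u (n + 1) with hF
  have h : ∀ i, expect (C (w i) * wick (u i) (n + 1) * F ^ (k + 1)) =
      ∑ a, (k + 1) * (n + 1) * expect (F ^ k *
        wickSum (fun i => w i * u i a) u n * (C (w i * u i a) * wick (u i) n)) := by
    intro i
    rw [mul_assoc, expect_C_mul, expect_wick_succ_mul, Finset.mul_sum]
    refine Finset.sum_congr rfl fun a _ => ?_
    rw [pderiv_pow, hF, pderiv_wickSum_succ, ← hF]
    generalize wickSum (fun i => w i * u i a) u n = E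
    generalize wick (u i) n = W
    have : W * (((k + 1 : ℕ) : MvPolynomial ι ℝ) * F ^ (k + 1 - 1) * (C (n + 1 : ℝ) * E)) =
        C ((k + 1 : ℝ) * (n + 1)) * (F ^ k * E * W) := by
      rw [Nat.add_sub_cancel, C_mul, C_add (a := (k : ℝ)), C_1, Nat.cast_add, Nat.cast_one,
        map_natCast]
      ring
    rw [this, expect_C_mul, mul_left_comm _ (C _), expect_C_mul]
    ring
  have hs : ∀ (p : MvPolynomial ι ℝ) (w : κ → ℝ) (m : ℕ),
      ∑ i, expect (p * (C (w i) * wick (u i) m)) = expect (p * wickSum w u m) := by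
    intro p w m
    rw [wickSum, Finset.mul_sum, map_sum]
  have e : expect (F ^ (k + 2)) = ∑ i, expect (C (w i) * wick (u i) (n + 1) * F ^ (k + 1)) := by
    rw [Finset.sum_congr rfl fun i _ => by rw [mul_comm], hs, ← hF, ← pow_succ]
  rw [e, Finset.sum_congr rfl fun i _ => h i, Finset.sum_comm, Finset.mul_sum]
  refine Finset.sum_congr rfl fun a _ => ?_
  rw [← Finset.mul_sum, hs, mul_assoc (F ^ k), ← sq]

lemma expect_sq_nonneg (p : MvPolynomial ι ℝ) (k : ℕ) : 0 ≤ expect (p ^ (2 * k)) :=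
  integral_nonneg fun x => by simp only [map_pow, pow_mul]; positivity

/-- Hölder with exponents `q / (q - 1)` and `q`; only even powers occur, so no absolute values are
needed. -/
lemma expect_holder (p r : MvPolynomial ι ℝ) {q : ℕ} (hq : 2 ≤ q) :
    expect (p ^ (2 * (q - 1)) * r ^ 2) ≤
      expect (p ^ (2 * q)) ^ (1 - 1 / (q : ℝ)) * expect (r ^ (2 * q)) ^ (1 / (q : ℝ)) := by
  have hq' : (2 : ℝ) ≤ q := by exact_mod_cast hq
  have hc : (Real.conjExponent q).HolderConjugate q :=
    (Real.HolderConjugate.conjExponent (by linarith)).symm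
  have hmem : ∀ (p : MvPolynomial ι ℝ) (a : ℝ), 0 < a → MemLp (fun x => eval x p)
      (ENNReal.ofReal a) (gaussPi ι) := by
    intro p a ha
    obtain ⟨k, hk⟩ := exists_nat_ge a
    have hk0 : 0 < (k : ℝ) := ha.trans_le hk
    have : MemLp (fun x => eval x p) (k : ℝ≥0∞) (gaussPi ι) := by
      rw [← integrable_norm_rpow_iff (MvPolynomial.continuous_eval p).aestronglyMeasurable
        (by exact_mod_cast hk0.ne') (by simp)]
      convert! (integrable_eval (p ^ k)).norm using 1
      ext x
      simp
    refine this.mono_exponent ?_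
    rw [← ENNReal.ofReal_natCast]
    exact ENNReal.ofReal_le_ofReal hk
  have h := integral_mul_le_Lp_mul_Lq_of_nonneg (μ := gaussPi ι) hc
    (f := fun x => eval x (p ^ (2 * (q - 1)))) (g := fun x => eval x (r ^ 2))
    (ae_of_all _ fun x => by simp only [map_pow, pow_mul]; simp; positivity)
    (ae_of_all _ fun x => by simp; positivity) (hmem _ _ hc.pos) (hmem _ _ (by linarith))
  have e0 : expect (p ^ (2 * (q - 1)) * r ^ 2) =
      ∫ x, eval x (p ^ (2 * (q - 1))) * eval x (r ^ 2) ∂gaussPi ι := by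
    simp [expect_apply]
  have e1 : ∫ x, eval x (p ^ (2 * (q - 1))) ^ (Real.conjExponent q) ∂gaussPi ι =
      expect (p ^ (2 * q)) := by
    simp only [expect_apply, map_pow]
    congr 1; ext x
    rw [pow_mul, pow_mul, ← Real.rpow_natCast, ← Real.rpow_mul (by positivity),
      ← Real.rpow_natCast _ q]
    congr 1
    rw [Real.conjExponent, Nat.cast_sub (by omega)]
    push_cast
    field_simp [show (q : ℝ) - 1 ≠ 0 by linarith]
  have e2 : ∫ x, eval x (r ^ 2) ^ (q : ℝ) ∂gaussPi ι = expect (r ^ (2 * q)) := by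
    simp only [expect_apply, map_pow]
    congr 1; ext x
    rw [Real.rpow_natCast, pow_mul]
  have e3 : 1 / Real.conjExponent q = 1 - 1 / (q : ℝ) := by
    rw [Real.conjExponent]; field_simp
  rw [e0]
  rwa [e1, e2, e3] at h

/-- Hypercontractivity on the `n`-th Wiener chaos, for even exponents. -/
theorem expect_wickSum_rpow_le {κ : Type*} [Fintype κ] {q : ℕ} (hq : 1 ≤ q) (u : κ → ι → ℝ)
    (n : ℕ) (w : κ → ℝ) :
    expect (wickSum w u n ^ (2 * q)) ^ (1 / (q : ℝ)) ≤
      (2 * q - 1 : ℝ) ^ n * expect (wickSum w u n ^ 2) := by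
  have hq0 : (0 : ℝ) < q := by exact_mod_cast hq
  have hq1 : (1 : ℝ) ≤ q := by exact_mod_cast hq
  induction n generalizing w with
  | zero =>
    have h : wickSum w u 0 = C (∑ i, w i) := by simp [wickSum, wick_zero]
    rw [h, ← C_pow, ← C_pow, ← mul_one (C _), expect_C_mul, ← mul_one (C (_ ^ 2)), expect_C_mul,
      expect_one, pow_mul, mul_one, mul_one, ← Real.rpow_natCast, ← Real.rpow_mul (by positivity)]
    field_simp
    simp
  | succ n ih =>
    rcases eq_or_lt_of_le hq with rfl | hq2
    · norm_num
    set F := wickSum w u (n + 1) with hF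
    set A := expect (F ^ (2 * q)) with hA
    have hA0 : 0 ≤ A := expect_sq_nonneg F q
    -- The same identity with `k = 0` turns the sum of second moments back into the variance of `F`.
    have h2 : expect (F ^ 2) = (n + 1) * ∑ a, expect (wickSum (fun i => w i * u i a) u n ^ 2) := by
      have := expect_wickSum_pow w u n 0
      simpa using this
    have hpos : 0 ≤ (2 * q - 1 : ℝ) ^ (n + 1) * expect (F ^ 2) :=
      mul_nonneg (pow_nonneg (by linarith) _) (expect_sq_nonneg F 1)
    rcases hA0.eq_or_lt with hz | hApos
    · rw [← hz, Real.zero_rpow (by positivity)]; exact hpos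
    -- Each summand is bounded by Hölder and by the induction hypothesis for the weights `w i * u i
    -- a`. The factor `2 q - 1` is `k + 1` for `k = 2 (q - 1)`. Dividing by `A ^ (1 - 1 / q)` then
    -- closes the induction.
    have hkey : A ≤ A ^ (1 - 1 / (q : ℝ)) * ((2 * q - 1 : ℝ) ^ (n + 1) * expect (F ^ 2)) := by
      have h1 := expect_wickSum_pow w u n (2 * (q - 1))
      rw [show 2 * (q - 1) + 2 = 2 * q by omega, ← hF, ← hA] at h1
      rw [h2]
      have hc : ((2 * (q - 1) : ℕ) : ℝ) + 1 = 2 * q - 1 := by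
        rw [Nat.cast_mul, Nat.cast_sub hq]; push_cast; ring
      rw [hc] at h1
      have : ∑ a, expect (F ^ (2 * (q - 1)) * wickSum (fun i => w i * u i a) u n ^ 2) ≤
          ∑ a, A ^ (1 - 1 / (q : ℝ)) *
            ((2 * q - 1 : ℝ) ^ n * expect (wickSum (fun i => w i * u i a) u n ^ 2)) := by
        refine Finset.sum_le_sum fun a _ => (expect_holder _ _ hq2).trans ?_
        gcongr
        exact ih _
      rw [← Finset.mul_sum, ← Finset.mul_sum] at this
      calc A = _ := h1
        _ ≤ (2 * q - 1 : ℝ) * (n + 1) * _ :=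
            mul_le_mul_of_nonneg_left this (mul_nonneg (by linarith) (by positivity))
        _ = _ := by ring
    have e : A = A ^ (1 - 1 / (q : ℝ)) * A ^ (1 / (q : ℝ)) := by
      rw [← Real.rpow_add hApos]; simp
    have hp : 0 < A ^ (1 - 1 / (q : ℝ)) := Real.rpow_pos_of_pos hApos _
    refine le_of_mul_le_mul_left ?_ hp
    rw [← e]; exact hkey

end GaussPoly

/-! ### Conditional expectations of Wick powers -/

namespace GaussPoly

open MvPolynomial

variable {ι : Type*} [Fintype ι]

lemma lin_add (u v : ι → ℝ) : lin (u + v) = lin u + lin v := by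
  simp [lin, add_mul, Finset.sum_add_distrib]

/-- Absorption, `(n choose i) j = n (n - 1 choose i)` for `i + j = n`. It collects the correction
terms of the Wick recursion in the binomial formula. -/
lemma sum_antidiagonal_choose_mul_snd {R : Type*} [CommRing R] (f : ℕ → ℕ → R) (n : ℕ) :
    ∑ ij ∈ Finset.HasAntidiagonal.antidiagonal n, (n.choose ij.1 : R) * (ij.2 * f ij.1 (ij.2 - 1)) =
      n * ∑ ij ∈ Finset.HasAntidiagonal.antidiagonal (n - 1), ((n - 1).choose ij.1 : R) * f ij.1 ij.2 := by
  cases n with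
  | zero => simp
  | succ m =>
    rw [Finset.Nat.sum_antidiagonal_succ', Finset.mul_sum]
    simp only [Nat.cast_zero, zero_mul, mul_zero, zero_add, Nat.add_sub_cancel]
    refine Finset.sum_congr rfl fun ij hij => ?_
    have h := Nat.choose_mul_succ_eq m ij.1
    have h2 : m + 1 - ij.1 = ij.2 + 1 := by
      have := Finset.HasAntidiagonal.mem_antidiagonal.1 hij; omega
    rw [h2] at h
    have h3 : (m.choose ij.1 : R) * (m + 1 : ℕ) = (m + 1).choose ij.1 * (ij.2 + 1 : ℕ) := by
      rw [← Nat.cast_mul, ← Nat.cast_mul, h]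
    rw [← mul_assoc, ← h3]; ring

lemma sum_antidiagonal_choose_mul_fst {R : Type*} [CommRing R] (f : ℕ → ℕ → R) (n : ℕ) :
    ∑ ij ∈ Finset.HasAntidiagonal.antidiagonal n, (n.choose ij.2 : R) * (ij.1 * f (ij.1 - 1) ij.2) =
      n * ∑ ij ∈ Finset.HasAntidiagonal.antidiagonal (n - 1), ((n - 1).choose ij.2 : R) * f ij.1 ij.2 := by
  rw [← Finset.Nat.sum_antidiagonal_swap, ← Finset.Nat.sum_antidiagonal_swap (n := n - 1)]
  exact sum_antidiagonal_choose_mul_snd (fun i j => f j i) n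

lemma sum_antidiagonal_choose_symm {R : Type*} [CommRing R] (f : ℕ → ℕ → R) (n : ℕ) :
    ∑ ij ∈ Finset.HasAntidiagonal.antidiagonal n, (n.choose ij.2 : R) * f ij.1 ij.2 =
      ∑ ij ∈ Finset.HasAntidiagonal.antidiagonal n, (n.choose ij.1 : R) * f ij.1 ij.2 := by
  refine Finset.sum_congr rfl fun ij hij => ?_
  rw [Nat.choose_symm_of_eq_add (Finset.HasAntidiagonal.mem_antidiagonal.1 hij).symm]

/-- The binomial formula for Wick powers of orthogonal linear forms. -/
lemma wick_add {u v : ι → ℝ} (h : u ⬝ᵥ v = 0) (n : ℕ) :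
    wick (u + v) n =
      ∑ ij ∈ Finset.HasAntidiagonal.antidiagonal n, (n.choose ij.1 : MvPolynomial ι ℝ) *
        (wick u ij.1 * wick v ij.2) := by
  induction n using Nat.strong_induction_on with
  | _ n ih =>
    cases n with
    | zero => simp [wick_zero]
    | succ n =>
      have hs : (u + v) ⬝ᵥ (u + v) = u ⬝ᵥ u + v ⬝ᵥ v := by
        simp [add_dotProduct, dotProduct_add, h, dotProduct_comm v u]
      -- Pascal's rule splits the sum according to which of the two degrees is raised; the recursion
      -- is applied to the raised factor, and `hs` says that the variances of orthogonal forms add.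
      rw [Finset.sum_antidiagonal_choose_succ_mul (fun i j => wick u i * wick v j), wick_succ,
        ih n (by omega), ih (n - 1) (by omega), lin_add, hs]
      have h1 : ∑ ij ∈ Finset.HasAntidiagonal.antidiagonal n, (n.choose ij.1 : MvPolynomial ι ℝ) *
            (wick u ij.1 * wick v (ij.2 + 1)) =
          lin v * ∑ ij ∈ Finset.HasAntidiagonal.antidiagonal n, (n.choose ij.1 : MvPolynomial ι ℝ) *
            (wick u ij.1 * wick v ij.2) - C (v ⬝ᵥ v) * ((n : MvPolynomial ι ℝ) *
          ∑ ij ∈ Finset.HasAntidiagonal.antidiagonal (n - 1), ((n - 1).choose ij.1 : MvPolynomial ι ℝ) *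
            (wick u ij.1 * wick v ij.2)) := by
        rw [← sum_antidiagonal_choose_mul_snd (fun i j => wick u i * wick v j), Finset.mul_sum,
          Finset.mul_sum, ← Finset.sum_sub_distrib]
        refine Finset.sum_congr rfl fun ij _ => ?_
        rw [wick_succ v, C_mul, map_natCast]; ring
      have h2 : ∑ ij ∈ Finset.HasAntidiagonal.antidiagonal n, (n.choose ij.2 : MvPolynomial ι ℝ) *
            (wick u (ij.1 + 1) * wick v ij.2) =
          lin u * ∑ ij ∈ Finset.HasAntidiagonal.antidiagonal n, (n.choose ij.1 : MvPolynomial ι ℝ) *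
            (wick u ij.1 * wick v ij.2) - C (u ⬝ᵥ u) * ((n : MvPolynomial ι ℝ) *
          ∑ ij ∈ Finset.HasAntidiagonal.antidiagonal (n - 1), ((n - 1).choose ij.1 : MvPolynomial ι ℝ) *
            (wick u ij.1 * wick v ij.2)) := by
        rw [← sum_antidiagonal_choose_symm (fun i j => wick u i * wick v j) n,
          ← sum_antidiagonal_choose_symm (fun i j => wick u i * wick v j) (n - 1),
          ← sum_antidiagonal_choose_mul_fst (fun i j => wick u i * wick v j), Finset.mul_sum,
          Finset.mul_sum, ← Finset.sum_sub_distrib]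
        refine Finset.sum_congr rfl fun ij _ => ?_
        rw [wick_succ u, C_mul, map_natCast]; ring
      rw [h1, h2, C_mul, C_add, map_natCast]
      ring

/-- The σ-algebra generated by the coordinates in `S`. -/
@[reducible]
def coordSigma (S : Set ι) : MeasurableSpace (ι → ℝ) :=
  ⨆ i ∈ S, MeasurableSpace.comap (fun x : ι → ℝ => x i) inferInstance

lemma coordSigma_le {κ : Type*} (S : Set κ) :
    coordSigma S ≤ (MeasurableSpace.pi : MeasurableSpace (κ → ℝ)) :=
  iSup₂_le fun i _ => (measurable_pi_apply i).comap_le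

lemma coordSigma_mono {κ : Type*} {S T : Set κ} (h : S ⊆ T) : coordSigma S ≤ coordSigma T :=
  biSup_mono fun _ hi => h hi

lemma indep_coordSigma {S T : Set ι} (h : Disjoint S T) :
    Indep (coordSigma S) (coordSigma T) (gaussPi ι) := by
  have h1 : iIndepFun (fun (i : ι) (x : ι → ℝ) => x i) (gaussPi ι) :=
    iIndepFun_pi (X := fun _ (x : ℝ) => x) fun i => aemeasurable_id
  exact indep_iSup_of_disjoint (fun i => (measurable_pi_apply i).comap_le) h1 h

lemma measurable_eval_lin {S : Set ι} {u : ι → ℝ} (hu : ∀ i ∉ S, u i = 0) :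
    Measurable[coordSigma S] fun x => eval x (lin u) := by
  simp only [eval_lin, dotProduct]
  refine Finset.measurable_fun_sum _ fun i _ => ?_
  by_cases hi : i ∈ S
  · refine Measurable.const_mul ?_ _
    have h : Measurable[MeasurableSpace.comap (fun x : ι → ℝ => x i) inferInstance]
        fun x : ι → ℝ => x i := comap_measurable _
    exact h.mono (le_iSup₂_of_le i hi le_rfl) le_rfl
  · simp only [hu i hi, zero_mul]; exact measurable_const

lemma measurable_eval_wick {S : Set ι} {u : ι → ℝ} (hu : ∀ i ∉ S, u i = 0) (n : ℕ) :
    Measurable[coordSigma S] fun x => eval x (wick u n) := by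
  induction n using Nat.strong_induction_on with
  | _ n ih =>
    cases n with
    | zero => simp only [wick_zero, map_one]; exact measurable_const
    | succ n =>
      simp only [wick_succ, map_sub, map_mul, eval_C]
      exact ((measurable_eval_lin hu).mul (ih n (by omega))).sub
        ((ih (n - 1) (by omega)).const_mul _)

/-- Conditioning a Wick power on some of the coordinates. -/
theorem condExp_wick (S : Set ι) (u : ι → ℝ) (n : ℕ) :
    (gaussPi ι)[fun x => eval x (wick u n) | coordSigma S] =ᵐ[gaussPi ι]
      fun x => eval x (wick (S.indicator u) n) := by
  classical
  set v := S.indicator u with hv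
  set w := Sᶜ.indicator u with hw
  have hvw : v + w = u := Set.indicator_self_add_compl S u
  have horth : v ⬝ᵥ w = 0 := by
    refine Finset.sum_eq_zero fun i _ => ?_
    by_cases hi : i ∈ S <;> simp [hv, hw, hi]
  have hvS : ∀ i ∉ S, v i = 0 := fun i hi => Set.indicator_of_notMem hi _
  have hwS : ∀ i ∉ Sᶜ, w i = 0 := fun i hi => Set.indicator_of_notMem hi _
  -- With `u = v + w` split along `S` and its complement, each term of the binomial formula is a
  -- product of a factor measurable in the coordinates of `S` and an independent one.
  have e : (fun x => eval x (wick u n)) = ∑ ij ∈ Finset.HasAntidiagonal.antidiagonal n,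
      (fun x => eval x (wick v ij.1)) *
        fun x => eval x (C (n.choose ij.1 : ℝ) * wick w ij.2) := by
    ext x
    rw [← hvw, wick_add horth, map_sum, Finset.sum_apply]
    refine Finset.sum_congr rfl fun ij _ => ?_
    simp; ring
  have hterm : ∀ ij ∈ Finset.HasAntidiagonal.antidiagonal n,
      (gaussPi ι)[(fun x => eval x (wick v ij.1)) *
        (fun x => eval x (C (n.choose ij.1 : ℝ) * wick w ij.2)) | coordSigma S] =ᵐ[gaussPi ι]
      fun x => eval x (wick v ij.1) * expect (C (n.choose ij.1 : ℝ) * wick w ij.2) := by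
    intro ij _
    have hm := measurable_eval_wick hvS ij.1
    have hm2 : Measurable[coordSigma Sᶜ] fun x => eval x (C (n.choose ij.1 : ℝ) * wick w ij.2) := by
      simp only [map_mul, eval_C]
      exact (measurable_eval_wick hwS ij.2).const_mul _
    have h1 := condExp_mul_of_stronglyMeasurable_left (μ := gaussPi ι) hm.stronglyMeasurable
      (g := fun x => eval x (C (n.choose ij.1 : ℝ) * wick w ij.2))
      (by
        have := integrable_eval (wick v ij.1 * (C (n.choose ij.1 : ℝ) * wick w ij.2))
        simp only [map_mul (eval _) (wick v ij.1)] at this; exact this)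
      (integrable_eval _)
    have h2 := condExp_indep_eq (μ := gaussPi ι) (coordSigma_le Sᶜ) (coordSigma_le S)
      hm2.stronglyMeasurable (indep_coordSigma disjoint_compl_left)
    filter_upwards [h1, h2] with x hx1 hx2
    rw [hx1, Pi.mul_apply, hx2]; rfl
  have hsum := condExp_finsetSum (μ := gaussPi ι) (m := coordSigma S) (s := Finset.HasAntidiagonal.antidiagonal n)
    (f := fun ij => (fun x => eval x (wick v ij.1)) *
        fun x => eval x (C (n.choose ij.1 : ℝ) * wick w ij.2))
    (fun ij _ => by
        have := integrable_eval (wick v ij.1 * (C (n.choose ij.1 : ℝ) * wick w ij.2))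
        simp only [map_mul (eval _) (wick v ij.1)] at this; exact this)
  rw [e]
  have hall : ∀ᵐ x ∂gaussPi ι, ∀ ij ∈ Finset.HasAntidiagonal.antidiagonal n,
      ((gaussPi ι)[(fun x => eval x (wick v ij.1)) *
        (fun x => eval x (C (n.choose ij.1 : ℝ) * wick w ij.2)) | coordSigma S]) x =
      eval x (wick v ij.1) * expect (C (n.choose ij.1 : ℝ) * wick w ij.2) :=
    (ae_ball_iff (Finset.HasAntidiagonal.antidiagonal n).countable_toSet).2 hterm
  filter_upwards [hsum, hall] with x hx1 hx2
  -- Wick powers of positive degree have mean zero, so only the last term, of degree `0` in `w`,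
  -- survives.
  rw [hx1, Finset.sum_apply, Finset.sum_congr rfl fun ij hij => hx2 ij hij,
    Finset.Nat.sum_antidiagonal_eq_sum_range_succ_mk, Finset.sum_range_succ,
    Finset.sum_eq_zero, zero_add]
  · simp [wick_zero, expect_one]
  · intro k hk
    obtain ⟨j, hj⟩ : ∃ j, n - k = j + 1 := ⟨n - k - 1, by have := Finset.mem_range.1 hk; omega⟩
    rw [hj, expect_C_mul, expect_wick_succ, mul_zero, mul_zero]

end GaussPoly

/-! ### Hermite expansions -/

lemma derivative_hermite_succ (n : ℕ) :
    Polynomial.derivative (Polynomial.hermite (n + 1)) = (n + 1) * Polynomial.hermite n := by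
  induction n with
  | zero => simp
  | succ n ih =>
    rw [Polynomial.hermite_succ (n + 1), Polynomial.derivative_sub, Polynomial.derivative_mul, ih]
    have h : Polynomial.derivative (((n : Polynomial ℤ) + 1) * Polynomial.hermite n) =
        ((n : Polynomial ℤ) + 1) * Polynomial.derivative (Polynomial.hermite n) := by
      rw [Polynomial.derivative_mul]; simp
    rw [h, Polynomial.derivative_X, Polynomial.hermite_succ n]
    push_cast; ring

lemma hermiteFun_zero (x : ℝ) : hermiteFun 0 x = 1 := by simp [hermiteFun]

lemma hermiteFun_succ (n : ℕ) (x : ℝ) :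
    hermiteFun (n + 1) x = x * hermiteFun n x - n * hermiteFun (n - 1) x := by
  cases n with
  | zero => simp [hermiteFun]
  | succ n =>
    rw [hermiteFun, Polynomial.hermite_succ, derivative_hermite_succ]
    simp [hermiteFun]

lemma continuous_hermiteFun (n : ℕ) : Continuous (hermiteFun n) :=
  Polynomial.continuous_aeval _

namespace GaussPoly

open MvPolynomial

variable {ι : Type*} [Fintype ι]

lemma eval_wick {u : ι → ℝ} (hu : u ⬝ᵥ u = 1) (n : ℕ) (x : ι → ℝ) :
    eval x (wick u n) = hermiteFun n (u ⬝ᵥ x) := by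
  induction n using Nat.strong_induction_on with
  | _ n ih =>
    cases n with
    | zero => simp [wick_zero, hermiteFun_zero]
    | succ n =>
      rw [wick_succ, hermiteFun_succ, map_sub, map_mul, map_mul, eval_lin, ih n (by omega),
        ih (n - 1) (by omega), eval_C, hu, mul_one]

lemma expect_sq_wickSum_single (u : ι → ℝ) (n : ℕ) (c : ℝ) :
    expect (wickSum (fun _ : Unit => c) (fun _ => u) n ^ 2) = c ^ 2 * (n ! * (u ⬝ᵥ u) ^ n) := by
  have : wickSum (fun _ : Unit => c) (fun _ => u) n ^ 2 =
      C (c ^ 2) * (wick u n * wick u n) := by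
    simp [wickSum]; ring
  rw [this, expect_C_mul, expect_wick_mul_wick]

lemma eLpNorm_eval_eq (p : MvPolynomial ι ℝ) {q : ℕ} (hq : 1 ≤ q) :
    eLpNorm (fun x => eval x p) (2 * q : ℕ) (gaussPi ι) =
      ENNReal.ofReal (expect (p ^ (2 * q)) ^ (1 / (2 * q : ℝ))) := by
  have h0 : ((2 * q : ℕ) : ℝ≥0∞) ≠ 0 := by simp; omega
  have hm : MemLp (fun x => eval x p) (2 * q : ℕ) (gaussPi ι) := by
    rw [← integrable_norm_rpow_iff (MvPolynomial.continuous_eval p).aestronglyMeasurable h0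
      (ENNReal.natCast_ne_top _)]
    convert! (integrable_eval (p ^ (2 * q))).norm using 1
    ext x
    rw [ENNReal.toReal_natCast, Real.rpow_natCast, map_pow, norm_pow]
  rw [hm.eLpNorm_eq_integral_rpow_norm h0 (ENNReal.natCast_ne_top _)]
  congr 2
  · rw [expect_apply]
    congr 1; ext x
    rw [ENNReal.toReal_natCast, Real.rpow_natCast, Real.norm_eq_abs, pow_mul, sq_abs, map_pow,
      pow_mul]
  · simp

/-- Hypercontractivity for `L^{2q}` norms. -/
theorem eLpNorm_wickSum_le {κ : Type*} [Fintype κ] {q : ℕ} (hq : 1 ≤ q) (u : κ → ι → ℝ)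
    (n : ℕ) (w : κ → ℝ) :
    eLpNorm (fun x => eval x (wickSum w u n)) (2 * q : ℕ) (gaussPi ι) ≤
      ENNReal.ofReal ((2 * q - 1 : ℝ) ^ ((n : ℝ) / 2) * √(expect (wickSum w u n ^ 2))) := by
  rw [eLpNorm_eval_eq _ hq]
  refine ENNReal.ofReal_le_ofReal ?_
  have h := expect_wickSum_rpow_le hq u n w
  have hq1 : (1 : ℝ) ≤ q := by exact_mod_cast hq
  have h0 : 0 ≤ expect (wickSum w u n ^ (2 * q)) := expect_sq_nonneg _ _
  have h1 := Real.sqrt_le_sqrt h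
  rw [Real.sqrt_mul (pow_nonneg (by linarith) _)] at h1
  convert! h1 using 1
  · rw [Real.sqrt_eq_rpow, ← Real.rpow_mul h0]
    congr 1; field_simp
  · rw [Real.sqrt_eq_rpow ((2 * q - 1 : ℝ) ^ n), ← Real.rpow_natCast,
      ← Real.rpow_mul (by linarith)]
    congr 2; ring

lemma eLpNorm_wick_le {q : ℕ} (hq : 1 ≤ q) (u : ι → ℝ) (n : ℕ) :
    eLpNorm (fun x => eval x (wick u n)) (2 * q : ℕ) (gaussPi ι) ≤
      ENNReal.ofReal ((2 * q - 1 : ℝ) ^ ((n : ℝ) / 2) * √(n ! : ℝ) * √(u ⬝ᵥ u) ^ n) := by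
  have h := eLpNorm_wickSum_le hq (fun _ : Unit => u) n (fun _ => (1 : ℝ))
  rw [expect_sq_wickSum_single] at h
  have e : wickSum (fun _ : Unit => (1 : ℝ)) (fun _ => u) n = wick u n := by simp [wickSum]
  rw [e, one_pow, one_mul, Real.sqrt_mul (by positivity), ← mul_assoc] at h
  convert! h using 3
  rw [Real.sqrt_eq_rpow, Real.sqrt_eq_rpow, ← Real.rpow_natCast, ← Real.rpow_natCast,
    ← Real.rpow_mul, ← Real.rpow_mul, mul_comm]
  · exact Finset.sum_nonneg fun i _ => mul_self_nonneg _
  · exact Finset.sum_nonneg fun i _ => mul_self_nonneg _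

end GaussPoly

-- For a unit vector Wick powers are Hermite polynomials; with a one-point index set this is
-- hypercontractivity in dimension one.
open GaussPoly in
lemma eLpNorm_hermiteFun_le {q : ℕ} (hq : 1 ≤ q) (n : ℕ) :
    eLpNorm (hermiteFun n) (2 * q : ℕ) (gaussianReal 0 1) ≤
      ENNReal.ofReal ((2 * q - 1 : ℝ) ^ ((n : ℝ) / 2) * √(n ! : ℝ)) := by
  have h1 : (fun _ : Unit => (1 : ℝ)) ⬝ᵥ (fun _ => 1) = 1 := by simp [dotProduct]
  have h := eLpNorm_wick_le hq (fun _ : Unit => (1 : ℝ)) n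
  rw [h1] at h
  simp only [eval_wick h1, Real.sqrt_one, one_pow, mul_one] at h
  have hp := measurePreserving_eval (fun _ : Unit => gaussianReal 0 1) ()
  rw [← hp.map_eq, eLpNorm_map_measure (continuous_hermiteFun n).aestronglyMeasurable
    (measurable_pi_apply _).aemeasurable]
  convert! h using 2
  ext x; simp [dotProduct]

open GaussPoly in
lemma integral_hermiteFun_mul (m n : ℕ) :
    ∫ x, hermiteFun m x * hermiteFun n x ∂(gaussianReal 0 1) = if m = n then (n ! : ℝ) else 0 := by
  have h1 : (fun _ : Unit => (1 : ℝ)) ⬝ᵥ (fun _ => 1) = 1 := by simp [dotProduct]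
  have hp := measurePreserving_eval (fun _ : Unit => gaussianReal 0 1) ()
  have e : ∫ x, hermiteFun m x * hermiteFun n x ∂(gaussianReal 0 1) =
      expect (wick (fun _ : Unit => (1 : ℝ)) m * wick (fun _ : Unit => (1 : ℝ)) n) := by
    rw [← hp.map_eq, integral_map (measurable_pi_apply _).aemeasurable
      ((continuous_hermiteFun m).mul (continuous_hermiteFun n)).aestronglyMeasurable, expect_apply]
    congr 1; ext x
    rw [map_mul, eval_wick h1, eval_wick h1]; simp [dotProduct]
  rw [e]
  split_ifs with h
  · rw [h, expect_wick_mul_wick, h1]; simp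
  · rcases lt_or_gt_of_ne h with h | h
    · rw [mul_comm, expect_wick_mul_wick_of_lt _ _ h]
    · rw [expect_wick_mul_wick_of_lt _ _ h]

lemma memLp_hermiteFun (n : ℕ) (p : ℝ≥0∞) (hp : p ≠ ∞) :
    MemLp (hermiteFun n) p (gaussianReal 0 1) := by
  obtain ⟨q, hq⟩ := ENNReal.exists_nat_gt hp
  have : MemLp (hermiteFun n) (2 * (q + 1) : ℕ) (gaussianReal 0 1) :=
    ⟨(continuous_hermiteFun n).aestronglyMeasurable,
      (eLpNorm_hermiteFun_le (by omega) n).trans_lt ENNReal.ofReal_lt_top⟩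
  refine this.mono_exponent (hq.le.trans ?_)
  exact_mod_cast (by omega : q ≤ 2 * (q + 1))

/-- Supplies the dominating function when a Fourier transform against `γ` is expanded in powers. -/
lemma memLp_exp_abs_gaussianReal (t : ℝ) :
    MemLp (fun x => Real.exp (|t * x|)) 2 (gaussianReal 0 1) := by
  rw [memLp_two_iff_integrable_sq (by fun_prop)]
  have h := (integrable_exp_mul_gaussianReal (μ := 0) (v := 1) (2 * t)).add
    (integrable_exp_mul_gaussianReal (μ := 0) (v := 1) (-(2 * t)))
  refine h.mono' (by fun_prop) (ae_of_all _ fun x => ?_)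
  rw [Real.norm_of_nonneg (by positivity), ← Real.exp_nat_mul]
  simp only [Pi.add_apply]
  rcases abs_cases (t * x) with ⟨h, -⟩ | ⟨h, -⟩ <;> rw [h]
  · refine le_add_of_le_of_nonneg (le_of_eq ?_) (by positivity)
    congr 1; push_cast; ring
  · refine le_add_of_nonneg_of_le (by positivity) (le_of_eq ?_)
    congr 1; push_cast; ring

/-- A square integrable function that is orthogonal to all Hermite polynomials vanishes. -/
theorem ae_eq_zero_of_forall_integral_hermiteFun {f : ℝ → ℝ} (hf : MemLp f 2 (gaussianReal 0 1))
    (h : ∀ n, ∫ x, f x * hermiteFun n x ∂(gaussianReal 0 1) = 0) :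
    f =ᵐ[gaussianReal 0 1] 0 := by
  set γ := gaussianReal 0 1 with hγ
  have hpowmem : ∀ k : ℕ, MemLp (fun x : ℝ => x ^ k) 2 γ := by
    intro k
    rw [memLp_two_iff_integrable_sq (by fun_prop)]
    simpa [← pow_mul] using integrable_pow_gaussianReal (k * 2)
  have hHint : ∀ k n : ℕ, Integrable (fun x => f x * (x ^ k * hermiteFun n x)) γ := by
    intro k n
    have h4 : MemLp (fun x : ℝ => x ^ k) 4 γ := by
      rw [← integrable_norm_rpow_iff (by fun_prop) (by norm_num) (by norm_num)]
      have := (integrable_pow_gaussianReal (k * 4)).norm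
      simpa [pow_mul] using this
    have : ENNReal.HolderTriple 4 4 2 := ⟨by
      rw [← ENNReal.toReal_eq_toReal_iff' (by norm_num) (by norm_num),
        ENNReal.toReal_add (by norm_num) (by norm_num)]; norm_num⟩
    have h2 : MemLp (fun x => x ^ k * hermiteFun n x) 2 γ :=
      MemLp.mul (p := 4) (q := 4) (memLp_hermiteFun n 4 (by norm_num)) h4
    exact hf.integrable_mul h2
  -- The three-term recursion writes `x H_n` through `H_{n+1}` and `H_{n-1}`, so orthogonality to
  -- all `H_n` passes to all `x ^ k H_n`, and with `n = 0` to monomials.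
  have hpow : ∀ k n : ℕ, ∫ x, f x * (x ^ k * hermiteFun n x) ∂γ = 0 := by
    intro k
    induction k with
    | zero => simpa using h
    | succ k ih =>
      intro n
      have e : (fun x => f x * (x ^ (k + 1) * hermiteFun n x)) = fun x =>
          f x * (x ^ k * hermiteFun (n + 1) x) + n * (f x * (x ^ k * hermiteFun (n - 1) x)) := by
        ext x; rw [hermiteFun_succ]; ring
      rw [e, integral_add (hHint _ _) ((hHint _ _).const_mul _), integral_const_mul, ih, ih]
      simp
  have hfint : Integrable f γ := hf.integrable (by norm_num)
  -- The Fourier transform of `f γ` is a limit of combinations of moments, which vanish; domination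
  -- is by `|f| e^{|t x|}`.
  have hchar : ∀ t : ℝ, ∫ x, (f x : ℂ) * Complex.exp (t * x * Complex.I) ∂γ = 0 := by
    intro t
    have hlim : Filter.Tendsto (fun n : ℕ => ∫ x, (f x : ℂ) *
        ∑ k ∈ Finset.range n, (t * x * Complex.I) ^ k / (k ! : ℂ) ∂γ) Filter.atTop
        (nhds (∫ x, (f x : ℂ) * Complex.exp (t * x * Complex.I) ∂γ)) := by
      refine tendsto_integral_of_dominated_convergence
        (fun x => |f x| * Real.exp (|t * x|)) ?_ ?_ ?_ ?_
      · intro n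
        refine AEStronglyMeasurable.mul ?_ ?_
        · exact Complex.continuous_ofReal.comp_aestronglyMeasurable hf.1
        · exact Continuous.aestronglyMeasurable (by fun_prop)
      · exact hf.abs.integrable_mul (memLp_exp_abs_gaussianReal t)
      · intro n
        refine ae_of_all _ fun x => ?_
        rw [norm_mul, Complex.norm_real, Real.norm_eq_abs]
        refine mul_le_mul_of_nonneg_left ?_ (abs_nonneg _)
        refine (norm_sum_le _ _).trans ?_
        refine le_trans (le_of_eq ?_) (Real.sum_le_exp_of_nonneg (abs_nonneg (t * x)) n)
        refine Finset.sum_congr rfl fun k _ => ?_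
        simp [abs_mul]
      · refine ae_of_all _ fun x => Filter.Tendsto.const_mul _ ?_
        have := NormedSpace.expSeries_div_hasSum_exp (𝔸 := ℂ) (t * x * Complex.I)
        rw [← Complex.exp_eq_exp_ℂ] at this
        exact this.tendsto_sum_nat
    refine tendsto_nhds_unique hlim ?_
    refine tendsto_const_nhds.congr fun n => ?_
    symm
    have e : (fun x => (f x : ℂ) * ∑ k ∈ Finset.range n, (t * x * Complex.I) ^ k / (k ! : ℂ)) =
        fun x => ∑ k ∈ Finset.range n, ((t * Complex.I) ^ k / (k ! : ℂ)) *
          ((f x * (x ^ k * hermiteFun 0 x) : ℝ) : ℂ) := by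
      ext x
      rw [Finset.mul_sum]
      refine Finset.sum_congr rfl fun k _ => ?_
      rw [hermiteFun_zero]; push_cast; ring
    rw [e, integral_finsetSum _ fun k _ => ((hHint k 0).ofReal).const_mul _]
    refine Finset.sum_eq_zero fun k _ => ?_
    rw [integral_const_mul, integral_complex_ofReal, hpow]; simp
  -- A signed density is handled by comparing the finite measures with densities `f⁺` and `f⁻`: they
  -- have the same characteristic function, hence coincide.
  set νp := γ.withDensity (fun x => ENNReal.ofReal (f x)) with hνp
  set νm := γ.withDensity (fun x => ENNReal.ofReal (-f x)) with hνm
  have hfinp : IsFiniteMeasure νp :=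
    isFiniteMeasure_withDensity_ofReal hfint.2
  have hfinm : IsFiniteMeasure νm := isFiniteMeasure_withDensity_ofReal hfint.neg.2
  have hcf : ∀ g : ℝ → ℝ, MemLp g 2 γ → ∀ t : ℝ,
      charFun (γ.withDensity fun x => ENNReal.ofReal (g x)) t =
        ∫ x, ((max (g x) 0 : ℝ) : ℂ) * Complex.exp (t * x * Complex.I) ∂γ := by
    intro g hg t
    rw [charFun_apply_real, integral_withDensity_eq_integral_toReal_smul₀]
    · congr 1
    · exact hg.1.aemeasurable.ennreal_ofReal
    · exact ae_of_all _ fun x => ENNReal.ofReal_lt_top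
  have heq : νp = νm := by
    refine Measure.ext_of_charFun (funext fun t => ?_)
    rw [hνp, hνm, hcf f hf, hcf (fun x => -f x) hf.neg, ← sub_eq_zero, ← integral_sub]
    · rw [← hchar t]
      congr 1; ext x
      rw [← sub_mul]
      congr 1
      rw [← Complex.ofReal_sub]
      congr 1
      rcases le_total 0 (f x) with h | h
      · rw [max_eq_left h, max_eq_right (by linarith)]; ring
      · rw [max_eq_right h, max_eq_left (by linarith)]; ring
    · refine (hfint.pos_part.ofReal (𝕜 := ℂ)).mul_bdd (c := 1) (by fun_prop)
        (ae_of_all _ fun x => ?_)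
      rw [← Complex.ofReal_mul, Complex.norm_exp_ofReal_mul_I]
    · refine (hfint.neg.pos_part.ofReal (𝕜 := ℂ)).mul_bdd (c := 1) (by fun_prop)
        (ae_of_all _ fun x => ?_)
      rw [← Complex.ofReal_mul, Complex.norm_exp_ofReal_mul_I]
  have hae := (withDensity_eq_iff (hf.1.aemeasurable.ennreal_ofReal)
    (hf.1.aemeasurable.neg.ennreal_ofReal) hfint.lintegral_lt_top.ne).1 heq
  filter_upwards [hae] with x hx
  simp only [Pi.zero_apply]
  rcases lt_trichotomy (f x) 0 with h | h | h
  · rw [ENNReal.ofReal_of_nonpos h.le] at hx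
    have := ENNReal.ofReal_pos.2 (neg_pos.2 h)
    exact absurd hx.symm this.ne'
  · exact h
  · rw [Pi.neg_apply, ENNReal.ofReal_of_nonpos (neg_nonpos.2 h.le)] at hx
    exact absurd hx (ENNReal.ofReal_pos.2 h).ne'

lemma hermiteCoeff_eq_zero_of_lt {G : ℝ → ℝ} {l : ℕ} (h : l < hermiteRank G) :
    hermiteCoeff G l = 0 := by
  by_contra hne
  exact Nat.notMem_of_lt_sInf h hne

/-- The weights in the fast chaos decay condition. -/
noncomputable def chaosWeight (q l : ℕ) : ℝ := (2 * (q : ℝ) - 1) ^ ((l : ℝ) / 2) * √(l ! : ℝ)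

lemma chaosWeight_nonneg {q : ℕ} (hq : 1 ≤ q) (l : ℕ) : 0 ≤ chaosWeight q l := by
  have : (1 : ℝ) ≤ q := by exact_mod_cast hq
  exact mul_nonneg (Real.rpow_nonneg (by linarith) _) (Real.sqrt_nonneg _)

lemma FastChaosDecay.summable {G : ℝ → ℝ} {q : ℕ} (h : FastChaosDecay G q) :
    Summable fun l => |hermiteCoeff G l| * chaosWeight q l := by
  refine h.2.congr fun l => ?_
  rw [chaosWeight]; ring

lemma eLpNorm_const_mul_hermiteFun_le {q : ℕ} (hq : 1 ≤ q) (c : ℝ) (l : ℕ) :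
    eLpNorm (fun x => c * hermiteFun l x) (2 * q : ℕ) (gaussianReal 0 1) ≤
      ENNReal.ofReal (|c| * chaosWeight q l) := by
  have : (fun x => c * hermiteFun l x) = c • hermiteFun l := rfl
  rw [this, eLpNorm_const_smul, ENNReal.ofReal_mul (abs_nonneg _), ← Real.norm_eq_abs,
    ofReal_norm]
  gcongr
  exact eLpNorm_hermiteFun_le hq l

lemma MeasureTheory.Lp.inner_toLp_toLp {α : Type*} [MeasurableSpace α] {μ : Measure α}
    {f g : α → ℝ} (hf : MemLp f 2 μ) (hg : MemLp g 2 μ) :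
    inner ℝ (hf.toLp f) (hg.toLp g) = ∫ x, f x * g x ∂μ := by
  rw [L2.inner_def]
  refine integral_congr_ae ?_
  filter_upwards [hf.coeFn_toLp, hg.coeFn_toLp] with x h1 h2
  rw [h1, h2]; simp [mul_comm]

/-- The Hermite expansion of a function of fast chaos decay converges almost everywhere. -/
theorem FastChaosDecay.ae_hasSum {G : ℝ → ℝ} {q : ℕ} (hq : 1 ≤ q) (h : FastChaosDecay G q) :
    ∀ᵐ x ∂(gaussianReal 0 1), HasSum (fun l => hermiteCoeff G l * hermiteFun l x) (G x) := by
  set γ := gaussianReal 0 1 with hγ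
  have hq1 : (1 : ℝ) ≤ q := by exact_mod_cast hq
  have hmem : ∀ l, MemLp (fun x => hermiteCoeff G l * hermiteFun l x) 2 γ := fun l =>
    (memLp_hermiteFun l 2 (by norm_num)).const_mul _
  have hle : ∀ l, eLpNorm (fun x => hermiteCoeff G l * hermiteFun l x) 2 γ ≤
      ENNReal.ofReal (|hermiteCoeff G l| * chaosWeight q l) := fun l =>
    (eLpNorm_le_eLpNorm_of_exponent_le (by exact_mod_cast (by omega : 2 ≤ 2 * q))
      (hmem l).1).trans (eLpNorm_const_mul_hermiteFun_le hq _ l)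
  -- convergence in `L²`
  set F : ℕ → Lp ℝ 2 γ := fun l => (hmem l).toLp _ with hF
  have hsum : Summable F := by
    refine Summable.of_norm_bounded h.summable fun l => ?_
    rw [hF, Lp.norm_toLp]
    exact ENNReal.toReal_le_of_le_ofReal
      (mul_nonneg (abs_nonneg _) (chaosWeight_nonneg hq l)) (hle l)
  set S := ∑' l, F l with hS
  have hcoef : ∀ n, ∫ x, S x * hermiteFun n x ∂γ = ∫ x, G x * hermiteFun n x ∂γ := by
    intro n
    set Hn := (memLp_hermiteFun n 2 (by norm_num)).toLp (hermiteFun n) with hHn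
    have h1 : HasSum (fun l => inner ℝ (F l) Hn) (inner ℝ S Hn) :=
      hsum.hasSum.mapL ((innerSL ℝ).flip Hn)
    have h2 : ∀ l, inner ℝ (F l) Hn = if l = n then hermiteCoeff G n * (n ! : ℝ) else 0 := by
      intro l
      rw [hF, hHn, Lp.inner_toLp_toLp]
      simp only [mul_assoc, integral_const_mul, hγ, integral_hermiteFun_mul]
      split_ifs with hln
      · rw [hln]
      · simp
    simp only [h2] at h1
    have h3 := h1.unique (hasSum_ite_eq n _)
    have h4 : inner ℝ S Hn = ∫ x, S x * hermiteFun n x ∂γ := by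
      have := Lp.inner_toLp_toLp (Lp.memLp S) (memLp_hermiteFun n 2 (by norm_num))
      rwa [Lp.toLp_coeFn] at this
    rw [← h4, h3, hermiteCoeff]
    field_simp
    rfl
  -- The `L²` sum has the Hermite coefficients of `G`, so completeness identifies the two.
  have hSG : (fun x => S x - G x) =ᵐ[γ] 0 := by
    refine ae_eq_zero_of_forall_integral_hermiteFun ((Lp.memLp S).sub h.1) fun n => ?_
    have i1 := (Lp.memLp S).integrable_mul (memLp_hermiteFun n 2 (by norm_num))
    have i2 := h.1.integrable_mul (memLp_hermiteFun n 2 (by norm_num))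
    calc _ = ∫ x, (S x * hermiteFun n x - G x * hermiteFun n x) ∂γ := by
          congr 1; ext x; ring
      _ = 0 := (integral_sub i1 i2).trans (sub_eq_zero.2 (hcoef n))
  -- absolute convergence almost everywhere
  have habs : ∀ᵐ x ∂γ, Summable fun l => hermiteCoeff G l * hermiteFun l x := by
    have h1 : ∫⁻ x, ∑' l, ‖hermiteCoeff G l * hermiteFun l x‖ₑ ∂γ ≠ ∞ := by
      rw [lintegral_tsum fun l => (hmem l).1.enorm]
      refine ne_top_of_le_ne_top (h.summable.tsum_ofReal_ne_top) (ENNReal.tsum_le_tsum fun l => ?_)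
      rw [← eLpNorm_one_eq_lintegral_enorm]
      exact (eLpNorm_le_eLpNorm_of_exponent_le (by norm_num) (hmem l).1).trans (hle l)
    filter_upwards [ae_lt_top' (AEMeasurable.tsum fun l => (hmem l).1.enorm) h1] with x hx
    refine Summable.of_norm ?_
    have := ENNReal.summable_toReal hx.ne
    simpa using this
  -- Convergence in `L²` identifies the limit along a subsequence of partial sums; absolute
  -- convergence extends it to the full sequence.
  have hmeas : TendstoInMeasure γ
      (fun n x => ∑ l ∈ Finset.range n, hermiteCoeff G l * hermiteFun l x) Filter.atTop S := by
    have h1 := tendstoInMeasure_of_tendsto_Lp hsum.hasSum.tendsto_sum_nat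
    refine h1.congr_left fun n => ?_
    have h2 := Lp.coeFn_finsetSum (s := Finset.range n) (f := F)
    have h3 : ∀ᵐ x ∂γ, ∀ l, F l x = hermiteCoeff G l * hermiteFun l x :=
      ae_all_iff.2 fun l => (hmem l).coeFn_toLp
    filter_upwards [h2, h3] with x hx hx3
    rw [hx, Finset.sum_apply]
    exact Finset.sum_congr rfl fun l _ => hx3 l
  obtain ⟨ns, hns, hlim⟩ := hmeas.exists_seq_tendsto_ae
  filter_upwards [hSG, habs, hlim] with x h1 h2 h3
  have h4 := h2.hasSum.tendsto_sum_nat.comp hns.tendsto_atTop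
  have h5 := tendsto_nhds_unique h3 h4
  have h6 : S x = G x := sub_eq_zero.1 h1
  rw [← h6, h5]
  exact h2.hasSum

/-! ### Norm bounds and martingale differences -/

/-- `f` is almost everywhere strongly measurable and its `L^p` norm is at most the real number
`c ≥ 0`. -/
structure LpBdd {Ω : Type*} [MeasurableSpace Ω] (μ : Measure Ω) (p : ℝ≥0∞) (c : ℝ) (f : Ω → ℝ) :
    Prop where
  aesm : AEStronglyMeasurable f μ
  nonneg : 0 ≤ c
  le : eLpNorm f p μ ≤ ENNReal.ofReal c

namespace LpBdd

variable {Ω : Type*} [MeasurableSpace Ω] {μ : Measure Ω} {p : ℝ≥0∞} {c d : ℝ} {f g : Ω → ℝ}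

lemma memLp (h : LpBdd μ p c f) : MemLp f p μ := ⟨h.aesm, h.le.trans_lt ENNReal.ofReal_lt_top⟩

lemma mono (h : LpBdd μ p c f) (hcd : c ≤ d) : LpBdd μ p d f :=
  ⟨h.aesm, h.nonneg.trans hcd, h.le.trans (ENNReal.ofReal_le_ofReal hcd)⟩

lemma congr (h : LpBdd μ p c f) (hfg : f =ᵐ[μ] g) : LpBdd μ p c g :=
  ⟨h.aesm.congr hfg, h.nonneg, (eLpNorm_congr_ae hfg).symm.trans_le h.le⟩

lemma add (hf : LpBdd μ p c f) (hg : LpBdd μ p d g) (hp : 1 ≤ p) :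
    LpBdd μ p (c + d) (fun x => f x + g x) :=
  ⟨hf.aesm.add hg.aesm, add_nonneg hf.nonneg hg.nonneg, by
    rw [ENNReal.ofReal_add hf.nonneg hg.nonneg]
    exact (eLpNorm_add_le hf.aesm hg.aesm hp).trans (add_le_add hf.le hg.le)⟩

lemma neg (hf : LpBdd μ p c f) : LpBdd μ p c (fun x => -f x) :=
  ⟨hf.aesm.neg, hf.nonneg, (eLpNorm_neg f p μ).trans_le hf.le⟩

lemma sub (hf : LpBdd μ p c f) (hg : LpBdd μ p d g) (hp : 1 ≤ p) :
    LpBdd μ p (c + d) (fun x => f x - g x) := by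
  simpa only [sub_eq_add_neg] using hf.add hg.neg hp

lemma zero : LpBdd μ p 0 (fun _ => 0) :=
  ⟨aestronglyMeasurable_const, le_rfl, by simp⟩

lemma const_mul (hf : LpBdd μ p c f) (a : ℝ) : LpBdd μ p (|a| * c) (fun x => a * f x) :=
  ⟨hf.aesm.const_mul a, mul_nonneg (abs_nonneg _) hf.nonneg, by
    have h : (fun x => a * f x) = a • f := rfl
    rw [h, eLpNorm_const_smul, ENNReal.ofReal_mul (abs_nonneg _), ← Real.norm_eq_abs, ofReal_norm]
    gcongr
    exact hf.le⟩

lemma sum {κ : Type*} {s : Finset κ} {c : κ → ℝ} {f : κ → Ω → ℝ} (hp : 1 ≤ p)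
    (h : ∀ i ∈ s, LpBdd μ p (c i) (f i)) : LpBdd μ p (∑ i ∈ s, c i) (fun x => ∑ i ∈ s, f i x) := by
  classical
  induction s using Finset.induction_on with
  | empty => simpa using zero
  | insert a s ha ih =>
    simp only [Finset.sum_insert ha]
    exact (h a (Finset.mem_insert_self _ _)).add
      (ih fun i hi => h i (Finset.mem_insert_of_mem hi)) hp

lemma mul {q : ℕ} (hf : LpBdd μ (2 * q : ℕ) c f) (hg : LpBdd μ (2 * q : ℕ) d g) :
    LpBdd μ q (c * d) (fun x => f x * g x) :=
  ⟨hf.aesm.mul hg.aesm, mul_nonneg hf.nonneg hg.nonneg, by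
    have : ENNReal.HolderTriple (2 * q : ℕ) (2 * q : ℕ) q := ⟨by
      rcases Nat.eq_zero_or_pos q with rfl | hq
      · simp
      · rw [← two_mul, Nat.cast_mul, ENNReal.mul_inv (by simp) (by simp), ← mul_assoc]
        rw [Nat.cast_two, ENNReal.mul_inv_cancel (by simp) (by simp), one_mul]⟩
    rw [ENNReal.ofReal_mul hf.nonneg]
    exact (eLpNorm_smul_le_mul_eLpNorm (p := (2 * q : ℕ)) (q := (2 * q : ℕ)) hg.aesm
      hf.aesm).trans (mul_le_mul' hf.le hg.le)⟩

/-- Fatou's lemma. Bounds uniform in the truncation of a Hermite expansion or in the mesh of a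
Riemann sum survive in the limit. -/
lemma of_tendsto {F : ℕ → Ω → ℝ} (hF : ∀ n, LpBdd μ p c (F n))
    (hlim : ∀ᵐ x ∂μ, Filter.Tendsto (fun n => F n x) Filter.atTop (nhds (f x))) :
    LpBdd μ p c f :=
  ⟨aestronglyMeasurable_of_tendsto_ae Filter.atTop (fun n => (hF n).aesm) hlim, (hF 0).nonneg,
    (Lp.eLpNorm_lim_le_liminf_eLpNorm (fun n => (hF n).aesm) f hlim).trans
      ((Filter.liminf_le_liminf (Filter.Eventually.of_forall fun n => (hF n).le)).trans
        (by simp))⟩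

lemma mono_exponent [IsProbabilityMeasure μ] {p' : ℝ≥0∞} (h : LpBdd μ p c f) (hp : p' ≤ p) :
    LpBdd μ p' c f :=
  ⟨h.aesm, h.nonneg, (eLpNorm_le_eLpNorm_of_exponent_le hp h.aesm).trans h.le⟩

lemma integral_pow_le {p : ℕ} (hp : p ≠ 0) (h : LpBdd μ p c f) :
    Integrable (fun x => |f x| ^ p) μ ∧ ∫ x, |f x| ^ p ∂μ ≤ c ^ p := by
  have hi : Integrable (fun x => |f x| ^ p) μ := h.memLp.integrable_norm_pow hp
  refine ⟨hi, ?_⟩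
  have h1 := h.le
  rw [h.memLp.eLpNorm_eq_integral_rpow_norm (by simpa using hp) (by simp),
    ENNReal.ofReal_le_ofReal_iff h.nonneg] at h1
  simp only [ENNReal.toReal_natCast, Real.rpow_natCast, Real.norm_eq_abs] at h1
  have h0 : 0 ≤ ∫ x, |f x| ^ p ∂μ := integral_nonneg fun x => by positivity
  calc _ = ((∫ x, |f x| ^ p ∂μ) ^ ((p : ℝ)⁻¹)) ^ p := by
        rw [← Real.rpow_natCast, ← Real.rpow_mul h0, inv_mul_cancel₀ (by exact_mod_cast hp),
          Real.rpow_one]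
    _ ≤ _ := pow_le_pow_left₀ (Real.rpow_nonneg h0 _) h1 p

lemma of_integral_pow_le {p : ℕ} (hp : p ≠ 0) (hm : MemLp f p μ) (hc : 0 ≤ c)
    (h : ∫ x, |f x| ^ p ∂μ ≤ c ^ p) : LpBdd μ p c f := by
  refine ⟨hm.1, hc, ?_⟩
  rw [hm.eLpNorm_eq_integral_rpow_norm (by simpa using hp) (by simp)]
  refine ENNReal.ofReal_le_ofReal ?_
  simp only [ENNReal.toReal_natCast, Real.rpow_natCast, Real.norm_eq_abs]
  have h0 : 0 ≤ ∫ x, |f x| ^ p ∂μ := integral_nonneg fun x => by positivity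
  calc _ ≤ (c ^ p) ^ ((p : ℝ)⁻¹) := Real.rpow_le_rpow h0 h (by positivity)
    _ = c := Real.pow_rpow_inv_natCast hc hp

end LpBdd

lemma one_add_pow_le_of_abs_le_one {t : ℝ} (ht : |t| ≤ 1) (p : ℕ) :
    (1 + t) ^ p ≤ 1 + p * t + 3 ^ p * t ^ 2 := by
  obtain ⟨h1, h2⟩ := abs_le.1 ht
  induction p with
  | zero => simp; positivity
  | succ p ih =>
    have hp : (p : ℝ) ≤ 3 ^ p := by exact_mod_cast (Nat.lt_pow_self (by norm_num)).le
    have h3 : (0 : ℝ) ≤ 3 ^ p := by positivity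
    calc (1 + t) ^ (p + 1) = (1 + t) ^ p * (1 + t) := pow_succ _ _
      _ ≤ (1 + p * t + 3 ^ p * t ^ 2) * (1 + t) := mul_le_mul_of_nonneg_right ih (by linarith)
      _ ≤ _ := by
        push_cast
        rw [pow_succ (3 : ℝ) p]
        nlinarith [mul_nonneg (sub_nonneg.2 hp) (sq_nonneg t),
          mul_nonneg (mul_nonneg h3 (sq_nonneg t)) (sub_nonneg.2 h2)]

/-- A second order Taylor bound. The linear term is kept exactly because its expectation will vanish
for a martingale difference. If `|y| ≤ |x|`, divide by `|x|` and expand; otherwise every term is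
dominated by a multiple of `|y| ^ (k + 2)`. -/
lemma abs_add_pow_le (x y : ℝ) (k : ℕ) :
    |x + y| ^ (k + 2) ≤ |x| ^ (k + 2) + (k + 2) * (|x| ^ k * x * y) +
      (3 ^ (k + 2) + (k + 2)) * (|x| ^ k * y ^ 2 + |y| ^ (k + 2)) := by
  rcases le_or_gt |y| |x| with h | h
  · rcases eq_or_ne x 0 with rfl | hx
    · have : y = 0 := by simpa using h
      simp [this]
    have hx' : 0 < |x| := abs_pos.2 hx
    have ht : |y / x| ≤ 1 := by rw [abs_div]; exact (div_le_one hx').2 h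
    have h1 := one_add_pow_le_of_abs_le_one ht (k + 2)
    have h2 : |x + y| = |x| * (1 + y / x) := by
      have : x + y = x * (1 + y / x) := by field_simp
      rw [this, abs_mul, abs_of_nonneg (a := 1 + y / x)]
      linarith [(abs_le.1 ht).1]
    have h3 : |x| ^ (k + 2) * (y / x) = |x| ^ k * x * y := by
      rw [pow_add, sq_abs]; field_simp
    have h4 : |x| ^ (k + 2) * (y / x) ^ 2 = |x| ^ k * y ^ 2 := by
      rw [pow_add, sq_abs]; field_simp
    calc |x + y| ^ (k + 2) = |x| ^ (k + 2) * (1 + y / x) ^ (k + 2) := by rw [h2, mul_pow]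
      _ ≤ |x| ^ (k + 2) * (1 + ((k + 2 : ℕ) : ℝ) * (y / x) + 3 ^ (k + 2) * (y / x) ^ 2) := by
        gcongr
      _ = |x| ^ (k + 2) + (k + 2) * (|x| ^ (k + 2) * (y / x)) +
          3 ^ (k + 2) * (|x| ^ (k + 2) * (y / x) ^ 2) := by push_cast; ring
      _ ≤ _ := by
        rw [h3, h4]
        have e1 : 0 ≤ |x| ^ k * y ^ 2 := by positivity
        have e2 : 0 ≤ |y| ^ (k + 2) := by positivity
        have e3 : (0 : ℝ) ≤ 3 ^ (k + 2) := by positivity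
        have e4 : (0 : ℝ) ≤ k + 2 := by positivity
        nlinarith [mul_nonneg e3 e2, mul_nonneg e4 e1, mul_nonneg e4 e2]
  · have h1 : |x + y| ^ (k + 2) ≤ 3 ^ (k + 2) * |y| ^ (k + 2) := by
      rw [← mul_pow]
      refine pow_le_pow_left₀ (abs_nonneg _) ?_ _
      linarith [abs_add_le x y, abs_nonneg y]
    have h2 : -(|x| ^ k * x * y) ≤ |y| ^ (k + 2) := by
      refine (neg_le_abs _).trans ?_
      rw [abs_mul, abs_mul, abs_pow, abs_abs, pow_add, sq, ← mul_assoc]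
      gcongr
    have e1 : 0 ≤ |x| ^ k * y ^ 2 := by positivity
    have e2 : 0 ≤ |x| ^ (k + 2) := by positivity
    have e4 : (0 : ℝ) ≤ k + 2 := by positivity
    have e3 : (0 : ℝ) ≤ 3 ^ (k + 2) := by positivity
    nlinarith [mul_nonneg e3 e1, mul_nonneg e4 e1, mul_le_mul_of_nonneg_left h2 e4]

/-- The constant in the martingale inequality in `L^p`. -/
noncomputable def martConst (p : ℕ) : ℝ := 4 * (3 ^ p + p)

lemma martConst_nonneg (p : ℕ) : 0 ≤ martConst p := by unfold martConst; positivity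

/-- Put `s = (k + 2) / 2 ≥ 1`. Half of the constant `4 C` absorbs the mixed term by Bernoulli's
inequality for `(1 + x) ^ s`, the other half absorbs `B ^ (k + 2)` by superadditivity of `x ^ s`.
Passing to squares of norms is what makes the estimate iterate to a square root of the number of
terms. -/
lemma pow_add_le_sqrt_pow {A B : ℝ} (hA : 0 ≤ A) (hB : 0 ≤ B) (k : ℕ) :
    A ^ (k + 2) + (3 ^ (k + 2) + (k + 2)) * (2 * (A ^ k * B ^ 2) + B ^ (k + 2)) ≤
      √(A ^ 2 + martConst (k + 2) * B ^ 2) ^ (k + 2) := by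
  set C : ℝ := 3 ^ (k + 2) + (k + 2) with hC
  have hC1 : 1 ≤ C := by
    have : (1 : ℝ) ≤ 3 ^ (k + 2) := one_le_pow₀ (by norm_num)
    have : (0 : ℝ) ≤ k := by positivity
    linarith
  set s : ℝ := ((k + 2 : ℕ) : ℝ) / 2 with hs
  have hs1 : 1 ≤ s := by rw [hs]; push_cast; linarith [(by positivity : (0 : ℝ) ≤ k)]
  have hsq : ∀ X : ℝ, 0 ≤ X → √X ^ (k + 2) = X ^ s := by
    intro X hX
    rw [Real.sqrt_eq_rpow, ← Real.rpow_natCast, ← Real.rpow_mul hX, hs]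
    congr 1; ring
  have hpow : ∀ X : ℝ, 0 ≤ X → (X ^ 2) ^ s = X ^ (k + 2) := by
    intro X hX
    rw [← hsq _ (by positivity), Real.sqrt_sq hX]
  have hM : martConst (k + 2) = 4 * C := by rw [martConst, hC]; push_cast; ring
  rw [hsq _ (by rw [hM]; positivity), hM]
  have h1 : (A ^ 2 + 2 * C * B ^ 2) ^ s + (2 * C * B ^ 2) ^ s ≤ (A ^ 2 + 4 * C * B ^ 2) ^ s := by
    refine (Real.add_rpow_le_rpow_add (by positivity) (by positivity) hs1).trans (le_of_eq ?_)
    congr 1; ring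
  have h2 : C * B ^ (k + 2) ≤ (2 * C * B ^ 2) ^ s := by
    rw [Real.mul_rpow (by positivity) (by positivity), hpow B hB]
    gcongr
    calc C ≤ 2 * C := by linarith
      _ = (2 * C) ^ (1 : ℝ) := (Real.rpow_one _).symm
      _ ≤ _ := Real.rpow_le_rpow_of_exponent_le (by linarith) hs1
  have h3 : A ^ (k + 2) + C * (2 * (A ^ k * B ^ 2)) ≤ (A ^ 2 + 2 * C * B ^ 2) ^ s := by
    rcases hA.eq_or_lt with rfl | hA'
    · rcases Nat.eq_zero_or_pos k with rfl | hk
      · simp [hs]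
        linarith
      · rw [zero_pow (by omega), zero_pow hk.ne']
        simp only [zero_mul, mul_zero, add_zero]
        positivity
    · have hb := one_add_mul_self_le_rpow_one_add (s := 2 * C * B ^ 2 / A ^ 2)
        (by linarith [show 0 ≤ 2 * C * B ^ 2 / A ^ 2 by positivity]) hs1
      have e : A ^ 2 + 2 * C * B ^ 2 = A ^ 2 * (1 + 2 * C * B ^ 2 / A ^ 2) := by field_simp
      rw [e, Real.mul_rpow (by positivity) (by positivity), hpow A hA]
      refine le_trans ?_ (mul_le_mul_of_nonneg_left hb (by positivity))
      have e2 : A ^ (k + 2) * (1 + s * (2 * C * B ^ 2 / A ^ 2)) =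
          A ^ (k + 2) + s * (C * (2 * (A ^ k * B ^ 2))) := by
        rw [pow_add A k 2]; field_simp
      rw [e2]
      have : 0 ≤ C * (2 * (A ^ k * B ^ 2)) := by positivity
      nlinarith
  linarith [h1, h2, h3, mul_add C (2 * (A ^ k * B ^ 2)) (B ^ (k + 2))]

lemma pow_mul_sq_le_add {a b : ℝ} (ha : 0 ≤ a) (hb : 0 ≤ b) (k : ℕ) :
    a ^ k * b ^ 2 ≤ a ^ (k + 2) + b ^ (k + 2) := by
  rcases le_total a b with h | h
  · calc a ^ k * b ^ 2 ≤ b ^ k * b ^ 2 := by gcongr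
      _ = b ^ (k + 2) := (pow_add _ _ _).symm
      _ ≤ _ := le_add_of_nonneg_left (by positivity)
  · calc a ^ k * b ^ 2 ≤ a ^ k * a ^ 2 := by gcongr
      _ = a ^ (k + 2) := (pow_add _ _ _).symm
      _ ≤ _ := le_add_of_nonneg_right (by positivity)

lemma pow_mul_le_add {a b : ℝ} (ha : 0 ≤ a) (hb : 0 ≤ b) (k : ℕ) :
    a ^ k * a * b ≤ a ^ (k + 2) + b ^ (k + 2) := by
  rcases le_total a b with h | h
  · calc a ^ k * a * b ≤ b ^ k * b * b := by gcongr
      _ = b ^ (k + 2) := by ring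
      _ ≤ _ := le_add_of_nonneg_left (by positivity)
  · calc a ^ k * a * b ≤ a ^ k * a * a := by gcongr
      _ = a ^ (k + 2) := by ring
      _ ≤ _ := le_add_of_nonneg_right (by positivity)

/-- Adding a martingale difference: the square of the `L^p` norm grows at most by a multiple of
the square of the norm of the difference. -/
theorem LpBdd.add_martingale_diff {Ω : Type*} {m m0 : MeasurableSpace Ω} {μ : Measure Ω}
    [IsProbabilityMeasure μ] (hm : m ≤ m0) {p : ℕ} (hp : 2 ≤ p) {X Y : Ω → ℝ} {A B : ℝ}
    (hX : LpBdd μ p A X) (hY : LpBdd μ p B Y) (hXm : StronglyMeasurable[m] X)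
    (hYm : μ[Y|m] =ᵐ[μ] 0) :
    LpBdd μ p √(A ^ 2 + martConst p * B ^ 2) (fun x => X x + Y x) := by
  obtain ⟨k, rfl⟩ : ∃ k, p = k + 2 := ⟨p - 2, by omega⟩
  have hp1 : (1 : ℝ≥0∞) ≤ (k + 2 : ℕ) := by exact_mod_cast (by omega : 1 ≤ k + 2)
  have hp0 : k + 2 ≠ 0 := by omega
  -- The norms are enlarged to strictly positive `A'`, `B'` so that one may divide by them; at the
  -- end `A' → A` and `B' → B`.
  have key : ∀ A' B' : ℝ, A ≤ A' → B ≤ B' → 0 < A' → 0 < B' →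
      ∫ x, |X x + Y x| ^ (k + 2) ∂μ ≤ A' ^ (k + 2) +
        (3 ^ (k + 2) + (k + 2)) * (2 * (A' ^ k * B' ^ 2) + B' ^ (k + 2)) := by
    intro A' B' hAA hBB hA hB
    obtain ⟨iX, hX1⟩ := (hX.mono hAA).integral_pow_le hp0
    obtain ⟨iY, hY1⟩ := (hY.mono hBB).integral_pow_le hp0
    have iXY : Integrable (fun x => |X x| ^ k * X x * Y x) μ := by
      refine (iX.add iY).mono' (((hX.aesm.norm.pow k).mul hX.aesm).mul hY.aesm)
        (ae_of_all _ fun x => ?_)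
      rw [norm_mul, norm_mul, norm_pow, Real.norm_eq_abs, Real.norm_eq_abs, Real.norm_eq_abs,
        abs_abs]
      exact pow_mul_le_add (abs_nonneg _) (abs_nonneg _) k
    have iX2 : Integrable (fun x => |X x| ^ k * Y x ^ 2) μ := by
      refine (iX.add iY).mono' ((hX.aesm.norm.pow k).mul (hY.aesm.pow 2))
        (ae_of_all _ fun x => ?_)
      rw [norm_mul, norm_pow, norm_pow, Real.norm_eq_abs, Real.norm_eq_abs, abs_abs]
      exact pow_mul_sq_le_add (abs_nonneg _) (abs_nonneg _) k
    -- `|X| ^ k X` is `m`-measurable and `Y` has conditional mean zero.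
    have h0 : ∫ x, |X x| ^ k * X x * Y x ∂μ = 0 := by
      have hsm : StronglyMeasurable[m] fun x => |X x| ^ k * X x := by
        have := hXm.norm
        exact (this.pow k).mul hXm
      have h1 := condExp_mul_of_stronglyMeasurable_left (μ := μ) hsm (g := Y) iXY
        (hY.memLp.integrable hp1)
      have h2 : ∫ x, |X x| ^ k * X x * Y x ∂μ = ∫ x, (μ[(fun x => |X x| ^ k * X x) * Y|m]) x ∂μ :=
        (integral_condExp hm).symm
      rw [h2, integral_congr_ae h1]
      refine integral_eq_zero_of_ae ?_
      filter_upwards [hYm] with x hx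
      simp [hx]
    -- Young's inequality in the crude form of `pow_mul_sq_le_add`, applied to `|X| / A'` and `|Y| /
    -- B'`; the two normalised moments are at most `1`, whence the factor `2`.
    have h2 : ∫ x, |X x| ^ k * Y x ^ 2 ∂μ ≤ 2 * (A' ^ k * B' ^ 2) := by
      have hle : ∀ x, |X x| ^ k * Y x ^ 2 ≤ A' ^ k * B' ^ 2 *
          ((A' ^ (k + 2))⁻¹ * |X x| ^ (k + 2) + (B' ^ (k + 2))⁻¹ * |Y x| ^ (k + 2)) := by
        intro x
        have := pow_mul_sq_le_add (a := |X x| / A') (b := |Y x| / B') (by positivity)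
          (by positivity) k
        rw [div_pow, div_pow, div_pow, div_pow, sq_abs] at this
        calc |X x| ^ k * Y x ^ 2 = A' ^ k * B' ^ 2 * (|X x| ^ k / A' ^ k * (Y x ^ 2 / B' ^ 2)) := by
              field_simp
          _ ≤ A' ^ k * B' ^ 2 * (|X x| ^ (k + 2) / A' ^ (k + 2) + |Y x| ^ (k + 2) / B' ^ (k + 2)) :=
              mul_le_mul_of_nonneg_left this (by positivity)
          _ = _ := by ring
      calc _ ≤ ∫ x, A' ^ k * B' ^ 2 *
          ((A' ^ (k + 2))⁻¹ * |X x| ^ (k + 2) + (B' ^ (k + 2))⁻¹ * |Y x| ^ (k + 2)) ∂μ :=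
            integral_mono iX2 (((iX.const_mul _).add (iY.const_mul _)).const_mul _) hle
        _ = A' ^ k * B' ^ 2 * ((A' ^ (k + 2))⁻¹ * ∫ x, |X x| ^ (k + 2) ∂μ +
              (B' ^ (k + 2))⁻¹ * ∫ x, |Y x| ^ (k + 2) ∂μ) := by
            rw [integral_const_mul, integral_add (iX.const_mul _) (iY.const_mul _),
              integral_const_mul, integral_const_mul]
        _ ≤ A' ^ k * B' ^ 2 * ((A' ^ (k + 2))⁻¹ * A' ^ (k + 2) +
              (B' ^ (k + 2))⁻¹ * B' ^ (k + 2)) := by gcongr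
        _ = _ := by field_simp; ring
    have i3 := (iX.add (iXY.const_mul ((k : ℝ) + 2))).add
      ((iX2.add iY).const_mul (3 ^ (k + 2) + ((k : ℝ) + 2)))
    calc _ ≤ ∫ x, (|X x| ^ (k + 2) + (k + 2) * (|X x| ^ k * X x * Y x) +
        (3 ^ (k + 2) + (k + 2)) * (|X x| ^ k * Y x ^ 2 + |Y x| ^ (k + 2))) ∂μ := by
          refine integral_mono_of_nonneg (ae_of_all _ fun x => by positivity) i3
            (ae_of_all _ fun x => abs_add_pow_le _ _ k)
      _ = ∫ x, |X x| ^ (k + 2) ∂μ + (k + 2) * ∫ x, |X x| ^ k * X x * Y x ∂μ +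
          (3 ^ (k + 2) + (k + 2)) * (∫ x, |X x| ^ k * Y x ^ 2 ∂μ + ∫ x, |Y x| ^ (k + 2) ∂μ) := by
          have e1 := integral_add (iX.add (iXY.const_mul ((k : ℝ) + 2)))
            ((iX2.add iY).const_mul (3 ^ (k + 2) + ((k : ℝ) + 2)))
          have e2 := integral_add iX (iXY.const_mul ((k : ℝ) + 2))
          have e3 := integral_add iX2 iY
          simp only [Pi.add_apply] at e1
          rw [e1, e2, integral_const_mul, integral_const_mul, e3]
      _ ≤ _ := by
          rw [h0, mul_zero, add_zero]
          gcongr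
  refine LpBdd.of_integral_pow_le hp0 (hX.memLp.add hY.memLp) (Real.sqrt_nonneg _) ?_
  refine (?_ : _ ≤ _).trans (pow_add_le_sqrt_pow hX.nonneg hY.nonneg k)
  have hlim : Filter.Tendsto (fun n : ℕ => (A + 1 / ((n : ℝ) + 1)) ^ (k + 2) +
        (3 ^ (k + 2) + (k + 2)) * (2 * ((A + 1 / ((n : ℝ) + 1)) ^ k * (B + 1 / ((n : ℝ) + 1)) ^ 2) +
          (B + 1 / ((n : ℝ) + 1)) ^ (k + 2))) Filter.atTop
      (nhds (A ^ (k + 2) + (3 ^ (k + 2) + (k + 2)) * (2 * (A ^ k * B ^ 2) + B ^ (k + 2)))) := by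
    have hc : Continuous fun δ : ℝ => (A + δ) ^ (k + 2) +
        (3 ^ (k + 2) + ((k : ℝ) + 2)) * (2 * ((A + δ) ^ k * (B + δ) ^ 2) + (B + δ) ^ (k + 2)) := by
      fun_prop
    have := (hc.tendsto 0).comp (tendsto_one_div_add_atTop_nhds_zero_nat (𝕜 := ℝ))
    simp only [add_zero] at this
    exact this
  refine ge_of_tendsto' hlim fun n => ?_
  have hn : (0 : ℝ) < 1 / ((n : ℝ) + 1) := by positivity
  exact key _ _ (by linarith) (by linarith) (by linarith [hX.nonneg]) (by linarith [hY.nonneg])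

/-! ### Martingale approximation of mixingales -/

section Mixingale

variable {Ω : Type*} {m0 : MeasurableSpace Ω} {μ : Measure Ω}

theorem LpBdd.martingale_sum [IsProbabilityMeasure μ] {F : Filtration ℕ m0} {p : ℕ} (hp : 2 ≤ p)
    {D : ℕ → Ω → ℝ} {d : ℕ → ℝ} (n : ℕ) (hm : ∀ k < n, StronglyMeasurable[F (k + 1)] (D k))
    (hD : ∀ k < n, LpBdd μ p (d k) (D k)) (h0 : ∀ k < n, μ[D k|F k] =ᵐ[μ] 0) :
    LpBdd μ p √(martConst p * ∑ k ∈ Finset.range n, d k ^ 2)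
      (fun x => ∑ k ∈ Finset.range n, D k x) := by
  induction n with
  | zero => simpa using LpBdd.zero
  | succ n ih =>
    have h1 := ih (fun k hk => hm k (by omega)) (fun k hk => hD k (by omega))
      (fun k hk => h0 k (by omega))
    have hsm : StronglyMeasurable[F n] fun x => ∑ k ∈ Finset.range n, D k x :=
      Finset.stronglyMeasurable_fun_sum _ fun k hk =>
        (hm k (by have := Finset.mem_range.1 hk; omega)).mono
          (F.mono (by have := Finset.mem_range.1 hk; omega))
    have h2 := h1.add_martingale_diff (F.le n) hp (hD n (by omega)) hsm (h0 n (by omega))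
    simp only [Finset.sum_range_succ]
    have hs : 0 ≤ ∑ k ∈ Finset.range n, d k ^ 2 := Finset.sum_nonneg fun k _ => sq_nonneg _
    rwa [Real.sq_sqrt (mul_nonneg (martConst_nonneg p) hs), ← mul_add] at h2

/-- A sequence of functions, the `k`-th one measurable at time `k + 1`, whose conditional
expectations decay at a summable rate. -/
structure IsMixingaleUpTo (F : Filtration ℕ m0) (μ : Measure Ω) (p : ℕ) (b : ℕ → ℝ) (β : ℝ)
    (n : ℕ) (g : ℕ → Ω → ℝ) : Prop where
  meas : ∀ k < n, StronglyMeasurable[F (k + 1)] (g k)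
  bdd : ∀ k < n, LpBdd μ p β (g k)
  cond : ∀ k l, k ≤ l → l < n → LpBdd μ p (b (l - k)) (μ[g l|F k])
  sum_le : ∀ n, ∑ j ∈ Finset.range n, b j ≤ β

namespace IsMixingaleUpTo

variable {F : Filtration ℕ m0} {p : ℕ} {b : ℕ → ℝ} {β : ℝ} {n : ℕ} {g : ℕ → Ω → ℝ}

lemma mono_right (h : IsMixingaleUpTo F μ p b β n g) {n' : ℕ} (hn : n' ≤ n) :
    IsMixingaleUpTo F μ p b β n' g :=
  ⟨fun k hk => h.meas k (by omega), fun k hk => h.bdd k (by omega),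
    fun k l hk hl => h.cond k l hk (by omega), h.sum_le⟩

/-- The conditional expectation of the sum of the remaining terms. -/
noncomputable def remainder (F : Filtration ℕ m0) (μ : Measure Ω) (g : ℕ → Ω → ℝ) (n k : ℕ) :
    Ω → ℝ := fun x => ∑ l ∈ Finset.Ico k n, (μ[g l|F k]) x

lemma remainder_self : remainder F μ g n n = 0 := by ext; simp [remainder]

lemma stronglyMeasurable_remainder (k : ℕ) : StronglyMeasurable[F k] (remainder F μ g n k) :=
  Finset.stronglyMeasurable_fun_sum _ fun _ _ => stronglyMeasurable_condExp

lemma bdd_remainder (h : IsMixingaleUpTo F μ p b β n g) (hp : 1 ≤ p) (k : ℕ) :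
    LpBdd μ p β (remainder F μ g n k) := by
  have h1 : LpBdd μ p (∑ l ∈ Finset.Ico k n, b (l - k)) (remainder F μ g n k) :=
    LpBdd.sum (by exact_mod_cast hp) fun l hl =>
      h.cond k l (Finset.mem_Ico.1 hl).1 (Finset.mem_Ico.1 hl).2
  refine h1.mono ?_
  rw [Finset.sum_Ico_eq_sum_range]
  simpa using h.sum_le (n - k)

/-- The martingale differences of the decomposition. -/
noncomputable def diff (F : Filtration ℕ m0) (μ : Measure Ω) (g : ℕ → Ω → ℝ) (n k : ℕ) :
    Ω → ℝ := fun x => g k x - remainder F μ g n k x + remainder F μ g n (k + 1) x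

lemma stronglyMeasurable_diff (h : IsMixingaleUpTo F μ p b β n g) {k : ℕ} (hk : k < n) :
    StronglyMeasurable[F (k + 1)] (diff F μ g n k) :=
  ((h.meas k hk).sub ((stronglyMeasurable_remainder k).mono (F.mono (Nat.le_succ k)))).add
    (stronglyMeasurable_remainder (k + 1))

lemma bdd_diff (h : IsMixingaleUpTo F μ p b β n g) (hp : 1 ≤ p) {k : ℕ} (hk : k < n) :
    LpBdd μ p (3 * β) (diff F μ g n k) := by
  have hp' : (1 : ℝ≥0∞) ≤ p := by exact_mod_cast hp
  exact (((h.bdd k hk).sub (h.bdd_remainder hp k) hp').add (h.bdd_remainder hp (k + 1)) hp').mono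
    (by linarith)

/-- By the tower property, the remainder at `k + 1` conditioned on `F k` is the remainder at `k`
without its first term `μ[g k|F k]`; this term is supplied by conditioning `g k`, and everything
cancels. -/
lemma condExp_diff [IsProbabilityMeasure μ] (h : IsMixingaleUpTo F μ p b β n g) (hp : 1 ≤ p)
    {k : ℕ} (hk : k < n) : μ[diff F μ g n k|F k] =ᵐ[μ] 0 := by
  have hp' : (1 : ℝ≥0∞) ≤ p := by exact_mod_cast hp
  have hg : Integrable (g k) μ := (h.bdd k hk).memLp.integrable hp'
  have hr : ∀ k, Integrable (remainder F μ g n k) μ := fun k =>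
    (h.bdd_remainder hp k).memLp.integrable hp'
  have h1 : μ[diff F μ g n k|F k] =ᵐ[μ]
      μ[g k|F k] - μ[remainder F μ g n k|F k] + μ[remainder F μ g n (k + 1)|F k] :=
    (condExp_add (hg.sub (hr k)) (hr (k + 1)) (F k)).trans
      ((condExp_sub hg (hr k) (F k)).add (ae_eq_refl _))
  have h2 : μ[remainder F μ g n k|F k] = remainder F μ g n k :=
    condExp_of_stronglyMeasurable (F.le k) (stronglyMeasurable_remainder k) (hr k)
  have h3 : μ[remainder F μ g n (k + 1)|F k] =ᵐ[μ]
      ∑ l ∈ Finset.Ico (k + 1) n, μ[g l|F k] := by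
    have e : remainder F μ g n (k + 1) = ∑ l ∈ Finset.Ico (k + 1) n, μ[g l|F (k + 1)] := by
      ext x; simp [remainder]
    rw [e]
    refine (condExp_finsetSum (fun l _ => integrable_condExp) (F k)).trans ?_
    have : ∀ᵐ x ∂μ, ∀ l ∈ Finset.Ico (k + 1) n, (μ[μ[g l|F (k + 1)]|F k]) x = (μ[g l|F k]) x :=
      (ae_ball_iff (Finset.Ico (k + 1) n).countable_toSet).2 fun l _ =>
        condExp_condExp_of_le (F.mono (Nat.le_succ k)) (F.le (k + 1))
    filter_upwards [this] with x hx
    rw [Finset.sum_apply, Finset.sum_apply]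
    exact Finset.sum_congr rfl fun l hl => hx l hl
  filter_upwards [h1, h3] with x hx1 hx3
  rw [hx1, Pi.add_apply, Pi.sub_apply, h2, hx3, Finset.sum_apply, remainder,
    Finset.sum_eq_sum_Ico_succ_bot hk]
  simp

/-- Gordin's decomposition: the remainders telescope, leaving a martingale and a boundary term of
bounded norm. -/
lemma sum_eq (N : ℕ) (x : Ω) : ∑ k ∈ Finset.range N, g k x =
    ∑ k ∈ Finset.range N, diff F μ g n k x + (remainder F μ g n 0 x - remainder F μ g n N x) := by
  rw [← Finset.sum_range_sub' (fun k => remainder F μ g n k x), ← Finset.sum_add_distrib]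
  refine Finset.sum_congr rfl fun k _ => ?_
  rw [diff]; ring

/-- Sums of mixingales are of the order of the square root of their length. -/
theorem bdd_sum [IsProbabilityMeasure μ] (h : IsMixingaleUpTo F μ p b β n g) (hp : 2 ≤ p)
    (hβ : 0 ≤ β) :
    LpBdd μ p ((3 * √(martConst p) + 1) * β * √n) (fun x => ∑ k ∈ Finset.range n, g k x) := by
  rcases Nat.eq_zero_or_pos n with rfl | hn
  · simpa using LpBdd.zero
  have hp' : (1 : ℝ≥0∞) ≤ p := by exact_mod_cast (by omega : 1 ≤ p)
  have h1 := LpBdd.martingale_sum (μ := μ) hp n (fun k hk => h.stronglyMeasurable_diff hk)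
    (fun k hk => h.bdd_diff (by omega) hk) (fun k hk => h.condExp_diff (by omega) hk)
  have h2 := h1.add (h.bdd_remainder (by omega) 0) hp'
  have h3 : LpBdd μ p _ (fun x => ∑ k ∈ Finset.range n, g k x) := h2.congr (ae_of_all _ fun x => by
    have := sum_eq (F := F) (μ := μ) (n := n) (g := g) n x
    rw [remainder_self, Pi.zero_apply, sub_zero] at this
    exact this.symm)
  refine h3.mono ?_
  rw [Finset.sum_const, Finset.card_range, nsmul_eq_mul, Real.sqrt_mul (martConst_nonneg p),
    Real.sqrt_mul (by positivity), Real.sqrt_sq (by positivity)]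
  have : (1 : ℝ) ≤ √n := Real.one_le_sqrt.2 (by exact_mod_cast hn)
  nlinarith [Real.sqrt_nonneg (martConst p)]

/-- Summation by parts after replacing `g k` by `diff` plus a difference of remainders. The partial
sum of `f` up to `k` is known at time `k`, so the first sum is a martingale transform; its increment
is `f k` alone, so the second sum consists of `N` terms of bounded norm. -/
lemma sum_remainder_mul (f : ℕ → Ω → ℝ) (N : ℕ) (x : Ω) :
    ∑ k ∈ Finset.range N, g k x * ∑ l ∈ Finset.range k, f l x =
      ∑ k ∈ Finset.range N, diff F μ g n k x * ∑ l ∈ Finset.range k, f l x +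
      ∑ k ∈ Finset.range N, remainder F μ g n (k + 1) x * f k x -
      remainder F μ g n N x * ∑ l ∈ Finset.range N, f l x := by
  induction N with
  | zero => simp
  | succ N ih =>
    rw [Finset.sum_range_succ, ih, Finset.sum_range_succ, Finset.sum_range_succ _ N,
      Finset.sum_range_succ _ N, diff]
    ring

/-- Discrete iterated sums of mixingales grow at most linearly. -/
theorem bdd_iterated_sum [IsProbabilityMeasure μ] {q : ℕ} (hq : 2 ≤ q) {b' : ℕ → ℝ} {β' : ℝ}
    {f : ℕ → Ω → ℝ} (h : IsMixingaleUpTo F μ (2 * q) b β n g)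
    (hf : IsMixingaleUpTo F μ (2 * q) b' β' n f) (hβ : 0 ≤ β) (hβ' : 0 ≤ β') :
    LpBdd μ q ((3 * √(martConst q) * (3 * √(martConst (2 * q)) + 1) + 1) * (β * β') * n)
      (fun x => ∑ k ∈ Finset.range n, g k x * ∑ l ∈ Finset.range k, f l x) := by
  have hq' : (1 : ℝ≥0∞) ≤ q := by exact_mod_cast (by omega : 1 ≤ q)
  set c := 3 * √(martConst (2 * q)) + 1 with hc
  have hc0 : 0 ≤ c := by positivity
  have hS : ∀ k < n, LpBdd μ (2 * q : ℕ) (c * β' * √k) (fun x => ∑ l ∈ Finset.range k, f l x) :=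
    fun k hk => (hf.mono_right hk.le).bdd_sum (by omega) hβ'
  have hSm : ∀ k < n, StronglyMeasurable[F k] (fun x => ∑ l ∈ Finset.range k, f l x) :=
    fun k hk => Finset.stronglyMeasurable_fun_sum _ fun l hl =>
      (hf.meas l (by have := Finset.mem_range.1 hl; omega)).mono
        (F.mono (by have := Finset.mem_range.1 hl; omega))
  have hDS : ∀ k < n, LpBdd μ q (3 * β * (c * β' * √k))
      (fun x => diff F μ g n k x * ∑ l ∈ Finset.range k, f l x) := fun k hk =>
    (h.bdd_diff (by omega) hk).mul (hS k hk)
  -- The products are again martingale differences, of `L^q` norm of order `√k` by Cauchy-Schwarz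
  -- from `L^{2q}`. Their squares sum to order `n²`, so the martingale inequality gives order `n`.
  have h1 : LpBdd μ q √(martConst q * ∑ k ∈ Finset.range n, (3 * β * (c * β' * √k)) ^ 2)
      (fun x => ∑ k ∈ Finset.range n, diff F μ g n k x * ∑ l ∈ Finset.range k, f l x) := by
    refine LpBdd.martingale_sum (F := F) hq n (fun k hk => ?_) hDS (fun k hk => ?_)
    · exact (h.stronglyMeasurable_diff hk).mul ((hSm k hk).mono (F.mono (Nat.le_succ k)))
    · have h2 := condExp_mul_of_stronglyMeasurable_right (μ := μ) (hSm k hk)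
        (f := diff F μ g n k) ((hDS k hk).memLp.integrable hq')
        ((h.bdd_diff (by omega) hk).memLp.integrable (by exact_mod_cast (by omega : 1 ≤ 2 * q)))
      filter_upwards [h2, h.condExp_diff (by omega) hk] with x hx hx2
      have : (fun x => diff F μ g n k x * ∑ l ∈ Finset.range k, f l x) =
        diff F μ g n k * fun x => ∑ l ∈ Finset.range k, f l x := rfl
      rw [this, hx, Pi.mul_apply, hx2]; simp
  have h2 : LpBdd μ q (∑ k ∈ Finset.range n, β * β')
      (fun x => ∑ k ∈ Finset.range n, remainder F μ g n (k + 1) x * f k x) :=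
    LpBdd.sum hq' fun k hk =>
      (h.bdd_remainder (by omega) (k + 1)).mul (hf.bdd k (Finset.mem_range.1 hk))
  have h3 : LpBdd μ q _ (fun x => ∑ k ∈ Finset.range n, g k x * ∑ l ∈ Finset.range k, f l x) :=
    (h1.add h2 hq').congr (ae_of_all _ fun x => by
    have := sum_remainder_mul (F := F) (μ := μ) (n := n) (g := g) f n x
    rw [remainder_self] at this
    simp only [Pi.zero_apply, zero_mul, sub_zero] at this
    exact this.symm)
  refine h3.mono ?_
  have e1 : ∑ k ∈ Finset.range n, (3 * β * (c * β' * √k)) ^ 2 ≤ (3 * β * (c * β') * n) ^ 2 := by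
    calc _ ≤ ∑ k ∈ Finset.range n, (3 * β * (c * β')) ^ 2 * n := by
          refine Finset.sum_le_sum fun k hk => ?_
          have hkn : (k : ℝ) ≤ n := by exact_mod_cast (Finset.mem_range.1 hk).le
          have : (3 * β * (c * β' * √k)) ^ 2 = (3 * β * (c * β')) ^ 2 * k := by
            rw [← mul_assoc, mul_pow, Real.sq_sqrt (by positivity)]
          rw [this]; gcongr
      _ = _ := by rw [Finset.sum_const, Finset.card_range, nsmul_eq_mul]; ring
  have e2 : √(martConst q * ∑ k ∈ Finset.range n, (3 * β * (c * β' * √k)) ^ 2) ≤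
      √(martConst q) * (3 * β * (c * β') * n) := by
    rw [Real.sqrt_mul (martConst_nonneg q)]
    refine mul_le_mul_of_nonneg_left ?_ (Real.sqrt_nonneg _)
    exact (Real.sqrt_le_sqrt e1).trans (le_of_eq (Real.sqrt_sq (by positivity)))
  rw [Finset.sum_const, Finset.card_range, nsmul_eq_mul]
  refine (add_le_add e2 le_rfl).trans (le_of_eq ?_)
  ring

end IsMixingaleUpTo

end Mixingale

/-! ### Gaussian families with prescribed Gram matrix -/

open InnerProductSpace in
/-- Cholesky decomposition of a Gram matrix, by the Gram-Schmidt process. -/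
theorem exists_cholesky {E : Type*} [NormedAddCommGroup E] [InnerProductSpace ℝ E] (v : ℕ → E)
    (N : ℕ) : ∃ u : ℕ → Fin N → ℝ,
      (∀ i < N, ∀ j < N, u i ⬝ᵥ u j = inner ℝ (v i) (v j)) ∧
      (∀ i < N, ∀ a : Fin N, i < a → u i a = 0) ∧
      (∀ k, ∀ i < N, ∀ A : ℝ, 0 ≤ A →
        (∀ w ∈ Submodule.span ℝ (v '' Set.Iio k), |inner ℝ (v i) w| ≤ A * ‖w‖) →
        √(Set.indicator {a : Fin N | (a : ℕ) < k} (u i) ⬝ᵥ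
          Set.indicator {a : Fin N | (a : ℕ) < k} (u i)) ≤ A) := by
  classical
  set e : ℕ → E := gramSchmidtNormed ℝ v with he
  have horth : ∀ a b, a ≠ b → inner ℝ (e a) (e b) = 0 := by
    intro a b hab
    simp [he, gramSchmidtNormed, inner_smul_left, inner_smul_right, gramSchmidt_orthogonal ℝ v hab]
  -- Linear dependence produces zero vectors in the Gram-Schmidt process, so `e` is orthonormal only
  -- up to zeros; the expansions below are arranged to hold in that case too.
  have hunit : ∀ a, e a = 0 ∨ inner ℝ (e a) (e a) = (1 : ℝ) := by
    intro a
    by_cases h : e a = 0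
    · exact Or.inl h
    · right
      rw [real_inner_self_eq_norm_sq, gramSchmidtNormed_unit_length' h, one_pow]
  have hspan : ∀ k, Submodule.span ℝ (e '' Set.Iio k) = Submodule.span ℝ (v '' Set.Iio k) := by
    intro k
    rw [he, span_gramSchmidtNormed, span_gramSchmidt_Iio]
  have hcomb : ∀ (s : Finset ℕ) (x : E), x ∈ Submodule.span ℝ (e '' (s : Set ℕ)) →
      x = ∑ a ∈ s, inner ℝ (e a) x • e a := by
    intro s x hx
    induction hx using Submodule.span_induction with
    | mem x hx =>
      obtain ⟨b, hb, rfl⟩ := hx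
      rw [Finset.sum_eq_single b]
      · rcases hunit b with h | h
        · simp [h]
        · rw [h, one_smul]
      · intro a _ hab; rw [horth a b hab, zero_smul]
      · intro h; exact absurd hb h
    | zero => simp
    | add x y _ _ hx hy =>
      conv_lhs => rw [hx, hy]
      rw [← Finset.sum_add_distrib]
      simp [inner_add_right, add_smul]
    | smul c x _ hx =>
      conv_lhs => rw [hx]
      rw [Finset.smul_sum]
      simp [inner_smul_right, mul_smul]
  have hpars : ∀ (s : Finset ℕ) (c d : ℕ → ℝ), (∀ a, e a = 0 → c a = 0) →
      inner ℝ (∑ a ∈ s, c a • e a) (∑ a ∈ s, d a • e a) = ∑ a ∈ s, c a * d a := by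
    intro s c d hc
    rw [sum_inner]
    refine Finset.sum_congr rfl fun a ha => ?_
    rw [inner_sum, Finset.sum_eq_single a]
    · rw [inner_smul_left, inner_smul_right]
      rcases hunit a with h | h
      · simp [hc a h]
      · rw [h]; simp
    · intro b _ hba
      rw [inner_smul_left, inner_smul_right, horth a b hba.symm]; simp
    · intro h; exact absurd ha h
  have hmem : ∀ {i k}, i < k → v i ∈ Submodule.span ℝ (e '' Set.Iio k) := fun {i k} hik => by
    rw [hspan]; exact Submodule.subset_span ⟨i, hik, rfl⟩
  have hrange : ∀ k, (e '' Set.Iio k) = e '' ((Finset.range k : Finset ℕ) : Set ℕ) := by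
    intro k; simp
  refine ⟨fun i a => inner ℝ (e a) (v i), ?_, ?_, ?_⟩
  · intro i hi j hj
    have h1 := hcomb (Finset.range N) (v i) (by rw [← hrange]; exact hmem hi)
    have h2 := hcomb (Finset.range N) (v j) (by rw [← hrange]; exact hmem hj)
    conv_rhs => rw [h1, h2]
    rw [hpars _ _ _ (fun a ha => by rw [ha, inner_zero_left]), dotProduct,
      Finset.sum_range (fun a => inner ℝ (e a) (v i) * inner ℝ (e a) (v j))]
  · intro i _ a hia
    simp [he, gramSchmidtNormed, inner_smul_left, gramSchmidt_inv_triangular ℝ v hia]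
  · intro k i hi A hA hw
    set s := (Finset.range N).filter (· < k) with hs
    -- `w` is the orthogonal projection of `v i` on the span of the first `min k N` vectors, so `⟨v
    -- i, w⟩ = ‖w‖²` and the hypothesis tested on `w` itself gives `‖w‖ ≤ A`.
    set w := ∑ a ∈ s, inner ℝ (e a) (v i) • e a with hwdef
    have hww : inner ℝ w w = Set.indicator {a : Fin N | (a : ℕ) < k} (fun a : Fin N => inner ℝ (e a) (v i))
        ⬝ᵥ Set.indicator {a : Fin N | (a : ℕ) < k} (fun a : Fin N => inner ℝ (e a) (v i)) := by
      rw [hwdef, hpars _ _ _ (fun a ha => by rw [ha, inner_zero_left]), hs, Finset.sum_filter,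
        Finset.sum_range (fun a => if a < k then inner ℝ (e a) (v i) * inner ℝ (e a) (v i) else 0),
        dotProduct]
      refine Finset.sum_congr rfl fun a _ => ?_
      by_cases h : (a : ℕ) < k <;> simp [h]
    have hvw : inner ℝ (v i) w = inner ℝ w w := by
      rw [hwdef, hpars _ _ _ (fun a ha => by rw [ha, inner_zero_left]), inner_sum]
      refine Finset.sum_congr rfl fun a _ => ?_
      rw [inner_smul_right, real_inner_comm]
    have hwmem : w ∈ Submodule.span ℝ (v '' Set.Iio k) := by
      rw [← hspan]
      refine Submodule.sum_mem _ fun a ha => Submodule.smul_mem _ _ (Submodule.subset_span ⟨a, ?_, rfl⟩)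
      exact (Finset.mem_filter.1 ha).2
    rw [← hww, real_inner_self_eq_norm_sq, Real.sqrt_sq (norm_nonneg _)]
    have h3 := hw w hwmem
    rw [hvw, real_inner_self_eq_norm_sq, abs_of_nonneg (by positivity), sq] at h3
    rcases (norm_nonneg w).eq_or_lt with h0 | h0
    · rw [← h0]; exact hA
    · exact le_of_mul_le_mul_right h3 h0

lemma map_dotProduct_gaussPi {ι : Type*} [Fintype ι] (u : ι → ℝ) :
    (gaussPi ι).map (fun x => u ⬝ᵥ x) =
      gaussianReal 0 (u ⬝ᵥ u).toNNReal := by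
  have hu0 : 0 ≤ u ⬝ᵥ u := Finset.sum_nonneg fun i _ => mul_self_nonneg _
  have hm : Measurable fun x : ι → ℝ => u ⬝ᵥ x := by
    simp only [dotProduct]; fun_prop
  have := Measure.isProbabilityMeasure_map (μ := gaussPi ι) hm.aemeasurable
  refine Measure.ext_of_charFun (funext fun t => ?_)
  rw [charFun_gaussianReal, charFun_apply_real, integral_map hm.aemeasurable (by fun_prop)]
  have e : ∀ x : ι → ℝ, Complex.exp (t * ((u ⬝ᵥ x : ℝ) : ℂ) * Complex.I) =
      ∏ i, Complex.exp (((t * u i : ℝ) : ℂ) * x i * Complex.I) := by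
    intro x
    rw [← Complex.exp_sum]
    congr 1
    simp only [dotProduct, Complex.ofReal_sum, Finset.mul_sum, Finset.sum_mul, Complex.ofReal_mul]
    exact Finset.sum_congr rfl fun i _ => by ring
  simp only [e]
  rw [integral_fintype_prod_eq_prod (fun i (x : ℝ) =>
    Complex.exp (((t * u i : ℝ) : ℂ) * x * Complex.I))]
  have h : ∀ i, ∫ x : ℝ, Complex.exp (((t * u i : ℝ) : ℂ) * x * Complex.I) ∂(gaussianReal 0 1) =
      Complex.exp (-((u i * u i) * t ^ 2 / 2 : ℝ)) := by
    intro i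
    rw [← charFun_apply_real, charFun_gaussianReal]
    congr 1; push_cast; ring
  simp only [h]
  rw [← Complex.exp_sum]
  congr 1
  rw [Real.coe_toNNReal _ hu0]
  simp only [dotProduct]
  push_cast
  rw [Finset.sum_mul, Finset.sum_div, Finset.sum_neg_distrib]
  simp

/-- All finite linear combinations of the `Y i` are centred Gaussian, with the same variances as
the squared norms of the corresponding combinations of the vectors `v i`. -/
structure IsGaussianRep {Ω T E : Type*} [MeasurableSpace Ω] [NormedAddCommGroup E]
    [InnerProductSpace ℝ E] (P : Measure Ω) (Y : T → Ω → ℝ) (v : T → E) : Prop where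
  aemeasurable : ∀ t, AEMeasurable (Y t) P
  map_sum : ∀ (s : Finset T) (c : T → ℝ),
    P.map (fun ω => ∑ i ∈ s, c i * Y i ω) = gaussianReal 0 (‖∑ i ∈ s, c i • v i‖₊ ^ 2)

namespace IsGaussianRep

variable {Ω E : Type*} [MeasurableSpace Ω] [NormedAddCommGroup E] [InnerProductSpace ℝ E]
  {P : Measure Ω}

lemma comp {T S : Type*} {Y : T → Ω → ℝ} {v : T → E} (h : IsGaussianRep P Y v) (f : S → T) :
    IsGaussianRep P (fun s => Y (f s)) (fun s => v (f s)) := by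
  classical
  refine ⟨fun s => h.aemeasurable _, fun s c => ?_⟩
  -- The map `f` need not be injective: coefficients of indices with the same image are added up.
  have h1 := h.map_sum (s.image f) (fun t => ∑ i ∈ s with f i = t, c i)
  have e1 : ∀ ω, ∑ t ∈ s.image f, (∑ i ∈ s with f i = t, c i) * Y t ω = ∑ i ∈ s, c i * Y (f i) ω := by
    intro ω
    rw [← Finset.sum_fiberwise_of_maps_to (fun i hi => Finset.mem_image_of_mem f hi)]
    refine Finset.sum_congr rfl fun t _ => ?_
    rw [Finset.sum_mul]
    exact Finset.sum_congr rfl fun i hi => by rw [(Finset.mem_filter.1 hi).2]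
  have e2 : ∑ t ∈ s.image f, (∑ i ∈ s with f i = t, c i) • v t = ∑ i ∈ s, c i • v (f i) := by
    rw [← Finset.sum_fiberwise_of_maps_to (fun i hi => Finset.mem_image_of_mem f hi)]
    refine Finset.sum_congr rfl fun t _ => ?_
    rw [Finset.sum_smul]
    exact Finset.sum_congr rfl fun i hi => by rw [(Finset.mem_filter.1 hi).2]
  simp only [e1, e2] at h1
  exact h1

/-- Cramér-Wold: both images of a linear functional are centred Gaussian, with the same variance
because the Gram matrices agree. -/
lemma map_eq_map_gaussPi [IsProbabilityMeasure P] {Y : ℕ → Ω → ℝ} {v : ℕ → E}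
    (h : IsGaussianRep P Y v) {N : ℕ} {u : ℕ → Fin N → ℝ}
    (hu : ∀ i < N, ∀ j < N, u i ⬝ᵥ u j = inner ℝ (v i) (v j)) :
    P.map (fun ω (i : Fin N) => Y i ω) = (gaussPi (Fin N)).map (fun x (i : Fin N) => u i ⬝ᵥ x) := by
  have hY : AEMeasurable (fun ω (i : Fin N) => Y i ω) P :=
    aemeasurable_pi_lambda _ fun i => h.aemeasurable i
  have hU : Measurable (fun (x : Fin N → ℝ) (i : Fin N) => u i ⬝ᵥ x) := by
    simp only [dotProduct]; fun_prop
  have := Measure.isProbabilityMeasure_map hY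
  have := Measure.isProbabilityMeasure_map (μ := gaussPi (Fin N)) hU.aemeasurable
  refine Measure.ext_of_charFunDual (funext fun L => ?_)
  rw [charFunDual_eq_charFun_map_one, charFunDual_eq_charFun_map_one,
    AEMeasurable.map_map_of_aemeasurable (by fun_prop) hY, Measure.map_map (by fun_prop) hU]
  set c : ℕ → ℝ := fun i => if hi : i < N then L (Pi.single ⟨i, hi⟩ 1) else 0 with hc
  have hL : ∀ x : Fin N → ℝ, L x = ∑ i ∈ Finset.range N, c i * (if hi : i < N then x ⟨i, hi⟩ else 0) := by
    intro x
    conv_lhs => rw [← Finset.univ_sum_single x]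
    rw [_root_.map_sum, Finset.sum_range]
    refine Finset.sum_congr rfl fun i _ => ?_
    have : Pi.single i (x i) = x i • (Pi.single i 1 : Fin N → ℝ) := by
      rw [← Pi.single_smul, smul_eq_mul, mul_one]
    rw [this, map_smul, smul_eq_mul, mul_comm]
    simp [hc]
  have e1 : (⇑L ∘ fun ω (i : Fin N) => Y i ω) = fun ω => ∑ i ∈ Finset.range N, c i * Y i ω := by
    ext ω
    rw [Function.comp_apply, hL]
    refine Finset.sum_congr rfl fun i hi => ?_
    rw [dif_pos (Finset.mem_range.1 hi)]
  have e2 : (⇑L ∘ fun (x : Fin N → ℝ) (i : Fin N) => u i ⬝ᵥ x) =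
      fun x => (∑ i ∈ Finset.range N, c i • u i) ⬝ᵥ x := by
    ext x
    rw [Function.comp_apply, hL, sum_dotProduct]
    refine Finset.sum_congr rfl fun i hi => ?_
    rw [dif_pos (Finset.mem_range.1 hi), smul_dotProduct, smul_eq_mul]
  rw [e1, e2, h.map_sum, map_dotProduct_gaussPi]
  congr 2
  refine NNReal.eq ?_
  have h0 : 0 ≤ (∑ i ∈ Finset.range N, c i • u i) ⬝ᵥ (∑ i ∈ Finset.range N, c i • u i) :=
    Finset.sum_nonneg fun i _ => mul_self_nonneg _
  rw [Real.coe_toNNReal _ h0, NNReal.coe_pow,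
    coe_nnnorm]
  rw [← real_inner_self_eq_norm_sq, sum_inner, sum_dotProduct]
  refine Finset.sum_congr rfl fun i hi => ?_
  rw [inner_sum, dotProduct_sum]
  refine Finset.sum_congr rfl fun j hj => ?_
  rw [inner_smul_left, inner_smul_right, smul_dotProduct, dotProduct_smul,
    hu i (Finset.mem_range.1 hi) j (Finset.mem_range.1 hj)]
  rfl

/-- Norm bounds for functions of the Gaussian family can be checked on the standard model. -/
lemma lpBdd_of_gaussPi [IsProbabilityMeasure P] {Y : ℕ → Ω → ℝ} {v : ℕ → E}
    (h : IsGaussianRep P Y v) {N : ℕ} {u : ℕ → Fin N → ℝ}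
    (hu : ∀ i < N, ∀ j < N, u i ⬝ᵥ u j = inner ℝ (v i) (v j)) {Φ : (Fin N → ℝ) → ℝ}
    (hΦ : Measurable Φ) {p : ℝ≥0∞} {c : ℝ}
    (hb : LpBdd (gaussPi (Fin N)) p c (fun x => Φ fun i => u i ⬝ᵥ x)) :
    LpBdd P p c (fun ω => Φ fun i => Y i ω) := by
  have hY : AEMeasurable (fun ω (i : Fin N) => Y i ω) P :=
    aemeasurable_pi_lambda _ fun i => h.aemeasurable i
  have hU : Measurable (fun (x : Fin N → ℝ) (i : Fin N) => u i ⬝ᵥ x) := by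
    simp only [dotProduct]; fun_prop
  refine ⟨(hΦ.comp_aemeasurable hY).aestronglyMeasurable, hb.nonneg, ?_⟩
  have e1 := eLpNorm_map_measure (p := p) (g := Φ) hΦ.aestronglyMeasurable hY
  have e2 := eLpNorm_map_measure (p := p) (g := Φ) (μ := gaussPi (Fin N)) hΦ.aestronglyMeasurable
    hU.aemeasurable
  rw [h.map_eq_map_gaussPi hu, e2] at e1
  exact e1.symm.trans_le hb.le

end IsGaussianRep

/-- `G` is continuous and has a Hermite expansion that starts at degree `m` and whose coefficients
have the weighted sum `K`. -/
structure HasChaosDecay (q m : ℕ) (K : ℝ) (G : ℝ → ℝ) : Prop where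
  continuous : Continuous G
  expansion : ∃ c : ℕ → ℝ, (∀ l < m, c l = 0) ∧
    (∀ n, ∑ l ∈ Finset.range n, |c l| * chaosWeight q l ≤ K) ∧
    ∀ᵐ x ∂(gaussianReal 0 1), HasSum (fun l => c l * hermiteFun l x) (G x)

lemma HasChaosDecay.nonneg {q m : ℕ} {K : ℝ} {G : ℝ → ℝ} (h : HasChaosDecay q m K G) : 0 ≤ K := by
  obtain ⟨c, -, h, -⟩ := h.expansion
  simpa using h 0

theorem FastChaosDecay.exists_hasChaosDecay {G : ℝ → ℝ} {q : ℕ} (hq : 1 ≤ q)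
    (h : FastChaosDecay G q) (hc : Continuous G) :
    ∃ K, HasChaosDecay q (hermiteRank G) K G :=
  ⟨∑' l, |hermiteCoeff G l| * chaosWeight q l, hc, hermiteCoeff G,
    fun _ => hermiteCoeff_eq_zero_of_lt, fun _ => h.summable.sum_le_tsum _ fun l _ =>
      mul_nonneg (abs_nonneg _) (chaosWeight_nonneg hq l), h.ae_hasSum hq⟩

/-- The partial sums of the Hermite expansion, with Wick powers in place of Hermite polynomials. -/
noncomputable def wickTrunc {ι : Type*} [Fintype ι] (c : ℕ → ℝ) (L : ℕ) (u x : ι → ℝ) : ℝ :=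
  ∑ l ∈ Finset.range L, c l * MvPolynomial.eval x (GaussPoly.wick u l)

/-! ### Norms and conditioning of truncated Hermite expansions -/

section wickTrunc

open GaussPoly MvPolynomial

variable {ι : Type*} [Fintype ι] {q m : ℕ} {c : ℕ → ℝ} {K : ℝ}

lemma wickTrunc_eq (L : ℕ) {u : ι → ℝ} (hu : u ⬝ᵥ u = 1) (x : ι → ℝ) :
    wickTrunc c L u x = ∑ l ∈ Finset.range L, c l * hermiteFun l (u ⬝ᵥ x) := by
  simp only [wickTrunc, eval_wick hu]

/-- A Wick power of degree `l` has norm proportional to `|u| ^ l`. As the expansion starts at degree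
`m` and `|u| ≤ A ≤ 1`, every term gains `A ^ m`. Since conditioning shortens `u`, this is how a high
Hermite rank accelerates the loss of memory. -/
lemma lpBdd_wickTrunc (hq : 1 ≤ q) (hc : ∀ l < m, c l = 0)
    (hK : ∀ n, ∑ l ∈ Finset.range n, |c l| * chaosWeight q l ≤ K) (L : ℕ) {u : ι → ℝ} {A : ℝ}
    (hu : √(u ⬝ᵥ u) ≤ A) (hA : A ≤ 1) :
    LpBdd (gaussPi ι) (2 * q : ℕ) (K * A ^ m) (wickTrunc c L u) := by
  have hA0 : 0 ≤ A := (Real.sqrt_nonneg _).trans hu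
  have hq' : (1 : ℝ≥0∞) ≤ (2 * q : ℕ) := by exact_mod_cast (by omega : 1 ≤ 2 * q)
  have h1 : ∀ l ∈ Finset.range L, LpBdd (gaussPi ι) (2 * q : ℕ)
      (|c l| * (chaosWeight q l * √(u ⬝ᵥ u) ^ l)) (fun x => c l * eval x (wick u l)) := by
    intro l _
    refine LpBdd.const_mul ⟨(MvPolynomial.continuous_eval _).aestronglyMeasurable, ?_, ?_⟩ _
    · exact mul_nonneg (chaosWeight_nonneg hq l) (by positivity)
    · exact eLpNorm_wick_le hq u l
  refine (LpBdd.sum hq' h1).mono ?_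
  calc _ ≤ ∑ l ∈ Finset.range L, |c l| * chaosWeight q l * A ^ m := by
        refine Finset.sum_le_sum fun l _ => ?_
        rcases lt_or_ge l m with h | h
        · simp [hc l h]
        · rw [← mul_assoc]
          refine mul_le_mul_of_nonneg_left ?_
            (mul_nonneg (abs_nonneg _) (chaosWeight_nonneg hq l))
          exact (pow_le_pow_left₀ (Real.sqrt_nonneg _) hu l).trans (pow_le_pow_of_le_one hA0 hA h)
    _ ≤ _ := by rw [← Finset.sum_mul]; exact mul_le_mul_of_nonneg_right (hK L) (by positivity)

lemma condExp_wickTrunc (L : ℕ) (S : Set ι) (u : ι → ℝ) :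
    (gaussPi ι)[wickTrunc c L u | coordSigma S] =ᵐ[gaussPi ι] wickTrunc c L (S.indicator u) := by
  have e : wickTrunc c L u = ∑ l ∈ Finset.range L, c l • fun x => eval x (wick u l) := by
    ext x; simp [wickTrunc]
  have h1 := condExp_finsetSum (μ := gaussPi ι) (s := Finset.range L)
    (f := fun l => c l • fun x => eval x (wick u l))
    (fun l _ => (integrable_eval (wick u l)).smul (c l)) (coordSigma S)
  have h2 : ∀ᵐ x ∂(gaussPi ι), ∀ l, ((gaussPi ι)[c l • fun x => eval x (wick u l) | coordSigma S]) x =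
      c l * eval x (wick (S.indicator u) l) := by
    refine ae_all_iff.2 fun l => ?_
    filter_upwards [condExp_smul (μ := gaussPi ι) (c l) (fun x => eval x (wick u l)) (coordSigma S),
      condExp_wick S u l] with x hx1 hx2
    rw [hx1, Pi.smul_apply, hx2, smul_eq_mul]
  rw [e]
  filter_upwards [h1, h2] with x hx1 hx2
  rw [hx1, Finset.sum_apply, Finset.sum_congr rfl fun l _ => hx2 l, wickTrunc]

/-- The degree `l` part lies in a single chaos, so hypercontractivity reduces to its variance `l! ∑
(u i ⬝ u j) ^ l`, and for `l ≥ m` the power `l` may be lowered to `m` because correlations are at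
most one. The weighted sum over `l` is bounded by `K` uniformly in `L`. -/
lemma lpBdd_sum_wickTrunc (hq : 1 ≤ q) (hc : ∀ l < m, c l = 0)
    (hK : ∀ n, ∑ l ∈ Finset.range n, |c l| * chaosWeight q l ≤ K) (L : ℕ) {N : ℕ}
    {u : ℕ → ι → ℝ} (hu : ∀ i < N, ∀ j < N, |u i ⬝ᵥ u j| ≤ 1) :
    LpBdd (gaussPi ι) (2 * q : ℕ)
      (K * √(∑ i ∈ Finset.range N, ∑ j ∈ Finset.range N, |u i ⬝ᵥ u j| ^ m))
      (fun x => ∑ i ∈ Finset.range N, wickTrunc c L (u i) x) := by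
  have hq' : (1 : ℝ≥0∞) ≤ (2 * q : ℕ) := by exact_mod_cast (by omega : 1 ≤ 2 * q)
  have hq1 : (1 : ℝ) ≤ q := by exact_mod_cast hq
  set R := ∑ i ∈ Finset.range N, ∑ j ∈ Finset.range N, |u i ⬝ᵥ u j| ^ m with hR
  have hR0 : 0 ≤ R := Finset.sum_nonneg fun i _ => Finset.sum_nonneg fun j _ => by positivity
  have h1 : ∀ l ∈ Finset.range L, LpBdd (gaussPi ι) (2 * q : ℕ) (|c l| * (chaosWeight q l * √R))
      (fun x => c l * ∑ i ∈ Finset.range N, eval x (wick (u i) l)) := by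
    intro l _
    rcases lt_or_ge l m with h | h
    · simp only [hc l h, zero_mul, abs_zero]; exact LpBdd.zero
    refine LpBdd.const_mul ⟨?_, mul_nonneg (chaosWeight_nonneg hq l) (Real.sqrt_nonneg _), ?_⟩ _
    · exact (continuous_finsetSum _ fun i _ =>
        MvPolynomial.continuous_eval _).aestronglyMeasurable
    · have e1 : (fun x => ∑ i ∈ Finset.range N, eval x (wick (u i) l)) =
          fun x => eval x (wickSum (fun _ : Fin N => (1 : ℝ)) (fun i => u i) l) := by
        ext x
        simp [wickSum, Finset.sum_range]
      rw [e1]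
      refine (eLpNorm_wickSum_le hq _ l _).trans (ENNReal.ofReal_le_ofReal ?_)
      rw [chaosWeight, mul_assoc, ← Real.sqrt_mul (by positivity)]
      refine mul_le_mul_of_nonneg_left (Real.sqrt_le_sqrt ?_) (Real.rpow_nonneg (by linarith) _)
      have e2 : wickSum (fun _ : Fin N => (1 : ℝ)) (fun i => u i) l ^ 2 =
          ∑ i : Fin N, ∑ j : Fin N, wick (u i) l * wick (u j) l := by
        rw [sq, ← Finset.sum_mul_sum]; simp [wickSum]
      simp only [e2, map_sum, expect_wick_mul_wick]
      simp only [hR, Finset.sum_range, Finset.mul_sum]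
      refine Finset.sum_le_sum fun i _ => Finset.sum_le_sum fun j _ => ?_
      refine mul_le_mul_of_nonneg_left ?_ (by positivity)
      refine (le_abs_self _).trans ?_
      rw [abs_pow]
      exact pow_le_pow_of_le_one (abs_nonneg _) (hu i i.2 j j.2) h
  have h2 : LpBdd (gaussPi ι) (2 * q : ℕ) _
      (fun x => ∑ i ∈ Finset.range N, wickTrunc c L (u i) x) :=
    (LpBdd.sum hq' h1).congr (ae_of_all _ fun x => by
      simp only [wickTrunc, Finset.mul_sum]
      exact Finset.sum_comm)
  refine h2.mono ?_
  simp only [← mul_assoc]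
  rw [← Finset.sum_mul]
  exact mul_le_mul_of_nonneg_right (hK L) (Real.sqrt_nonneg _)

lemma ae_tendsto_wickTrunc {G : ℝ → ℝ}
    (hG : ∀ᵐ x ∂(gaussianReal 0 1), HasSum (fun l => c l * hermiteFun l x) (G x)) {N : ℕ}
    {u : ℕ → ι → ℝ} (hu : ∀ i < N, u i ⬝ᵥ u i = 1) :
    ∀ᵐ x ∂(gaussPi ι), ∀ i < N,
      Filter.Tendsto (fun L => wickTrunc c L (u i) x) Filter.atTop (nhds (G (u i ⬝ᵥ x))) := by
  refine ae_all_iff.2 fun i => ?_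
  by_cases hi : i < N
  · have hm : Measurable fun x : ι → ℝ => u i ⬝ᵥ x := by simp only [dotProduct]; fun_prop
    have h1 := map_dotProduct_gaussPi (u i)
    rw [hu i hi, Real.toNNReal_one] at h1
    rw [← h1] at hG
    filter_upwards [ae_of_ae_map hm.aemeasurable hG] with x hx _
    simp only [wickTrunc_eq _ (hu i hi)]
    exact hx.tendsto_sum_nat
  · exact ae_of_all _ fun x h => absurd h hi

end wickTrunc

/-! ### Sums and block sums over a Gaussian sequence -/

section Discrete

variable {Ω E : Type*} [MeasurableSpace Ω] [NormedAddCommGroup E] [InnerProductSpace ℝ E]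
  {P : Measure Ω} [IsProbabilityMeasure P] {Y : ℕ → Ω → ℝ} {v : ℕ → E}

/-- Sums of functions of a Gaussian family are controlled by the correlations. -/
theorem IsGaussianRep.lpBdd_sum (h : IsGaussianRep P Y v) {N : ℕ} (hv : ∀ i < N, ‖v i‖ = 1)
    {q m : ℕ} (hq : 1 ≤ q) {K : ℝ} {G : ℝ → ℝ} (hG : HasChaosDecay q m K G) :
    LpBdd P (2 * q : ℕ)
      (K * √(∑ i ∈ Finset.range N, ∑ j ∈ Finset.range N, |inner ℝ (v i) (v j)| ^ m))
      (fun ω => ∑ i ∈ Finset.range N, G (Y i ω)) := by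
  obtain ⟨u, hu, -, -⟩ := exists_cholesky v N
  obtain ⟨c, hc, hK, hae⟩ := hG.expansion
  have hu1 : ∀ i < N, u i ⬝ᵥ u i = 1 := fun i hi => by
    rw [hu i hi i hi, real_inner_self_eq_norm_sq, hv i hi, one_pow]
  have hle : ∀ i < N, ∀ j < N, |u i ⬝ᵥ u j| ≤ 1 := fun i hi j hj => by
    rw [hu i hi j hj]
    refine (abs_real_inner_le_norm _ _).trans ?_
    rw [hv i hi, hv j hj, one_mul]
  have h1 : LpBdd (gaussPi (Fin N)) (2 * q : ℕ)
      (K * √(∑ i ∈ Finset.range N, ∑ j ∈ Finset.range N, |inner ℝ (v i) (v j)| ^ m))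
      (fun x => ∑ i : Fin N, G (u i ⬝ᵥ x)) := by
    have e : ∑ i ∈ Finset.range N, ∑ j ∈ Finset.range N, |inner ℝ (v i) (v j)| ^ m =
        ∑ i ∈ Finset.range N, ∑ j ∈ Finset.range N, |u i ⬝ᵥ u j| ^ m :=
      Finset.sum_congr rfl fun i hi => Finset.sum_congr rfl fun j hj => by
        rw [hu i (Finset.mem_range.1 hi) j (Finset.mem_range.1 hj)]
    rw [e]
    refine LpBdd.of_tendsto (fun L => lpBdd_sum_wickTrunc hq hc hK L hle) ?_
    filter_upwards [ae_tendsto_wickTrunc hae hu1] with x hx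
    rw [← Finset.sum_range (fun i => G (u i ⬝ᵥ x))]
    exact tendsto_finsetSum _ fun i hi => hx i (Finset.mem_range.1 hi)
  have hΦ : Measurable fun y : Fin N → ℝ => ∑ i : Fin N, G (y i) :=
    Finset.measurable_fun_sum _ fun i _ => hG.continuous.measurable.comp (measurable_pi_apply i)
  refine (h.lpBdd_of_gaussPi hu hΦ h1).congr (ae_of_all _ fun ω => ?_)
  exact (Finset.sum_range (fun i => G (Y i ω))).symm

/-- The averages over the blocks of length `M`. -/
noncomputable def blockAvg (M : ℕ) (f : ℕ → ℝ) (k : ℕ) : ℝ :=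
  (1 / (M : ℝ)) * ∑ j ∈ Finset.range M, f (k * M + j)

/-- The filtration on the standard model generated by the blocks. -/
def blockFiltration (n M : ℕ) :
    Filtration ℕ (MeasurableSpace.pi : MeasurableSpace (Fin (n * M) → ℝ)) where
  seq k := GaussPoly.coordSigma {a | (a : ℕ) < k * M}
  mono' _ _ h := GaussPoly.coordSigma_mono fun _ ha =>
    lt_of_lt_of_le ha (Nat.mul_le_mul_right M h)
  le' _ := GaussPoly.coordSigma_le _

/-- The past of a block explains only a small part of the values in a later block. -/
def HasBlockDecay (v : ℕ → E) (n M : ℕ) (r : ℕ → ℝ) : Prop :=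
  ∀ k l j, k ≤ l → l < n → j < M → ∀ w ∈ Submodule.span ℝ (v '' Set.Iio (k * M)),
    |inner ℝ (v (l * M + j)) w| ≤ r (l - k) * ‖w‖

lemma block_lt {n M l j : ℕ} (hl : l < n) (hj : j < M) : l * M + j < n * M := by
  calc l * M + j < l * M + M := by omega
    _ = (l + 1) * M := by ring
    _ ≤ n * M := Nat.mul_le_mul_right M hl

-- Triangularity of `u` makes block `k` depend only on the first `(k + 1) * M` coordinates.
-- Conditioning on the first `k * M` of them truncates each vector, and `hu3` with block decay
-- bounds the truncated length by `r (l - k)`; the rank `m` then turns this into `r (l - k) ^ m`.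
open GaussPoly in
lemma isMixingaleUpTo_wickTrunc {n M : ℕ} (hM : 1 ≤ M) {r : ℕ → ℝ} (hr0 : ∀ j, 0 ≤ r j)
    (hr1 : ∀ j, r j ≤ 1) (hdec : HasBlockDecay v n M r) {u : ℕ → Fin (n * M) → ℝ}
    (hu1 : ∀ i < n * M, u i ⬝ᵥ u i = 1)
    (hu2 : ∀ i < n * M, ∀ a : Fin (n * M), i < a → u i a = 0)
    (hu3 : ∀ k, ∀ i < n * M, ∀ A : ℝ, 0 ≤ A →
        (∀ w ∈ Submodule.span ℝ (v '' Set.Iio k), |inner ℝ (v i) w| ≤ A * ‖w‖) →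
        √(Set.indicator {a : Fin (n * M) | (a : ℕ) < k} (u i) ⬝ᵥ
          Set.indicator {a : Fin (n * M) | (a : ℕ) < k} (u i)) ≤ A)
    {q m : ℕ} (hq : 1 ≤ q) {K R : ℝ} {c : ℕ → ℝ} (hc : ∀ l < m, c l = 0)
    (hK : ∀ n, ∑ l ∈ Finset.range n, |c l| * chaosWeight q l ≤ K) (hR1 : 1 ≤ R)
    (hR : ∀ n, ∑ j ∈ Finset.range n, r j ^ m ≤ R) (L : ℕ) :
    IsMixingaleUpTo (blockFiltration n M) (gaussPi (Fin (n * M))) (2 * q) (fun j => K * r j ^ m)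
      (K * R) n (fun k x => blockAvg M (fun i => wickTrunc c L (u i) x) k) := by
  have hK0 : 0 ≤ K := by simpa using hK 0
  have hM0 : (M : ℝ) ≠ 0 := by positivity
  have hq' : (1 : ℝ≥0∞) ≤ (2 * q : ℕ) := by exact_mod_cast (by omega : 1 ≤ 2 * q)
  have havg : ∀ {f : ℕ → (Fin (n * M) → ℝ) → ℝ} {B : ℝ} {k : ℕ},
      (∀ j < M, LpBdd (gaussPi (Fin (n * M))) (2 * q : ℕ) B (f (k * M + j))) →
      LpBdd (gaussPi (Fin (n * M))) (2 * q : ℕ) B (fun x => blockAvg M (fun i => f i x) k) := by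
    intro f B k hf
    have := (LpBdd.sum hq' (s := Finset.range M) fun j hj => hf j (Finset.mem_range.1 hj)).const_mul
      (1 / (M : ℝ))
    refine this.mono (le_of_eq ?_)
    rw [Finset.sum_const, Finset.card_range, nsmul_eq_mul, abs_of_nonneg (by positivity)]
    field_simp
  refine ⟨fun k hk => ?_, fun k hk => ?_, fun k l hkl hl => ?_, fun N => ?_⟩
  · have hm : ∀ j < M, Measurable[coordSigma {a : Fin (n * M) | (a : ℕ) < (k + 1) * M}]
        (wickTrunc c L (u (k * M + j))) := by
      intro j hj
      refine Finset.measurable_fun_sum _ fun l _ => (measurable_eval_wick ?_ l).const_mul _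
      intro a ha
      refine hu2 _ (block_lt hk hj) a (lt_of_lt_of_le ?_ (not_lt.1 ha))
      exact block_lt (Nat.lt_succ_self k) hj
    exact Measurable.stronglyMeasurable ((Finset.measurable_fun_sum _ fun j hj =>
      hm j (Finset.mem_range.1 hj)).const_mul _)
  · refine havg fun j hj => (lpBdd_wickTrunc hq hc hK L (A := 1) ?_ le_rfl).mono ?_
    · rw [hu1 _ (block_lt hk hj)]; simp
    · rw [one_pow]; exact mul_le_mul_of_nonneg_left hR1 hK0
  · set S := {a : Fin (n * M) | (a : ℕ) < k * M} with hS
    have h1 : (gaussPi (Fin (n * M)))[fun x => blockAvg M (fun i => wickTrunc c L (u i) x) l |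
        coordSigma S] =ᵐ[gaussPi (Fin (n * M))]
        fun x => blockAvg M (fun i => wickTrunc c L (S.indicator (u i)) x) l := by
      have e : (fun x => blockAvg M (fun i => wickTrunc c L (u i) x) l) =
          (1 / (M : ℝ)) • ∑ j ∈ Finset.range M, wickTrunc c L (u (l * M + j)) := by
        ext x; simp [blockAvg]
      have hint : ∀ j ∈ Finset.range M, Integrable (wickTrunc c L (u (l * M + j)))
          (gaussPi (Fin (n * M))) := fun j _ =>
        integrable_finsetSum _ fun l _ => (GaussPoly.integrable_eval _).const_mul _
      rw [e]
      have h2 := condExp_smul (μ := gaussPi (Fin (n * M))) (1 / (M : ℝ))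
        (∑ j ∈ Finset.range M, wickTrunc c L (u (l * M + j))) (coordSigma S)
      have h3 := condExp_finsetSum hint (coordSigma S)
      have h4 : ∀ᵐ x ∂(gaussPi (Fin (n * M))), ∀ j,
          ((gaussPi (Fin (n * M)))[wickTrunc c L (u (l * M + j)) | coordSigma S]) x =
            wickTrunc c L (S.indicator (u (l * M + j))) x :=
        ae_all_iff.2 fun j => condExp_wickTrunc L S _
      filter_upwards [h2, h3, h4] with x hx2 hx3 hx4
      rw [hx2, Pi.smul_apply, hx3, Finset.sum_apply, Finset.sum_congr rfl fun j _ => hx4 j,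
        blockAvg, smul_eq_mul]
    refine LpBdd.congr (havg fun j hj => ?_) h1.symm
    exact lpBdd_wickTrunc hq hc hK L
      (hu3 (k * M) _ (block_lt hl hj) _ (hr0 _) (hdec k l j hkl hl hj)) (hr1 _)
  · rw [← Finset.mul_sum]
    exact mul_le_mul_of_nonneg_left (hR N) hK0

/-- Block sums of functions of high Hermite rank are of the order of the square root of the number
of blocks. -/
theorem IsGaussianRep.lpBdd_blockSum (h : IsGaussianRep P Y v) {n M : ℕ} (hM : 1 ≤ M)
    (hv : ∀ i < n * M, ‖v i‖ = 1) {r : ℕ → ℝ} (hr0 : ∀ j, 0 ≤ r j) (hr1 : ∀ j, r j ≤ 1)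
    (hdec : HasBlockDecay v n M r) {q m : ℕ} (hq : 1 ≤ q) {K R : ℝ} {G : ℝ → ℝ}
    (hG : HasChaosDecay q m K G) (hR1 : 1 ≤ R) (hR : ∀ n, ∑ j ∈ Finset.range n, r j ^ m ≤ R) :
    LpBdd P (2 * q : ℕ) ((3 * √(martConst (2 * q)) + 1) * (K * R) * √n)
      (fun ω => ∑ k ∈ Finset.range n, blockAvg M (fun i => G (Y i ω)) k) := by
  obtain ⟨u, hu, hu2, hu3⟩ := exists_cholesky v (n * M)
  obtain ⟨c, hc, hK, hae⟩ := hG.expansion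
  have hu1 : ∀ i < n * M, u i ⬝ᵥ u i = 1 := fun i hi => by
    rw [hu i hi i hi, real_inner_self_eq_norm_sq, hv i hi, one_pow]
  set Φ : (ℕ → ℝ) → ℝ := fun y => ∑ k ∈ Finset.range n, blockAvg M (fun i => G (y i)) k with hΦdef
  have hKR : 0 ≤ K * R := mul_nonneg hG.nonneg (by linarith)
  -- Extension by zero lets block averages of sequences be applied to finite vectors; only indices
  -- below `n * M` enter.
  set ext : (Fin (n * M) → ℝ) → ℕ → ℝ := fun y i => if hi : i < n * M then y ⟨i, hi⟩ else 0 with hext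
  have hextm : ∀ i, Measurable fun y => ext y i := by
    intro i
    by_cases hi : i < n * M
    · simp only [hext, dif_pos hi]; exact measurable_pi_apply _
    · simp only [hext, dif_neg hi]; exact measurable_const
  have hΦext : ∀ z : ℕ → ℝ, Φ (ext fun i => z i) = Φ z := by
    intro z
    refine Finset.sum_congr rfl fun k hk => ?_
    simp only [blockAvg]
    congr 1
    refine Finset.sum_congr rfl fun j hj => ?_
    simp [hext, block_lt (Finset.mem_range.1 hk) (Finset.mem_range.1 hj)]
  have h1 : LpBdd (gaussPi (Fin (n * M))) (2 * q : ℕ) ((3 * √(martConst (2 * q)) + 1) * (K * R) * √n)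
      (fun x => Φ (ext fun i => u i ⬝ᵥ x)) := by
    refine LpBdd.of_tendsto (fun L => (isMixingaleUpTo_wickTrunc hM hr0 hr1 hdec hu1 hu2 hu3 hq hc hK
      hR1 hR L).bdd_sum (by omega) hKR) ?_
    filter_upwards [ae_tendsto_wickTrunc hae hu1] with x hx
    rw [hΦext (fun i => u i ⬝ᵥ x)]
    refine tendsto_finsetSum _ fun k hk => Filter.Tendsto.const_mul _ ?_
    exact tendsto_finsetSum _ fun j hj =>
      hx _ (block_lt (Finset.mem_range.1 hk) (Finset.mem_range.1 hj))
  have hΦ : Measurable fun y : Fin (n * M) → ℝ => Φ (ext y) :=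
    Finset.measurable_fun_sum _ fun k _ => (Finset.measurable_fun_sum _ fun j _ =>
      hG.continuous.measurable.comp (hextm _)).const_mul _
  refine (h.lpBdd_of_gaussPi hu hΦ h1).congr (ae_of_all _ fun ω => ?_)
  exact hΦext fun i => Y i ω

/-- Iterated block sums of functions of high Hermite rank grow at most linearly. -/
theorem IsGaussianRep.lpBdd_iterated_blockSum (h : IsGaussianRep P Y v) {n M : ℕ} (hM : 1 ≤ M)
    (hv : ∀ i < n * M, ‖v i‖ = 1) {r : ℕ → ℝ} (hr0 : ∀ j, 0 ≤ r j) (hr1 : ∀ j, r j ≤ 1)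
    (hdec : HasBlockDecay v n M r) {q m m' : ℕ} (hq : 2 ≤ q) {K K' R R' : ℝ} {G G' : ℝ → ℝ}
    (hG : HasChaosDecay q m K G) (hG' : HasChaosDecay q m' K' G') (hR1 : 1 ≤ R) (hR1' : 1 ≤ R')
    (hR : ∀ n, ∑ j ∈ Finset.range n, r j ^ m ≤ R)
    (hR' : ∀ n, ∑ j ∈ Finset.range n, r j ^ m' ≤ R') :
    LpBdd P q ((3 * √(martConst q) * (3 * √(martConst (2 * q)) + 1) + 1) *
        ((K * R) * (K' * R')) * n)
      (fun ω => ∑ k ∈ Finset.range n, blockAvg M (fun i => G (Y i ω)) k *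
        ∑ l ∈ Finset.range k, blockAvg M (fun i => G' (Y i ω)) l) := by
  obtain ⟨u, hu, hu2, hu3⟩ := exists_cholesky v (n * M)
  obtain ⟨c, hc, hK, hae⟩ := hG.expansion
  obtain ⟨c', hc', hK', hae'⟩ := hG'.expansion
  have hu1 : ∀ i < n * M, u i ⬝ᵥ u i = 1 := fun i hi => by
    rw [hu i hi i hi, real_inner_self_eq_norm_sq, hv i hi, one_pow]
  set Φ : (ℕ → ℝ) → ℝ := fun y => ∑ k ∈ Finset.range n, blockAvg M (fun i => G (y i)) k *
    ∑ l ∈ Finset.range k, blockAvg M (fun i => G' (y i)) l with hΦdef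
  have hKR : 0 ≤ K * R := mul_nonneg hG.nonneg (by linarith)
  have hKR' : 0 ≤ K' * R' := mul_nonneg hG'.nonneg (by linarith)
  set ext : (Fin (n * M) → ℝ) → ℕ → ℝ := fun y i => if hi : i < n * M then y ⟨i, hi⟩ else 0 with hext
  have hextm : ∀ i, Measurable fun y => ext y i := by
    intro i
    by_cases hi : i < n * M
    · simp only [hext, dif_pos hi]; exact measurable_pi_apply _
    · simp only [hext, dif_neg hi]; exact measurable_const
  have hΦext : ∀ z : ℕ → ℝ, Φ (ext fun i => z i) = Φ z := by
    intro z
    have hb : ∀ (g : ℝ → ℝ), ∀ k < n, blockAvg M (fun i => g (ext (fun i => z i) i)) k =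
        blockAvg M (fun i => g (z i)) k := by
      intro g k hk
      simp only [blockAvg]
      congr 1
      refine Finset.sum_congr rfl fun j hj => ?_
      simp [hext, block_lt hk (Finset.mem_range.1 hj)]
    refine Finset.sum_congr rfl fun k hk => ?_
    have hk' := Finset.mem_range.1 hk
    rw [hb G k hk']
    congr 1
    exact Finset.sum_congr rfl fun l hl => hb G' l ((Finset.mem_range.1 hl).trans hk')
  have h1 : LpBdd (gaussPi (Fin (n * M))) q ((3 * √(martConst q) *
      (3 * √(martConst (2 * q)) + 1) + 1) * ((K * R) * (K' * R')) * n)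
      (fun x => Φ (ext fun i => u i ⬝ᵥ x)) := by
    refine LpBdd.of_tendsto (fun L => (isMixingaleUpTo_wickTrunc hM hr0 hr1 hdec hu1 hu2 hu3
      (by omega) hc hK hR1 hR L).bdd_iterated_sum hq (isMixingaleUpTo_wickTrunc hM hr0 hr1 hdec
      hu1 hu2 hu3 (by omega) hc' hK' hR1' hR' L) hKR hKR') ?_
    filter_upwards [ae_tendsto_wickTrunc hae hu1, ae_tendsto_wickTrunc hae' hu1] with x hx hx'
    rw [hΦext (fun i => u i ⬝ᵥ x)]
    refine tendsto_finsetSum _ fun k hk => Filter.Tendsto.mul (Filter.Tendsto.const_mul _ ?_) ?_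
    · exact tendsto_finsetSum _ fun j hj =>
        hx _ (block_lt (Finset.mem_range.1 hk) (Finset.mem_range.1 hj))
    · refine tendsto_finsetSum _ fun l hl => Filter.Tendsto.const_mul _ ?_
      exact tendsto_finsetSum _ fun j hj =>
        hx' _ (block_lt ((Finset.mem_range.1 hl).trans (Finset.mem_range.1 hk))
          (Finset.mem_range.1 hj))
  have hba : ∀ {g : ℝ → ℝ} (k : ℕ), Continuous g →
      Measurable fun y : Fin (n * M) → ℝ => blockAvg M (fun i => g (ext y i)) k := fun k hg =>
    (Finset.measurable_fun_sum _ fun j _ => hg.measurable.comp (hextm _)).const_mul _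
  have hΦ : Measurable fun y : Fin (n * M) → ℝ => Φ (ext y) :=
    Finset.measurable_fun_sum _ fun k _ => (hba k hG.continuous).mul
      (Finset.measurable_fun_sum _ fun l _ => hba l hG'.continuous)
  refine (h.lpBdd_of_gaussPi hu hΦ h1).congr (ae_of_all _ fun ω => ?_)
  exact hΦext fun i => Y i ω

end Discrete

/-! ### Riemann sums and iterated integrals of continuous functions -/

/-- Left Riemann sums of a continuous function converge to its integral. -/
theorem tendsto_riemannSum {f : ℝ → ℝ} (hf : Continuous f) (a : ℝ) {T : ℝ} (hT : 0 ≤ T) :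
    Filter.Tendsto (fun n : ℕ => T / n * ∑ i ∈ Finset.range n, f (a + i * (T / n))) Filter.atTop
      (nhds (∫ x in a..(a + T), f x)) := by
  rcases hT.eq_or_lt with rfl | hT
  · simp
  rw [Metric.tendsto_atTop]
  intro ε hε
  have huc := isCompact_Icc.uniformContinuousOn_of_continuous
    (hf.continuousOn (s := Set.Icc a (a + T)))
  obtain ⟨δ, hδ, hfδ⟩ := Metric.uniformContinuousOn_iff.1 huc (ε / (2 * T)) (by positivity)
  obtain ⟨n₀, hn₀⟩ := exists_nat_gt (T / δ)
  refine ⟨n₀ + 1, fun n hn => ?_⟩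
  have hn0 : (0 : ℝ) < n := by exact_mod_cast (by omega : 0 < n)
  have hmesh : T / n < δ := by
    rw [div_lt_iff₀ hn0, mul_comm, ← div_lt_iff₀ hδ]
    exact hn₀.trans (by exact_mod_cast (by omega : n₀ < n))
  have hmesh0 : 0 < T / n := by positivity
  have hsplit := intervalIntegral.sum_integral_adjacent_intervals (f := f) (μ := volume)
    (a := fun i : ℕ => a + i * (T / n)) (n := n) (fun k _ => hf.intervalIntegrable _ _)
  have e0 : a + ((0 : ℕ) : ℝ) * (T / n) = a := by simp
  have e1 : a + (n : ℝ) * (T / n) = a + T := by field_simp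
  rw [e0, e1] at hsplit
  rw [← hsplit, Finset.mul_sum, Real.dist_eq, ← Finset.sum_sub_distrib]
  have hterm : ∀ i ∈ Finset.range n, |T / n * f (a + i * (T / n)) -
      ∫ x in (a + i * (T / n))..(a + (i + 1 : ℕ) * (T / n)), f x| ≤ ε / (2 * T) * (T / n) := by
    intro i hi
    have hin : (i : ℝ) + 1 ≤ n := by exact_mod_cast Finset.mem_range.1 hi
    have hlen : a + ((i + 1 : ℕ) : ℝ) * (T / n) - (a + i * (T / n)) = T / n := by push_cast; ring
    have hc : ∫ _ in (a + i * (T / n))..(a + (i + 1 : ℕ) * (T / n)), f (a + i * (T / n)) =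
        T / n * f (a + i * (T / n)) := by
      rw [intervalIntegral.integral_const, hlen, smul_eq_mul]
    rw [← hc, ← intervalIntegral.integral_sub (by simp) (hf.intervalIntegrable _ _)]
    have := intervalIntegral.norm_integral_le_of_norm_le_const (a := a + i * (T / n))
      (b := a + (i + 1 : ℕ) * (T / n)) (C := ε / (2 * T))
      (f := fun x => f (a + i * (T / n)) - f x) ?_
    · rwa [hlen, abs_of_pos hmesh0] at this
    · intro x hx
      rw [Set.uIoc_of_le (by linarith)] at hx
      have hup : ((i : ℝ) + 1) * (T / n) ≤ T := by
        calc _ ≤ (n : ℝ) * (T / n) := by gcongr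
          _ = T := by field_simp
      have hi0 : 0 ≤ (i : ℝ) * (T / n) := by positivity
      have hx2 : x ≤ a + (i + 1) * (T / n) := by have := hx.2; push_cast at this; exact this
      refine (hfδ _ ⟨by linarith, by linarith⟩ x ⟨by linarith [hx.1], by linarith⟩ ?_).le
      rw [Real.dist_eq, abs_sub_comm, abs_of_pos (by linarith [hx.1])]
      linarith
  calc _ ≤ ∑ i ∈ Finset.range n, ε / (2 * T) * (T / n) :=
        (Finset.abs_sum_le_sum_abs _ _).trans (Finset.sum_le_sum hterm)
    _ = ε / 2 := by rw [Finset.sum_const, Finset.card_range, nsmul_eq_mul]; field_simp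
    _ < ε := by linarith

lemma tendsto_blockAvg {f : ℝ → ℝ} (hf : Continuous f) {δ : ℝ} (hδ : 0 ≤ δ) (k : ℕ) :
    Filter.Tendsto (fun M : ℕ => δ * blockAvg M (fun i => f (i * (δ / M))) k) Filter.atTop
      (nhds (∫ x in (k * δ)..((k + 1) * δ), f x)) := by
  have h := tendsto_riemannSum hf (k * δ) hδ
  rw [show k * δ + δ = (k + 1) * δ by ring] at h
  refine h.congr' ?_
  filter_upwards [Filter.eventually_gt_atTop 0] with M hM
  have hM0 : (M : ℝ) ≠ 0 := by positivity
  rw [blockAvg, ← mul_assoc, mul_one_div]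
  congr 1
  refine Finset.sum_congr rfl fun j _ => ?_
  congr 1
  push_cast; field_simp

/-- The iterated integral `∫_a^b f(s) ∫_a^s g(u) du ds`. -/
noncomputable def iterInt (f g : ℝ → ℝ) (a b : ℝ) : ℝ := ∫ s in a..b, f s * ∫ u in a..s, g u

section iterInt

variable {f g : ℝ → ℝ}

lemma continuous_primitive' (hg : Continuous g) (a : ℝ) : Continuous fun s => ∫ u in a..s, g u :=
  intervalIntegral.continuous_primitive (fun _ _ => hg.intervalIntegrable _ _) a

lemma integral_sub_primitive (hg : Continuous g) (a b c : ℝ) :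
    ∫ u in a..c, g u = (∫ u in a..b, g u) + ∫ u in b..c, g u :=
  (intervalIntegral.integral_add_adjacent_intervals (hg.intervalIntegrable _ _)
    (hg.intervalIntegrable _ _)).symm

/-- Chen's relation. -/
lemma iterInt_chen (hf : Continuous f) (hg : Continuous g) (a b c : ℝ) :
    iterInt f g a c = iterInt f g a b + iterInt f g b c +
      (∫ s in b..c, f s) * ∫ u in a..b, g u := by
  have hcont : ∀ a, Continuous fun s => f s * ∫ u in a..s, g u := fun a =>
    hf.mul (continuous_primitive' hg a)
  have e : ∀ s, f s * ∫ u in a..s, g u = (f s * ∫ u in b..s, g u) + f s * ∫ u in a..b, g u := by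
    intro s; rw [integral_sub_primitive hg a b s]; ring
  have h1 : iterInt f g a c = iterInt f g a b + ∫ s in b..c, f s * ∫ u in a..s, g u :=
    integral_sub_primitive (hcont a) a b c
  have h2 : ∫ s in b..c, f s * ∫ u in a..s, g u =
      iterInt f g b c + (∫ s in b..c, f s) * ∫ u in a..b, g u := by
    rw [intervalIntegral.integral_congr fun s _ => e s, ← intervalIntegral.integral_mul_const]
    exact intervalIntegral.integral_add ((hcont b).intervalIntegrable _ _)
      ((hf.mul continuous_const).intervalIntegrable _ _)
  rw [h1, h2, add_assoc]

lemma iterInt_self (a : ℝ) : iterInt f g a a = 0 := by simp [iterInt]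

lemma iterInt_comp_add (d a b : ℝ) :
    iterInt (fun s => f (s + d)) (fun s => g (s + d)) a b = iterInt f g (a + d) (b + d) := by
  have h : ∀ s, ∫ u in a..s, g (u + d) = ∫ u in (a + d)..(s + d), g u := fun s =>
    intervalIntegral.integral_comp_add_right g d
  simp only [iterInt, h]
  exact intervalIntegral.integral_comp_add_right (fun s => f s * ∫ u in (a + d)..s, g u) d

/-- Iterating Chen's relation: pairs in different blocks give the discrete iterated sum, pairs in
the same block remain as small iterated integrals. -/
lemma iterInt_blocks (hf : Continuous f) (hg : Continuous g) (δ : ℝ) (n : ℕ) :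
    iterInt f g 0 (n * δ) =
      ∑ k ∈ Finset.range n, (∫ s in (k * δ)..((k + 1) * δ), f s) *
        ∑ l ∈ Finset.range k, (∫ s in (l * δ)..((l + 1) * δ), g s) +
      ∑ k ∈ Finset.range n, iterInt f g (k * δ) ((k + 1) * δ) := by
  have hsum : ∀ k : ℕ, ∑ l ∈ Finset.range k, (∫ s in (l * δ)..((l + 1) * δ), g s) =
      ∫ u in 0..(k * δ), g u := by
    intro k
    have := intervalIntegral.sum_integral_adjacent_intervals (f := g) (μ := volume)
      (a := fun i : ℕ => i * δ) (n := k) (fun k _ => hg.intervalIntegrable _ _)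
    simpa using this
  simp only [hsum]
  induction n with
  | zero => simp [iterInt_self]
  | succ n ih =>
    rw [Finset.sum_range_succ, Finset.sum_range_succ, Nat.cast_succ,
      iterInt_chen hf hg 0 (n * δ) ((n + 1) * δ), ih]
    ring

end iterInt

section

variable {Ω : Type*} [MeasurableSpace Ω] {P : Measure Ω} {p : ℝ≥0∞}

/-- Minkowski's integral inequality for processes with continuous paths. -/
lemma LpBdd.intervalIntegral {f : ℝ → Ω → ℝ} (hf : ∀ ω, Continuous fun t => f t ω) {a b c : ℝ}
    (hab : a ≤ b) (hp : 1 ≤ p) (hb : ∀ t ∈ Set.Icc a b, LpBdd P p c (f t)) :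
    LpBdd P p (c * (b - a)) (fun ω => ∫ t in a..b, f t ω) := by
  have hc : 0 ≤ c := (hb a ⟨le_rfl, hab⟩).nonneg
  have hT : 0 ≤ b - a := sub_nonneg.2 hab
  refine LpBdd.of_tendsto (F := fun n : ℕ => fun ω => (b - a) / (n + 1 : ℕ) *
    ∑ i ∈ Finset.range (n + 1), f (a + i * ((b - a) / (n + 1 : ℕ))) ω) (fun n => ?_) ?_
  · have hn : (0 : ℝ) < ((n + 1 : ℕ) : ℝ) := by positivity
    have h1 : ∀ i ∈ Finset.range (n + 1), LpBdd P p c (f (a + i * ((b - a) / (n + 1 : ℕ)))) := by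
      intro i hi
      have hi' : (i : ℝ) ≤ (n + 1 : ℕ) := by exact_mod_cast (Finset.mem_range.1 hi).le
      have h0 : 0 ≤ (i : ℝ) * ((b - a) / (n + 1 : ℕ)) := by positivity
      have h2 : (i : ℝ) * ((b - a) / (n + 1 : ℕ)) ≤ b - a := by
        calc _ ≤ ((n + 1 : ℕ) : ℝ) * ((b - a) / (n + 1 : ℕ)) := by gcongr
          _ = b - a := by field_simp
      exact hb _ ⟨by linarith, by linarith⟩
    refine ((LpBdd.sum hp h1).const_mul _).mono (le_of_eq ?_)
    rw [Finset.sum_const, Finset.card_range, nsmul_eq_mul, abs_of_nonneg (by positivity)]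
    field_simp
  · refine ae_of_all _ fun ω => ?_
    have := tendsto_riemannSum (hf ω) a hT
    rw [add_sub_cancel] at this
    exact this.comp (Filter.tendsto_add_atTop_nat 1)

lemma LpBdd.of_forall_tendsto {f : Ω → ℝ} {c : ℝ} {d : ℕ → ℝ} (h : ∀ n, LpBdd P p (d n) f)
    (hd : Filter.Tendsto d Filter.atTop (nhds c)) : LpBdd P p c f :=
  ⟨(h 0).aesm, ge_of_tendsto' hd fun n => (h n).nonneg,
    ge_of_tendsto' (ENNReal.tendsto_ofReal hd) fun n => (h n).le⟩

end

/-- Comparison with an integral, by induction: Bernoulli's inequality for the concave power `1 - s`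
gives `n^{1-s} ≤ (n+1)^{1-s} - (1-s)(n+1)^{-s}`. -/
lemma sum_rpow_neg_le {s : ℝ} (hs0 : 0 ≤ s) (hs1 : s < 1) (n : ℕ) :
    ∑ d ∈ Finset.range n, ((d : ℝ) + 1) ^ (-s) ≤ (n : ℝ) ^ (1 - s) / (1 - s) := by
  have hs : 0 < 1 - s := by linarith
  induction n with
  | zero => simp [Real.zero_rpow hs.ne']
  | succ n ih =>
    rw [Finset.sum_range_succ]
    have hn : (0 : ℝ) < n + 1 := by positivity
    have hb := rpow_one_add_le_one_add_mul_self (s := -(1 / ((n : ℝ) + 1))) (p := 1 - s)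
      (by rw [neg_le_neg_iff, div_le_one hn]; linarith [(Nat.cast_nonneg n : (0 : ℝ) ≤ n)])
      hs.le (by linarith)
    have e : (n : ℝ) = (n + 1) * (1 + -(1 / ((n : ℝ) + 1))) := by field_simp; ring
    have h1 : (n : ℝ) ^ (1 - s) ≤ (n + 1 : ℝ) ^ (1 - s) - (1 - s) * (n + 1 : ℝ) ^ (-s) := by
      conv_lhs => rw [e]
      have hnn : (0 : ℝ) ≤ 1 + -(1 / ((n : ℝ) + 1)) := by
        have : 1 / ((n : ℝ) + 1) ≤ 1 := by
          rw [div_le_one hn]; linarith [(Nat.cast_nonneg n : (0 : ℝ) ≤ n)]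
        linarith
      rw [Real.mul_rpow hn.le hnn]
      refine (mul_le_mul_of_nonneg_left hb (by positivity)).trans (le_of_eq ?_)
      have : (n + 1 : ℝ) ^ (-s) = (n + 1 : ℝ) ^ (1 - s) / (n + 1) := by
        rw [← Real.rpow_sub_one hn.ne']; congr 1; ring
      rw [this]; field_simp; ring
    have h2 : (n : ℝ) ^ (1 - s) / (1 - s) ≤
        (n + 1 : ℝ) ^ (1 - s) / (1 - s) - (n + 1 : ℝ) ^ (-s) := by
      rw [le_sub_iff_add_le, div_add' _ _ _ hs.ne']
      exact div_le_div_of_nonneg_right (by linarith) hs.le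
    push_cast
    linarith

/-- With truncated subtraction `i - j + (j - i)` is the distance of `i` and `j`, and each distance
occurs at most twice in a row. -/
lemma sum_sum_dist_le {ψ : ℕ → ℝ} (hψ : ∀ d, 0 ≤ ψ d) (n : ℕ) :
    ∑ i ∈ Finset.range n, ∑ j ∈ Finset.range n, ψ (i - j + (j - i)) ≤
      n * (2 * ∑ d ∈ Finset.range n, ψ d) := by
  have h : ∀ i ∈ Finset.range n, ∑ j ∈ Finset.range n, ψ (i - j + (j - i)) ≤
      2 * ∑ d ∈ Finset.range n, ψ d := by
    intro i hi
    have hi' := Finset.mem_range.1 hi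
    rw [Finset.range_eq_Ico, ← Finset.sum_Ico_consecutive _ (Nat.zero_le (i + 1)) (by omega : i + 1 ≤ n),
      two_mul]
    refine add_le_add ?_ ?_
    · have e : ∑ j ∈ Finset.Ico 0 (i + 1), ψ (i - j + (j - i)) =
          ∑ j ∈ Finset.range (i + 1), ψ j := by
        rw [← Finset.range_eq_Ico, ← Finset.sum_range_reflect]
        refine Finset.sum_congr rfl fun j hj => ?_
        have := Finset.mem_range.1 hj
        congr 1; omega
      rw [e, ← Finset.range_eq_Ico]
      exact Finset.sum_le_sum_of_subset_of_nonneg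
        (Finset.range_subset_range.2 (by omega)) fun d _ _ => hψ d
    · rw [Finset.sum_Ico_eq_sum_range, ← Finset.range_eq_Ico]
      have e : ∑ k ∈ Finset.range (n - (i + 1)), ψ (i - (i + 1 + k) + (i + 1 + k - i)) =
          ∑ k ∈ Finset.Ico 1 (n - i), ψ k := by
        rw [Finset.sum_Ico_eq_sum_range]
        refine Finset.sum_congr (by congr 1) fun k _ => ?_
        congr 1; omega
      rw [e]
      refine Finset.sum_le_sum_of_subset_of_nonneg (fun k hk => ?_) fun d _ _ => hψ d
      have := Finset.mem_Ico.1 hk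
      exact Finset.mem_range.2 (by omega)
  calc _ ≤ ∑ i ∈ Finset.range n, 2 * ∑ d ∈ Finset.range n, ψ d := Finset.sum_le_sum h
    _ = _ := by rw [Finset.sum_const, Finset.card_range, nsmul_eq_mul]

/-! ### Moment bounds in continuous time -/

/-- A stationary Gaussian process with continuous paths and unit variance, represented by a curve
`v` in a Hilbert space, with the correlation decay of the fractional Ornstein-Uhlenbeck process. -/
structure IsFOULike {Ω E : Type*} [MeasurableSpace Ω] [NormedAddCommGroup E]
    [InnerProductSpace ℝ E] (P : Measure Ω) (H A : ℝ) (v : ℝ → E) (Y : ℝ → Ω → ℝ) : Prop where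
  continuous : ∀ ω, Continuous fun t => Y t ω
  rep : IsGaussianRep P Y v
  norm_eq : ∀ t, ‖v t‖ = 1
  past : ∀ s t, s < t → ∀ w ∈ Submodule.span ℝ (v '' Set.Iic s),
    |inner ℝ (v t) w| ≤ A * (t - s) ^ (H - 1) * ‖w‖
  corr : 1 / 2 < H → ∀ s t, s ≠ t → |inner ℝ (v s) (v t)| ≤ A * |t - s| ^ (2 * H - 2)

/-- The bound for the correlation of blocks of length at least `1/2`. -/
noncomputable def blockDecay (H A : ℝ) (j : ℕ) : ℝ :=
  if j = 0 then 1 else min 1 (A * ((j : ℝ) / 2) ^ (H - 1))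

section blockDecay

variable {H A : ℝ}

lemma blockDecay_nonneg (hA : 0 ≤ A) (j : ℕ) : 0 ≤ blockDecay H A j := by
  unfold blockDecay; split_ifs
  · exact zero_le_one
  · positivity

lemma blockDecay_le_one (j : ℕ) : blockDecay H A j ≤ 1 := by
  unfold blockDecay; split_ifs
  · exact le_rfl
  · exact min_le_left _ _

/-- `hStar H m < 0` says `(H - 1) m < -1`, so the powers are summable; this is where the gap
assumption on high ranks enters. -/
lemma exists_sum_blockDecay_pow_le (hA : 0 ≤ A) {m : ℕ} (hm : hStar H m < 0) :
    ∃ R, 1 ≤ R ∧ ∀ n, ∑ j ∈ Finset.range n, blockDecay H A j ^ m ≤ R := by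
  have hm0 : m ≠ 0 := by rintro rfl; simp [hStar] at hm; linarith
  have hs : Summable fun j : ℕ => A ^ m * (1 / 2 : ℝ) ^ ((H - 1) * m) * (j : ℝ) ^ ((H - 1) * m) := by
    refine Summable.mul_left _ (Real.summable_nat_rpow.2 ?_)
    unfold hStar at hm; linarith
  have hb : ∀ j : ℕ, j ≠ 0 → blockDecay H A j ^ m ≤
      A ^ m * (1 / 2 : ℝ) ^ ((H - 1) * m) * (j : ℝ) ^ ((H - 1) * m) := by
    intro j hj
    calc blockDecay H A j ^ m ≤ (A * ((j : ℝ) / 2) ^ (H - 1)) ^ m := by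
          refine pow_le_pow_left₀ (blockDecay_nonneg hA j) ?_ m
          rw [blockDecay, if_neg hj]; exact min_le_right _ _
      _ = _ := by
          rw [div_eq_mul_one_div, Real.mul_rpow (by positivity) (by norm_num), mul_pow, mul_pow,
            ← Real.rpow_mul_natCast (by positivity), ← Real.rpow_mul_natCast (by norm_num)]
          ring
  refine ⟨1 + ∑' j : ℕ, A ^ m * (1 / 2 : ℝ) ^ ((H - 1) * m) * (j : ℝ) ^ ((H - 1) * m), ?_, fun n => ?_⟩
  · exact le_add_of_nonneg_right (tsum_nonneg fun j => by positivity)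
  · have h2 : ∀ j : ℕ, blockDecay H A j ^ m ≤ (if j = 0 then 1 else 0) +
        A ^ m * (1 / 2 : ℝ) ^ ((H - 1) * m) * (j : ℝ) ^ ((H - 1) * m) := by
      intro j
      rcases eq_or_ne j 0 with rfl | hj
      · simp only [if_true]
        exact (pow_le_one₀ (blockDecay_nonneg hA 0) (blockDecay_le_one 0)).trans
          (le_add_of_nonneg_right (by positivity))
      · simpa [hj] using hb j hj
    refine (Finset.sum_le_sum fun j _ => h2 j).trans ?_
    rw [Finset.sum_add_distrib]
    refine add_le_add ?_ (hs.sum_le_tsum _ fun j _ => by positivity)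
    rw [Finset.sum_ite_eq']
    split_ifs <;> norm_num

end blockDecay

namespace IsFOULike

variable {Ω E : Type*} [MeasurableSpace Ω] [NormedAddCommGroup E] [InnerProductSpace ℝ E]
  {P : Measure Ω} {H A : ℝ} {v : ℝ → E} {Y : ℝ → Ω → ℝ}

lemma shift (h : IsFOULike P H A v Y) (d : ℝ) :
    IsFOULike P H A (fun t => v (t + d)) (fun t => Y (t + d)) where
  continuous ω := (h.continuous ω).comp (continuous_id.add continuous_const)
  rep := h.rep.comp fun t => t + d
  norm_eq t := h.norm_eq _
  past s t hst w hw := by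
    have := h.past (s + d) (t + d) (by linarith) w (Submodule.span_mono ?_ hw)
    · rwa [add_sub_add_right_eq_sub] at this
    · rintro _ ⟨x, hx, rfl⟩
      exact ⟨x + d, by simpa using hx, rfl⟩
  corr hH s t hst := by
    have := h.corr hH (s + d) (t + d) (by simpa using hst)
    rwa [add_sub_add_right_eq_sub] at this

lemma continuous_comp (h : IsFOULike P H A v Y) {G : ℝ → ℝ} (hG : Continuous G) (ω : Ω) :
    Continuous fun t => G (Y t ω) := hG.comp (h.continuous ω)

lemma lpBdd [IsProbabilityMeasure P] (h : IsFOULike P H A v Y) {q m : ℕ} (hq : 1 ≤ q) {K : ℝ} {G : ℝ → ℝ}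
    (hG : HasChaosDecay q m K G) (t : ℝ) : LpBdd P (2 * q : ℕ) K (fun ω => G (Y t ω)) := by
  have := (h.rep.comp (fun _ : ℕ => t)).lpBdd_sum (N := 1) (fun _ _ => h.norm_eq t) hq hG
  simpa [h.norm_eq t] using this

lemma lpBdd_integral [IsProbabilityMeasure P] (h : IsFOULike P H A v Y) {q m : ℕ} (hq : 1 ≤ q) {K : ℝ} {G : ℝ → ℝ}
    (hG : HasChaosDecay q m K G) {a b : ℝ} (hab : a ≤ b) :
    LpBdd P (2 * q : ℕ) (K * (b - a)) (fun ω => ∫ t in a..b, G (Y t ω)) :=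
  LpBdd.intervalIntegral (h.continuous_comp hG.continuous) hab
    (by exact_mod_cast (by omega : 1 ≤ 2 * q)) fun t _ => h.lpBdd hq hG t

lemma lpBdd_iterInt [IsProbabilityMeasure P] (h : IsFOULike P H A v Y) {q m m' : ℕ} (hq : 1 ≤ q) {K K' : ℝ} {G G' : ℝ → ℝ}
    (hG : HasChaosDecay q m K G) (hG' : HasChaosDecay q m' K' G') {a b : ℝ} (hab : a ≤ b) :
    LpBdd P q (K * K' * (b - a) ^ 2)
      (fun ω => iterInt (fun t => G (Y t ω)) (fun t => G' (Y t ω)) a b) := by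
  refine (LpBdd.intervalIntegral (c := K * (K' * (b - a))) (fun ω => ?_) hab
    (by exact_mod_cast hq) fun t ht => ?_).mono (le_of_eq (by ring))
  · exact (h.continuous_comp hG.continuous ω).mul
      (continuous_primitive' (h.continuous_comp hG'.continuous ω) a)
  · refine (h.lpBdd hq hG t).mul ((h.lpBdd_integral hq hG' ht.1).mono ?_)
    exact mul_le_mul_of_nonneg_left (by linarith [ht.2]) hG'.nonneg

/-- The points of block `l` lie at least `(l - k) δ ≥ (l - k) / 2` after time `k δ`, which explains
the division by two in `blockDecay`. The value `1` is Cauchy-Schwarz for unit vectors. -/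
lemma hasBlockDecay (h : IsFOULike P H A v Y) (hH : H < 1) (hA : 0 ≤ A) {δ : ℝ} (hδ : 1 / 2 ≤ δ)
    (n : ℕ) {M : ℕ} (hM : 1 ≤ M) :
    HasBlockDecay (fun i : ℕ => v (i * (δ / M))) n M (blockDecay H A) := by
  intro k l j hkl _ _ w hw
  have hM0 : (0 : ℝ) < M := by exact_mod_cast hM
  have h1 : |inner ℝ (v (((l * M + j : ℕ) : ℝ) * (δ / M))) w| ≤ 1 * ‖w‖ := by
    refine (abs_real_inner_le_norm _ _).trans (le_of_eq ?_)
    rw [h.norm_eq]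
  rcases Nat.eq_or_lt_of_le hkl with rfl | hlt
  · simpa [blockDecay] using h1
  have hne : l - k ≠ 0 := by omega
  rw [blockDecay, if_neg hne]
  rcases min_choice 1 (A * (((l - k : ℕ) : ℝ) / 2) ^ (H - 1)) with e | e <;> rw [e]
  · exact h1
  have hlk : (0 : ℝ) < ((l - k : ℕ) : ℝ) := by exact_mod_cast (by omega : 0 < l - k)
  have hd : ((l - k : ℕ) : ℝ) / 2 ≤ ((l * M + j : ℕ) : ℝ) * (δ / M) - k * δ := by
    rw [Nat.cast_sub hkl] at hlk ⊢
    have : ((l * M + j : ℕ) : ℝ) * (δ / M) = l * δ + j * (δ / M) := by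
      push_cast; field_simp
    rw [this]
    have h0 : 0 ≤ (j : ℝ) * (δ / M) := by positivity
    nlinarith
  refine (h.past (k * δ) _ (by linarith) w (Submodule.span_mono ?_ hw)).trans ?_
  · rintro _ ⟨i, hi, rfl⟩
    refine ⟨i * (δ / M), ?_, rfl⟩
    have : (i : ℝ) ≤ k * M := by exact_mod_cast (Set.mem_Iio.1 hi).le
    calc (i : ℝ) * (δ / M) ≤ k * M * (δ / M) := by gcongr
      _ = k * δ := by field_simp
  · refine mul_le_mul_of_nonneg_right (mul_le_mul_of_nonneg_left ?_ hA) (norm_nonneg _)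
    exact Real.rpow_le_rpow_of_nonpos (by positivity) hd (by linarith)

/-- `n = ⌈T⌉` works since `⌈T⌉ ≤ T + 1 ≤ 2 T`. The lower bound on `δ` keeps the block decay uniform,
the bound on `n` converts the number of blocks into a power of `T`. -/
lemma exists_mesh {T : ℝ} (hT : 1 ≤ T) : ∃ (n : ℕ) (δ : ℝ), (n : ℝ) * δ = T ∧ 1 / 2 ≤ δ ∧ δ ≤ 1 ∧
    (n : ℝ) ≤ 2 * T := by
  have h1 := Nat.le_ceil T
  have h2 := (Nat.ceil_lt_add_one (by linarith : 0 ≤ T)).le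
  have hn : (0 : ℝ) < ⌈T⌉₊ := by linarith
  refine ⟨⌈T⌉₊, T / ⌈T⌉₊, by field_simp, ?_, ?_, by linarith⟩
  · rw [div_le_div_iff₀ two_pos hn]; linarith
  · rw [div_le_one hn]; exact h1

/-- Growth of integrals of functions of high Hermite rank. -/
theorem exists_lpBdd_integral_of_high (P : Measure Ω) [IsProbabilityMeasure P] (E : Type*)
    [NormedAddCommGroup E] [InnerProductSpace ℝ E] (hH : H < 1) (hA : 0 ≤ A)
    {q m : ℕ} (hq : 1 ≤ q) (hm : hStar H m < 0) {K : ℝ} {G : ℝ → ℝ} (hG : HasChaosDecay q m K G) :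
    ∃ C, 0 ≤ C ∧ ∀ (v : ℝ → E) (Y : ℝ → Ω → ℝ), IsFOULike P H A v Y → ∀ T, 0 ≤ T →
      LpBdd P (2 * q : ℕ) (C * T ^ (1 / 2 : ℝ)) (fun ω => ∫ t in 0..T, G (Y t ω)) := by
  obtain ⟨R, hR1, hR⟩ := exists_sum_blockDecay_pow_le hA hm
  have hK := hG.nonneg
  set C₁ := (3 * √(martConst (2 * q)) + 1) * (K * R) with hC₁
  have hC₁0 : 0 ≤ C₁ := by positivity
  refine ⟨K + 2 * C₁, by positivity, fun v Y h T hT0 => ?_⟩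
  rw [← Real.sqrt_eq_rpow]
  -- For `T < 1` the trivial bound `K T ≤ K √T` suffices; only longer intervals are cut into blocks.
  rcases lt_or_ge T 1 with hT | hT
  · have := h.lpBdd_integral hq hG hT0
    rw [sub_zero] at this
    refine this.mono ?_
    have : T ≤ √T := Real.le_sqrt_of_sq_le (by nlinarith)
    calc K * T ≤ K * √T := by gcongr
      _ ≤ _ := by gcongr; linarith
  · obtain ⟨n, δ, hn, hδ, hδ1, hn2⟩ := exists_mesh hT
    -- The number of blocks is fixed while each block is discretised by `M + 1` points; the bound
    -- does not see `M`, and `M → ∞` turns averages into integrals.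
    have h1 : ∀ M : ℕ, LpBdd P (2 * q : ℕ) (δ * (C₁ * √n))
        (fun ω => ∑ k ∈ Finset.range n, δ * blockAvg (M + 1)
          (fun i => G (Y (i * (δ / (M + 1 : ℕ))) ω)) k) := by
      intro M
      have h2 := ((h.rep.comp fun i : ℕ => (i : ℝ) * (δ / (M + 1 : ℕ))).lpBdd_blockSum (n := n)
        (Nat.le_add_left 1 M) (fun _ _ => h.norm_eq _) (blockDecay_nonneg hA) blockDecay_le_one
        (h.hasBlockDecay hH hA hδ n (Nat.le_add_left 1 M)) hq hG hR1 hR).const_mul δ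
      simpa only [Finset.mul_sum, abs_of_nonneg (by linarith : 0 ≤ δ)] using h2
    refine (LpBdd.of_tendsto h1 (ae_of_all _ fun ω => ?_)).mono (d := (K + 2 * C₁) * √T) ?_
    · have h3 := intervalIntegral.sum_integral_adjacent_intervals (f := fun t => G (Y t ω))
        (μ := volume) (a := fun i : ℕ => i * δ) (n := n)
        (fun k _ => (h.continuous_comp hG.continuous ω).intervalIntegrable _ _)
      rw [hn, Nat.cast_zero, zero_mul] at h3
      rw [← h3]
      refine tendsto_finsetSum _ fun k _ => ?_
      rw [Nat.cast_succ]
      exact (tendsto_blockAvg (h.continuous_comp hG.continuous ω) (by linarith) k).comp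
        (Filter.tendsto_add_atTop_nat 1)
    · have h4 : √(n : ℝ) ≤ 2 * √T := by
        rw [Real.sqrt_le_left (by positivity), mul_pow, Real.sq_sqrt hT0]; linarith
      calc δ * (C₁ * √n) ≤ 1 * (C₁ * (2 * √T)) := by gcongr
        _ = 2 * C₁ * √T := by ring
        _ ≤ _ := by gcongr; linarith

/-- Growth of iterated integrals of functions of high Hermite rank. -/
theorem exists_lpBdd_iterInt_of_high (P : Measure Ω) [IsProbabilityMeasure P] (E : Type*)
    [NormedAddCommGroup E] [InnerProductSpace ℝ E] (hH : H < 1) (hA : 0 ≤ A)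
    {q m m' : ℕ} (hq : 2 ≤ q) (hm : hStar H m < 0) (hm' : hStar H m' < 0) {K K' : ℝ} {G G' : ℝ → ℝ}
    (hG : HasChaosDecay q m K G) (hG' : HasChaosDecay q m' K' G') :
    ∃ C, 0 ≤ C ∧ ∀ (v : ℝ → E) (Y : ℝ → Ω → ℝ), IsFOULike P H A v Y → ∀ T, 0 ≤ T →
      LpBdd P q (C * T) (fun ω => iterInt (fun t => G (Y t ω)) (fun t => G' (Y t ω)) 0 T) := by
  obtain ⟨R, hR1, hR⟩ := exists_sum_blockDecay_pow_le hA hm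
  obtain ⟨R', hR1', hR'⟩ := exists_sum_blockDecay_pow_le hA hm'
  have hK := hG.nonneg
  have hK' := hG'.nonneg
  have hq1 : (1 : ℝ≥0∞) ≤ q := by exact_mod_cast (by omega : 1 ≤ q)
  set C₁ := (3 * √(martConst q) * (3 * √(martConst (2 * q)) + 1) + 1) * ((K * R) * (K' * R')) with hC₁
  have hC₁0 : 0 ≤ C₁ := by positivity
  refine ⟨2 * (K * K' + C₁), by positivity, fun v Y h T hT0 => ?_⟩
  rcases lt_or_ge T 1 with hT | hT
  · have := h.lpBdd_iterInt (by omega) hG hG' hT0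
    rw [sub_zero] at this
    refine this.mono ?_
    calc K * K' * T ^ 2 ≤ K * K' * T := by gcongr; nlinarith
      _ ≤ _ := by
          have := mul_nonneg hK hK'
          exact mul_le_mul_of_nonneg_right (by linarith) hT0
  · obtain ⟨n, δ, hn, hδ, hδ1, hn2⟩ := exists_mesh hT
    have hδ0 : 0 ≤ δ := by linarith
    have hf := fun ω => h.continuous_comp hG.continuous ω
    have hg := fun ω => h.continuous_comp hG'.continuous ω
    have h1 : ∀ M : ℕ, LpBdd P q (δ ^ 2 * (C₁ * n))
        (fun ω => ∑ k ∈ Finset.range n, δ * blockAvg (M + 1)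
          (fun i => G (Y (i * (δ / (M + 1 : ℕ))) ω)) k * ∑ l ∈ Finset.range k, δ * blockAvg (M + 1)
          (fun i => G' (Y (i * (δ / (M + 1 : ℕ))) ω)) l) := by
      intro M
      have h2 := ((h.rep.comp fun i : ℕ => (i : ℝ) * (δ / (M + 1 : ℕ))).lpBdd_iterated_blockSum
        (n := n) (Nat.le_add_left 1 M) (fun _ _ => h.norm_eq _) (blockDecay_nonneg hA)
        blockDecay_le_one (h.hasBlockDecay hH hA hδ n (Nat.le_add_left 1 M)) hq hG hG' hR1 hR1' hR
        hR').const_mul (δ ^ 2)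
      rw [abs_of_nonneg (by positivity)] at h2
      refine h2.congr (ae_of_all _ fun ω => ?_)
      simp only [Finset.mul_sum]
      refine Finset.sum_congr rfl fun k _ => Finset.sum_congr rfl fun l _ => ?_
      ring
    have h5 : LpBdd P q (δ ^ 2 * (C₁ * n)) (fun ω => ∑ k ∈ Finset.range n,
        (∫ s in (k * δ)..((k + 1) * δ), G (Y s ω)) *
        ∑ l ∈ Finset.range k, (∫ s in (l * δ)..((l + 1) * δ), G' (Y s ω))) := by
      refine LpBdd.of_tendsto h1 (ae_of_all _ fun ω => ?_)
      refine tendsto_finsetSum _ fun k _ => Filter.Tendsto.mul ?_ (tendsto_finsetSum _ fun l _ => ?_)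
      · exact (tendsto_blockAvg (hf ω) hδ0 k).comp (Filter.tendsto_add_atTop_nat 1)
      · exact (tendsto_blockAvg (hg ω) hδ0 l).comp (Filter.tendsto_add_atTop_nat 1)
    -- The diagonal blocks need no cancellation: there are at most `2 T` of them, each of bounded
    -- norm.
    have h6 : LpBdd P q (∑ _k ∈ Finset.range n, K * K' * δ ^ 2) (fun ω => ∑ k ∈ Finset.range n,
        iterInt (fun t => G (Y t ω)) (fun t => G' (Y t ω)) (k * δ) ((k + 1) * δ)) := by
      refine LpBdd.sum hq1 fun k _ => ?_
      refine (h.lpBdd_iterInt (by omega) hG hG' (by nlinarith)).mono (le_of_eq ?_)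
      ring
    refine ((h5.add h6 hq1).congr (ae_of_all _ fun ω => ?_)).mono (d := 2 * (K * K' + C₁) * T) ?_
    · rw [← hn]; exact (iterInt_blocks (hf ω) (hg ω) δ n).symm
    · rw [Finset.sum_const, Finset.card_range, nsmul_eq_mul]
      have hδ2 : δ ^ 2 ≤ 1 := pow_le_one₀ hδ0 hδ1
      calc _ = (n * (K * K' + C₁)) * δ ^ 2 := by ring
        _ ≤ (2 * T * (K * K' + C₁)) * 1 := by gcongr
        _ = _ := by ring

/-- Growth of integrals of functions of low Hermite rank. -/
theorem exists_lpBdd_integral_of_low (P : Measure Ω) [IsProbabilityMeasure P] (E : Type*)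
    [NormedAddCommGroup E] [InnerProductSpace ℝ E] (hH : H < 1) (hA : 0 ≤ A)
    {q m : ℕ} (hq : 1 ≤ q) (hm1 : 1 ≤ m) (hm : 1 / 2 < hStar H m) {K : ℝ} {G : ℝ → ℝ}
    (hG : HasChaosDecay q m K G) :
    ∃ C, 0 ≤ C ∧ ∀ (v : ℝ → E) (Y : ℝ → Ω → ℝ), IsFOULike P H A v Y → ∀ T, 0 ≤ T →
      LpBdd P (2 * q : ℕ) (C * T ^ hStar H m) (fun ω => ∫ t in 0..T, G (Y t ω)) := by
  set β := (m : ℝ) * (1 - H) with hβ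
  have hst : hStar H m = 1 - β := by rw [hStar, hβ]; ring
  have hm1' : (1 : ℝ) ≤ m := by exact_mod_cast hm1
  rw [hst] at hm ⊢
  have hβ0 : 0 < β := by rw [hβ]; exact mul_pos (by linarith) (by linarith)
  -- From `m ≥ 1` and `β < 1/2`; hence the correlation estimate is available.
  have hH2 : 1 / 2 < H := by nlinarith
  set D := 2 * (2 * A ^ m + 1) / (1 - 2 * β) with hD
  have hβ2 : 0 < 1 - 2 * β := by linarith
  have hD0 : 0 ≤ D := by positivity
  have hK := hG.nonneg
  refine ⟨K * √D, by positivity, fun v Y h T hT0 => ?_⟩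
  rcases hT0.eq_or_lt with rfl | hT
  · rw [Real.zero_rpow (by linarith), mul_zero]
    simpa using LpBdd.zero
  -- Taking at least `⌈T⌉` points makes the mesh at most `1`, so `δ ^ (-2β) ≥ 1` and the bound `ψ`
  -- also covers the diagonal terms.
  have h1 : ∀ N : ℕ, LpBdd P (2 * q : ℕ) (K * √D * T ^ (1 - β)) (fun ω => T / (N + ⌈T⌉₊ : ℕ) *
      ∑ i ∈ Finset.range (N + ⌈T⌉₊), G (Y (0 + i * (T / (N + ⌈T⌉₊ : ℕ))) ω)) := by
    intro N
    set n := N + ⌈T⌉₊ with hn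
    have hnT : T ≤ n := (Nat.le_ceil T).trans (by exact_mod_cast Nat.le_add_left _ _)
    have hn0 : (0 : ℝ) < n := by linarith
    set δ := T / n with hδ
    have hδ0 : 0 < δ := by positivity
    have hδ1 : δ ≤ 1 := (div_le_one hn0).2 hnT
    have h2 := ((h.rep.comp fun i : ℕ => 0 + (i : ℝ) * δ).lpBdd_sum (N := n)
      (fun _ _ => h.norm_eq _) hq hG).const_mul δ
    refine h2.mono ?_
    -- The shift to `d + 1` avoids the singularity at `d = 0`: for `d ≥ 1` it costs `2 ^ (2β) ≤ 2`
    -- since `d ≥ (d + 1) / 2`, and the summand `+ 1` pays for `i = j`.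
    set ψ : ℕ → ℝ := fun d => (2 * A ^ m + 1) * δ ^ (-(2 * β)) * ((d : ℝ) + 1) ^ (-(2 * β)) with hψ
    have hψ0 : ∀ d, 0 ≤ ψ d := fun d => by positivity
    have hterm : ∀ i j : ℕ, |inner ℝ (v (0 + i * δ)) (v (0 + j * δ))| ^ m ≤ ψ (i - j + (j - i)) := by
      intro i j
      have hone : 1 ≤ δ ^ (-(2 * β)) := by
        rw [Real.rpow_neg hδ0.le]
        exact (one_le_inv₀ (by positivity)).2 (Real.rpow_le_one hδ0.le hδ1 (by linarith))
      rcases eq_or_ne i j with rfl | hij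
      · simp only [hψ, Nat.sub_self, add_zero, Nat.cast_zero, zero_add, Real.one_rpow, mul_one]
        rw [real_inner_self_eq_norm_sq, h.norm_eq]
        simp only [one_pow, abs_one]
        nlinarith [pow_nonneg hA m]
      · set d := i - j + (j - i) with hd
        have hd1 : 1 ≤ d := by omega
        have hd1' : (1 : ℝ) ≤ d := by exact_mod_cast hd1
        have habs : |(0 + (j : ℝ) * δ) - (0 + i * δ)| = d * δ := by
          have e : |(j : ℝ) - i| = d := by
            rcases le_total i j with hle | hle
            · have : d = j - i := by omega
              rw [this, Nat.cast_sub hle, abs_of_nonneg]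
              rw [sub_nonneg]; exact_mod_cast hle
            · have : d = i - j := by omega
              rw [this, Nat.cast_sub hle, abs_sub_comm, abs_of_nonneg]
              rw [sub_nonneg]; exact_mod_cast hle
          rw [zero_add, zero_add, ← sub_mul, abs_mul, e, abs_of_pos hδ0]
        have hne : 0 + (i : ℝ) * δ ≠ 0 + j * δ := by
          intro e
          rw [e, sub_self, abs_zero] at habs
          have : 0 < d * δ := by positivity
          linarith
        have h3 := h.corr hH2 _ _ hne
        rw [habs] at h3
        have hexp : (2 * H - 2) * m = -(2 * β) := by rw [hβ]; ring
        calc _ ≤ (A * (d * δ) ^ (2 * H - 2)) ^ m := pow_le_pow_left₀ (abs_nonneg _) h3 m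
          _ = A ^ m * δ ^ (-(2 * β)) * (d : ℝ) ^ (-(2 * β)) := by
              rw [mul_pow, ← Real.rpow_mul_natCast (by positivity), hexp,
                Real.mul_rpow (by positivity) hδ0.le]
              ring
          _ ≤ A ^ m * δ ^ (-(2 * β)) * (2 * ((d : ℝ) + 1) ^ (-(2 * β))) := by
              refine mul_le_mul_of_nonneg_left ?_ (by positivity)
              have h5 : (d : ℝ) ^ (-(2 * β)) ≤ (((d : ℝ) + 1) / 2) ^ (-(2 * β)) :=
                Real.rpow_le_rpow_of_nonpos (by positivity) (by linarith) (by linarith)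
              refine h5.trans ?_
              rw [div_eq_mul_inv, Real.mul_rpow (by positivity) (by norm_num), mul_comm]
              refine mul_le_mul_of_nonneg_right ?_ (by positivity)
              rw [Real.inv_rpow two_pos.le, ← Real.rpow_neg two_pos.le, neg_neg]
              calc (2 : ℝ) ^ (2 * β) ≤ 2 ^ (1 : ℝ) :=
                    Real.rpow_le_rpow_of_exponent_le one_le_two (by linarith)
                _ = 2 := Real.rpow_one 2
          _ = (2 * A ^ m) * δ ^ (-(2 * β)) * ((d : ℝ) + 1) ^ (-(2 * β)) := by ring
          _ ≤ ψ d := by simp only [hψ]; gcongr; linarith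
    have hsum : ∑ i ∈ Finset.range n, ∑ j ∈ Finset.range n,
        |inner ℝ (v (0 + i * δ)) (v (0 + j * δ))| ^ m ≤ D * δ ^ (-(2 * β)) * (n : ℝ) ^ (2 - 2 * β) := by
      refine (Finset.sum_le_sum fun i _ => Finset.sum_le_sum fun j _ => hterm i j).trans
        ((sum_sum_dist_le hψ0 n).trans ?_)
      rw [hψ, ← Finset.mul_sum]
      calc _ ≤ (n : ℝ) * (2 * ((2 * A ^ m + 1) * δ ^ (-(2 * β)) *
            ((n : ℝ) ^ (1 - 2 * β) / (1 - 2 * β)))) := by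
            gcongr
            exact sum_rpow_neg_le (by linarith) (by linarith) n
        _ = _ := by
            have : (n : ℝ) ^ (2 - 2 * β) = n * (n : ℝ) ^ (1 - 2 * β) := by
              rw [show 2 - 2 * β = 1 + (1 - 2 * β) by ring, Real.rpow_add hn0, Real.rpow_one]
            rw [this, hD]; ring
    have hfin : δ * √(D * δ ^ (-(2 * β)) * (n : ℝ) ^ (2 - 2 * β)) = √D * T ^ (1 - β) := by
      have e1 : D * δ ^ (-(2 * β)) * (n : ℝ) ^ (2 - 2 * β) =
          D * (δ ^ (-β) * (n : ℝ) ^ (1 - β)) ^ 2 := by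
        rw [mul_pow, ← Real.rpow_mul_natCast hδ0.le, ← Real.rpow_mul_natCast hn0.le, mul_assoc]
        congr 3 <;> push_cast <;> ring
      rw [e1, Real.sqrt_mul hD0, Real.sqrt_sq (by positivity)]
      have e2 : T = δ * n := by rw [hδ]; field_simp
      have e3 : δ ^ (1 - β) = δ * δ ^ (-β) := by
        rw [sub_eq_add_neg, Real.rpow_add hδ0, Real.rpow_one]
      rw [e2, Real.mul_rpow hδ0.le hn0.le, e3]
      ring
    rw [abs_of_pos hδ0]
    calc _ ≤ δ * (K * √(D * δ ^ (-(2 * β)) * (n : ℝ) ^ (2 - 2 * β))) := by gcongr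
      _ = K * (δ * √(D * δ ^ (-(2 * β)) * (n : ℝ) ^ (2 - 2 * β))) := by ring
      _ = _ := by rw [hfin]; ring
  refine LpBdd.of_tendsto h1 (ae_of_all _ fun ω => ?_)
  have := tendsto_riemannSum (h.continuous_comp hG.continuous ω) 0 hT0
  rw [zero_add] at this
  exact this.comp (Filter.tendsto_add_atTop_nat ⌈T⌉₊)

/-- Growth of iterated integrals when the sum of the exponents exceeds one. -/
theorem exists_lpBdd_iterInt_of_one_lt (P : Measure Ω) [IsProbabilityMeasure P] (E : Type*)
    [NormedAddCommGroup E] [InnerProductSpace ℝ E] {q m m' : ℕ} (hq : 1 ≤ q) {K K' : ℝ}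
    {G G' : ℝ → ℝ} (hG : HasChaosDecay q m K G) (hG' : HasChaosDecay q m' K' G')
    {C C' θ θ' : ℝ} (hC : 0 ≤ C) (hC' : 0 ≤ C') (hθ : 1 < θ + θ')
    (h : ∀ (v : ℝ → E) (Y : ℝ → Ω → ℝ), IsFOULike P H A v Y → ∀ T, 0 ≤ T →
      LpBdd P (2 * q : ℕ) (C * T ^ θ) (fun ω => ∫ t in 0..T, G (Y t ω)))
    (h' : ∀ (v : ℝ → E) (Y : ℝ → Ω → ℝ), IsFOULike P H A v Y → ∀ T, 0 ≤ T →
      LpBdd P (2 * q : ℕ) (C' * T ^ θ') (fun ω => ∫ t in 0..T, G' (Y t ω))) :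
    ∃ D, 0 ≤ D ∧ ∀ (v : ℝ → E) (Y : ℝ → Ω → ℝ), IsFOULike P H A v Y → ∀ T, 0 ≤ T →
      LpBdd P q (D * T ^ (θ + θ'))
        (fun ω => iterInt (fun t => G (Y t ω)) (fun t => G' (Y t ω)) 0 T) := by
  have hq1 : (1 : ℝ≥0∞) ≤ q := by exact_mod_cast hq
  set a := (1 / 2 : ℝ) ^ (θ + θ') with ha
  have ha0 : 0 ≤ a := by positivity
  -- `a = 2^{-(θ+θ')} < 1/2` makes the halving recursion contract; `D` is the fixed point of `D ↦ 2
  -- a D + C C' a`.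
  have ha1 : 0 < 1 - 2 * a := by
    have : a < (1 / 2 : ℝ) ^ (1 : ℝ) :=
      Real.rpow_lt_rpow_of_exponent_gt (by norm_num) (by norm_num) hθ
    rw [Real.rpow_one] at this; linarith
  set D := C * C' * a / (1 - 2 * a) with hD
  have hD0 : 0 ≤ D := by positivity
  have hDeq : 2 * (D * a) + C * C' * a = D := by rw [hD]; field_simp; ring
  -- Start from the quadratic bound and improve it by halving: Chen's relation at the midpoint gives
  -- two iterated integrals over `T / 2`, the later one being of the same kind for the shifted
  -- process, and a product of two single integrals. Each step halves the quadratic part, as `2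
  -- (T/2)² = T²/2`, and reproduces the term with `D`.
  have key : ∀ n : ℕ, ∀ (v : ℝ → E) (Y : ℝ → Ω → ℝ), IsFOULike P H A v Y → ∀ T, 0 ≤ T →
      LpBdd P q (K * K' * T ^ 2 * (1 / 2) ^ n + D * T ^ (θ + θ'))
        (fun ω => iterInt (fun t => G (Y t ω)) (fun t => G' (Y t ω)) 0 T) := by
    intro n
    induction n with
    | zero =>
      intro v Y hY T hT
      refine (hY.lpBdd_iterInt hq hG hG' hT).mono ?_
      rw [sub_zero, pow_zero, mul_one]
      exact le_add_of_nonneg_right (by positivity)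
    | succ n ih =>
      intro v Y hY T hT
      have hT2 : 0 ≤ T / 2 := by positivity
      have hs := hY.shift (T / 2)
      have h1 := ih v Y hY (T / 2) hT2
      have h2 := ih _ _ hs (T / 2) hT2
      have h3 := (h _ _ hs (T / 2) hT2).mul (h' v Y hY (T / 2) hT2)
      refine (((h1.add h2 hq1).add h3 hq1).congr (ae_of_all _ fun ω => ?_)).mono (le_of_eq ?_)
      · have e1 := iterInt_comp_add (f := fun t => G (Y t ω)) (g := fun t => G' (Y t ω))
          (T / 2) 0 (T / 2)
        have e2 : ∫ t in 0..(T / 2), G (Y (t + T / 2) ω) = ∫ t in (T / 2)..T, G (Y t ω) := by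
          rw [intervalIntegral.integral_comp_add_right (fun t => G (Y t ω)), zero_add, add_halves]
        simp only [zero_add, add_halves] at e1
        simp only [e1, e2]
        exact (iterInt_chen (hY.continuous_comp hG.continuous ω)
          (hY.continuous_comp hG'.continuous ω) 0 (T / 2) T).symm
      · have e : (T / 2) ^ (θ + θ') = T ^ (θ + θ') * a := by
          rw [div_eq_mul_one_div, Real.mul_rpow hT (by norm_num)]
        have e' : (T / 2) ^ θ * (T / 2) ^ θ' = (T / 2) ^ (θ + θ') := by
          rcases hT2.eq_or_lt with h0 | h0
          · rw [← h0, Real.zero_rpow (by linarith : θ + θ' ≠ 0)]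
            by_cases hθ0 : θ = 0
            · rw [hθ0, Real.zero_rpow (by linarith : θ' ≠ 0), mul_zero]
            · rw [Real.zero_rpow hθ0, zero_mul]
          · rw [Real.rpow_add h0]
        calc _ = K * K' * T ^ 2 * (1 / 2) ^ (n + 1) + 2 * (D * (T / 2) ^ (θ + θ')) +
              C * C' * ((T / 2) ^ θ * (T / 2) ^ θ') := by rw [pow_succ]; ring
          _ = K * K' * T ^ 2 * (1 / 2) ^ (n + 1) + (2 * (D * a) + C * C' * a) * T ^ (θ + θ') := by
              rw [e', e]; ring
          _ = _ := by rw [hDeq]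
  refine ⟨D, hD0, fun v Y hY T hT => ?_⟩
  refine LpBdd.of_forall_tendsto (fun n => key n v Y hY T hT) ?_
  have := (tendsto_pow_atTop_nhds_zero_of_lt_one (by norm_num : (0 : ℝ) ≤ 1 / 2)
    (by norm_num)).const_mul (K * K' * T ^ 2)
  simpa using this.add_const (D * T ^ (θ + θ'))

theorem exists_lpBdd_integral (P : Measure Ω) [IsProbabilityMeasure P] (E : Type*)
    [NormedAddCommGroup E] [InnerProductSpace ℝ E] (hH : H < 1) (hA : 0 ≤ A)
    {q m : ℕ} (hq : 1 ≤ q) (hm1 : 1 ≤ m) (hm : hStar H m < 0 ∨ 1 / 2 < hStar H m) {K : ℝ}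
    {G : ℝ → ℝ} (hG : HasChaosDecay q m K G) :
    ∃ C, 0 ≤ C ∧ ∀ (v : ℝ → E) (Y : ℝ → Ω → ℝ), IsFOULike P H A v Y → ∀ T, 0 ≤ T →
      LpBdd P (2 * q : ℕ) (C * T ^ max (hStar H m) (1 / 2)) (fun ω => ∫ t in 0..T, G (Y t ω)) := by
  rcases hm with hm | hm
  · rw [max_eq_right (by linarith)]
    exact exists_lpBdd_integral_of_high P E hH hA hq hm hG
  · rw [max_eq_left hm.le]
    exact exists_lpBdd_integral_of_low P E hH hA hq hm1 hm hG

/-- Two high ranks have exponents summing to exactly one, the borderline case in which halving fails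
and the martingale argument is needed. As soon as one rank is low the sum exceeds one. -/
theorem exists_lpBdd_iterInt (P : Measure Ω) [IsProbabilityMeasure P] (E : Type*)
    [NormedAddCommGroup E] [InnerProductSpace ℝ E] (hH : H < 1) (hA : 0 ≤ A)
    {q m m' : ℕ} (hq : 2 ≤ q) (hm1 : 1 ≤ m) (hm1' : 1 ≤ m')
    (hm : hStar H m < 0 ∨ 1 / 2 < hStar H m) (hm' : hStar H m' < 0 ∨ 1 / 2 < hStar H m')
    {K K' : ℝ} {G G' : ℝ → ℝ} (hG : HasChaosDecay q m K G) (hG' : HasChaosDecay q m' K' G') :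
    ∃ C, 0 ≤ C ∧ ∀ (v : ℝ → E) (Y : ℝ → Ω → ℝ), IsFOULike P H A v Y → ∀ T, 0 ≤ T →
      LpBdd P q (C * T ^ (max (hStar H m) (1 / 2) + max (hStar H m') (1 / 2)))
        (fun ω => iterInt (fun t => G (Y t ω)) (fun t => G' (Y t ω)) 0 T) := by
  by_cases hboth : hStar H m < 0 ∧ hStar H m' < 0
  · rw [max_eq_right (by linarith), max_eq_right (by linarith), add_halves]
    simpa only [Real.rpow_one] using
      exists_lpBdd_iterInt_of_high P E hH hA hq hboth.1 hboth.2 hG hG'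
  · obtain ⟨C, hC, h⟩ := exists_lpBdd_integral P E hH hA (by omega) hm1 hm hG
    obtain ⟨C', hC', h'⟩ := exists_lpBdd_integral P E hH hA (by omega) hm1' hm' hG'
    refine exists_lpBdd_iterInt_of_one_lt P E (by omega) hG hG' hC hC' ?_ h h'
    have h1 := le_max_right (hStar H m) (1 / 2)
    have h2 := le_max_right (hStar H m') (1 / 2)
    have h3 := le_max_left (hStar H m) (1 / 2)
    have h4 := le_max_left (hStar H m') (1 / 2)
    rcases hm with hm | hm
    · rcases hm' with hm' | hm'
      · exact absurd ⟨hm, hm'⟩ hboth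
      · linarith
    · linarith

end IsFOULike

/-! ### The Ornstein-Uhlenbeck transform of a fractional Brownian curve -/

lemma abs_rpow_sub_rpow_le {p m x y : ℝ} (hp : p ≤ 1) (hm : 0 < m) (hx : m ≤ x) (hy : m ≤ y) :
    |y ^ p - x ^ p| ≤ |p| * m ^ (p - 1) * |y - x| := by
  refine (convex_Ici m).norm_image_sub_le_of_norm_hasDerivWithin_le (f := fun x => x ^ p)
    (f' := fun x => p * x ^ (p - 1)) (fun z hz => ?_) (fun z hz => ?_) hx hy
  · exact (Real.hasDerivAt_rpow_const (Or.inl (hm.trans_le hz).ne')).hasDerivWithinAt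
  · rw [Real.norm_eq_abs, abs_mul, abs_of_nonneg (Real.rpow_nonneg (hm.le.trans hz) _)]
    exact mul_le_mul_of_nonneg_left (Real.rpow_le_rpow_of_nonpos hm hz (by linarith)) (abs_nonneg _)

/-- A second difference, bounded by applying the mean value theorem twice; `p (p - 1) ≤ 2`. -/
lemma abs_rpow_double_sub_le {p m x y r : ℝ} (hp1 : 1 ≤ p) (hp : p ≤ 2) (hm : 0 < m) (hr : 0 ≤ r)
    (hx : m ≤ x) (hy : m ≤ y) :
    |((y + r) ^ p - y ^ p) - ((x + r) ^ p - x ^ p)| ≤ 2 * m ^ (p - 2) * r * |y - x| := by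
  refine (convex_Ici m).norm_image_sub_le_of_norm_hasDerivWithin_le
    (f := fun x => (x + r) ^ p - x ^ p)
    (f' := fun x => p * (x + r) ^ (p - 1) * 1 - p * x ^ (p - 1)) (fun z hz => ?_) (fun z hz => ?_)
    hx hy
  · have hz0 : 0 < z := hm.trans_le hz
    have h1 : HasDerivAt (fun x : ℝ => (x + r) ^ p) (p * (z + r) ^ (p - 1) * 1) z :=
      (Real.hasDerivAt_rpow_const (Or.inl (by positivity))).comp z ((hasDerivAt_id z).add_const r)
    exact (h1.sub (Real.hasDerivAt_rpow_const (Or.inl hz0.ne'))).hasDerivWithinAt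
  · have h1 := abs_rpow_sub_rpow_le (p := p - 1) (by linarith) hm hz
      (show m ≤ z + r by linarith [Set.mem_Ici.1 hz])
    rw [mul_one, ← mul_sub, Real.norm_eq_abs, abs_mul, abs_of_nonneg (by linarith : 0 ≤ p)]
    rw [abs_of_nonneg (by linarith : 0 ≤ p - 1), add_sub_cancel_left, abs_of_nonneg hr,
      show p - 1 - 1 = p - 2 by ring] at h1
    calc _ ≤ p * ((p - 1) * m ^ (p - 2) * r) := mul_le_mul_of_nonneg_left h1 (by linarith)
      _ = (p * (p - 1)) * (m ^ (p - 2) * r) := by ring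
      _ ≤ 2 * (m ^ (p - 2) * r) := by
          refine mul_le_mul_of_nonneg_right (by nlinarith) (by positivity)
      _ = _ := by ring

/-- A curve in a Hilbert space with the increments of fractional Brownian motion. -/
def IsFBMCurve {E : Type*} [NormedAddCommGroup E] (H : ℝ) (b : ℝ → E) : Prop :=
  ∀ s t, ‖b t - b s‖ = |t - s| ^ H

/-- The Ornstein-Uhlenbeck transform `∫_0^∞ e^{-r} (b(t) - b(t - r)) dr` of a curve. -/
noncomputable def ouCurve {E : Type*} [NormedAddCommGroup E] [NormedSpace ℝ E] (b : ℝ → E) (t : ℝ) :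
    E := ∫ r in Set.Ioi (0 : ℝ), Real.exp (-r) • (b t - b (t - r))

lemma integrableOn_exp_neg_mul_rpow {p : ℝ} (hp : 0 ≤ p) :
    IntegrableOn (fun r => Real.exp (-r) * r ^ p) (Set.Ioi 0) := by
  have := Real.GammaIntegral_convergent (s := p + 1) (by linarith)
  simpa using this

/-- The weight `e^{-r} (1 + r²)`. -/
noncomputable def expWeight (r : ℝ) : ℝ := Real.exp (-r) * (1 + r ^ 2)

lemma expWeight_nonneg (r : ℝ) : 0 ≤ expWeight r := by unfold expWeight; positivity

lemma integrableOn_expWeight : IntegrableOn expWeight (Set.Ioi 0) := by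
  have h1 := (integrableOn_exp_neg_mul_rpow (p := 0) le_rfl).add
    (integrableOn_exp_neg_mul_rpow (p := 2) two_pos.le)
  refine h1.congr_fun (fun r _ => ?_) measurableSet_Ioi
  simp [expWeight, mul_add]

lemma rpow_le_one_add_sq {r p : ℝ} (hr : 0 ≤ r) (hp0 : 0 ≤ p) (hp : p ≤ 2) :
    r ^ p ≤ 1 + r ^ 2 := by
  rcases le_total r 1 with h | h
  · exact (Real.rpow_le_one hr h hp0).trans (by nlinarith)
  · refine (Real.rpow_le_rpow_of_exponent_le h hp).trans ?_
    rw [Real.rpow_two]; linarith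

section

variable {E : Type*} [NormedAddCommGroup E] {H : ℝ} {b : ℝ → E}

lemma IsFBMCurve.continuous (hb : IsFBMCurve H b) (hH : 0 < H) : Continuous b := by
  rw [continuous_iff_continuousAt]
  intro s
  rw [ContinuousAt, tendsto_iff_norm_sub_tendsto_zero]
  simp only [hb s]
  have h : Continuous fun t : ℝ => |t - s| ^ H :=
    (continuous_abs.comp (continuous_id.sub continuous_const)).rpow_const fun _ => Or.inr hH.le
  simpa [Real.zero_rpow hH.ne'] using h.tendsto s

lemma IsFBMCurve.shift (hb : IsFBMCurve H b) (d : ℝ) : IsFBMCurve H fun t => b (t + d) :=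
  fun s t => by simpa using hb (s + d) (t + d)

variable [InnerProductSpace ℝ E]

lemma ouCurve_shift (b : ℝ → E) (d t : ℝ) : ouCurve (fun t => b (t + d)) t = ouCurve b (t + d) := by
  simp only [ouCurve, sub_add_eq_add_sub]

lemma IsFBMCurve.norm_kernel (hb : IsFBMCurve H b) (t : ℝ) {r : ℝ} (hr : 0 < r) :
    ‖Real.exp (-r) • (b t - b (t - r))‖ = Real.exp (-r) * r ^ H := by
  rw [norm_smul, hb, sub_sub_cancel, abs_of_pos hr, Real.norm_eq_abs, abs_of_pos (Real.exp_pos _)]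

lemma IsFBMCurve.integrable_kernel (hb : IsFBMCurve H b) (hH : 0 < H) (t : ℝ) :
    IntegrableOn (fun r => Real.exp (-r) • (b t - b (t - r))) (Set.Ioi 0) := by
  have hc := hb.continuous hH
  refine Integrable.mono' (integrableOn_exp_neg_mul_rpow hH.le) ?_ ?_
  · exact Continuous.aestronglyMeasurable (by fun_prop)
  · exact (ae_restrict_iff' measurableSet_Ioi).2 (ae_of_all _ fun r hr => (hb.norm_kernel t hr).le)

/-- The covariance of increments of fractional Brownian motion. -/
noncomputable def fbmIncCov (H s s' t t' : ℝ) : ℝ :=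
  (|s - t'| ^ (2 * H) + |t - s'| ^ (2 * H) - |t - s| ^ (2 * H) - |t' - s'| ^ (2 * H)) / 2

lemma IsFBMCurve.inner_eq (hb : IsFBMCurve H b) (s s' t t' : ℝ) :
    inner ℝ (b s - b s') (b t - b t') = fbmIncCov H s s' t t' := by
  have hn : ∀ x y, inner ℝ (b y - b x) (b y - b x) = |y - x| ^ (2 * H) := fun x y => by
    rw [real_inner_self_eq_norm_sq, hb, ← Real.rpow_mul_natCast (abs_nonneg _)]
    congr 1; push_cast; ring
  rw [fbmIncCov, ← hn t' s, ← hn s' t, ← hn s t, ← hn s' t']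
  simp only [inner_sub_left, inner_sub_right]
  rw [real_inner_comm (b s) (b t), real_inner_comm (b s) (b t'), real_inner_comm (b s') (b t'),
    real_inner_comm (b s') (b t)]
  ring

lemma abs_fbmIncCov_le (H s s' t t' : ℝ) (hb : IsFBMCurve H b) :
    |fbmIncCov H s s' t t'| ≤ |s - s'| ^ H * |t - t'| ^ H := by
  rw [← hb.inner_eq, ← hb, ← hb]
  exact abs_real_inner_le_norm _ _

/-- If `r ≤ (t-s)/2` the two increments live on intervals at least `(t-s)/2` apart, and their
covariance is a second difference of `x^{2H}`. If `r` is larger, Cauchy-Schwarz suffices, since `r^H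
= r^{2H-2} r^{2-H}` and `2H - 2 < 0`. The weights `1 + r²` are integrable against `e^{-r}`. -/
lemma abs_fbmIncCov_le_of_lt (hb : IsFBMCurve H b) (hH : 1 / 2 < H) (hH1 : H < 1) {s t r r' : ℝ}
    (hst : s < t) (hr : 0 < r) (hr' : 0 < r') :
    |fbmIncCov H s (s - r') t (t - r)| ≤
      4 * (t - s) ^ (2 * H - 2) * (1 + r ^ 2) * (1 + r' ^ 2) := by
  have hτ : 0 < (t - s) / 2 := by linarith
  have h4 : ((t - s) / 2) ^ (2 * H - 2) ≤ 4 * (t - s) ^ (2 * H - 2) := by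
    rw [div_eq_mul_inv, Real.mul_rpow (by linarith) (by norm_num), mul_comm]
    refine mul_le_mul_of_nonneg_right ?_ (Real.rpow_nonneg (by linarith) _)
    rw [Real.inv_rpow two_pos.le, ← Real.rpow_neg two_pos.le]
    calc (2 : ℝ) ^ (-(2 * H - 2)) ≤ 2 ^ (2 : ℝ) :=
          Real.rpow_le_rpow_of_exponent_le one_le_two (by linarith)
      _ = 4 := by norm_num
  have hP : 0 ≤ ((t - s) / 2) ^ (2 * H - 2) := Real.rpow_nonneg hτ.le _
  rcases le_or_gt r ((t - s) / 2) with h | h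
  · have h1 := abs_rpow_double_sub_le (p := 2 * H) (m := (t - s) / 2) (x := t - s - r)
      (y := t - s - r + r') (r := r) (by linarith) (by linarith) hτ hr.le (by linarith)
      (by linarith)
    have e : fbmIncCov H s (s - r') t (t - r) = ((t - s - r + r' + r) ^ (2 * H) -
        (t - s - r + r') ^ (2 * H) - ((t - s - r + r) ^ (2 * H) - (t - s - r) ^ (2 * H))) / 2 := by
      rw [fbmIncCov, abs_sub_comm s, abs_of_pos (by linarith : 0 < t - r - s),
        abs_of_pos (by linarith : 0 < t - (s - r')), abs_of_pos (by linarith : 0 < t - s),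
        abs_of_pos (by linarith : 0 < t - r - (s - r'))]
      ring_nf
    rw [e, abs_div, abs_two, div_le_iff₀ two_pos]
    refine h1.trans ?_
    rw [add_sub_cancel_left, abs_of_pos hr']
    have hr2 : r ≤ 1 + r ^ 2 := by nlinarith
    have hr2' : r' ≤ 1 + r' ^ 2 := by nlinarith
    calc 2 * ((t - s) / 2) ^ (2 * H - 2) * r * r' ≤
        2 * (4 * (t - s) ^ (2 * H - 2)) * (1 + r ^ 2) * (1 + r' ^ 2) := by gcongr
      _ = _ := by ring
  · refine (abs_fbmIncCov_le H _ _ _ _ hb).trans ?_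
    rw [sub_sub_cancel, sub_sub_cancel, abs_of_pos hr, abs_of_pos hr']
    have h1 : r ^ H = r ^ (2 * H - 2) * r ^ (2 - H) := by
      rw [← Real.rpow_add hr]; congr 1; ring
    have h2 : r ^ (2 * H - 2) ≤ ((t - s) / 2) ^ (2 * H - 2) :=
      Real.rpow_le_rpow_of_nonpos hτ h.le (by linarith)
    rw [h1]
    calc r' ^ H * (r ^ (2 * H - 2) * r ^ (2 - H)) ≤
        (1 + r' ^ 2) * ((4 * (t - s) ^ (2 * H - 2)) * (1 + r ^ 2)) := by
          gcongr
          · exact rpow_le_one_add_sq hr'.le (by linarith) (by linarith)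
          · exact h2.trans h4
          · exact rpow_le_one_add_sq hr.le (by linarith) (by linarith)
      _ = _ := by ring

/-- The covariance of the Ornstein-Uhlenbeck transform. -/
noncomputable def ouCov (H s t : ℝ) : ℝ :=
  ∫ r in Set.Ioi (0 : ℝ), Real.exp (-r) *
    ∫ r' in Set.Ioi (0 : ℝ), Real.exp (-r') * fbmIncCov H s (s - r') t (t - r)

variable [CompleteSpace E]

/-- The right side depends on `H` only. Curves with the increments of fractional Brownian motion in
different Hilbert spaces therefore have transforms with the same Gram matrix. -/
theorem IsFBMCurve.inner_ouCurve (hb : IsFBMCurve H b) (hH : 0 < H) (s t : ℝ) :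
    inner ℝ (ouCurve b s) (ouCurve b t) = ouCov H s t := by
  rw [ouCov]
  conv_lhs => rw [ouCurve.eq_1 b t]
  rw [← integral_inner (hb.integrable_kernel hH t)]
  refine integral_congr_ae (ae_of_all _ fun r => ?_)
  simp only [inner_smul_right]
  congr 1
  rw [real_inner_comm, ouCurve, ← integral_inner (hb.integrable_kernel hH s)]
  refine integral_congr_ae (ae_of_all _ fun r' => ?_)
  simp only [inner_smul_right]
  rw [real_inner_comm, hb.inner_eq]

/-- This permits replacing the curve of `B` in `L²(P)` by the Mandelbrot-Van Ness curve, where the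
past is visible through supports. -/
theorem IsFBMCurve.norm_sum_ouCurve (hb : IsFBMCurve H b) (hH : 0 < H) {E' : Type*}
    [NormedAddCommGroup E'] [InnerProductSpace ℝ E'] [CompleteSpace E'] {b' : ℝ → E'}
    (hb' : IsFBMCurve H b') {ι : Type*} (s : Finset ι) (c : ι → ℝ) (t : ι → ℝ) :
    ‖∑ i ∈ s, c i • ouCurve b (t i)‖ = ‖∑ i ∈ s, c i • ouCurve b' (t i)‖ := by
  rw [← sq_eq_sq₀ (norm_nonneg _) (norm_nonneg _), ← real_inner_self_eq_norm_sq,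
    ← real_inner_self_eq_norm_sq]
  simp only [sum_inner, inner_sum, inner_smul_left, inner_smul_right, hb.inner_ouCurve hH,
    hb'.inner_ouCurve hH]

lemma IsFBMCurve.norm_ouCurve (hb : IsFBMCurve H b) (hH : 0 < H) (t : ℝ) :
    ‖ouCurve b t‖ = ‖ouCurve b 0‖ := by
  have := (hb.shift t).norm_sum_ouCurve hH hb {()} (fun _ => 1) (fun _ => 0)
  simpa [ouCurve_shift] using this

/-- For `H > 1/2` correlations decay like `|t - s|^{2H - 2}`. -/
theorem IsFBMCurve.exists_abs_inner_ouCurve_le (hb : IsFBMCurve H b) (hH : 1 / 2 < H)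
    (hH1 : H < 1) : ∃ A, 0 ≤ A ∧ ∀ s t, s ≠ t →
      |inner ℝ (ouCurve b s) (ouCurve b t)| ≤ A * |t - s| ^ (2 * H - 2) := by
  set W := ∫ r in Set.Ioi (0 : ℝ), expWeight r with hW
  have hW0 : 0 ≤ W := integral_nonneg fun r => expWeight_nonneg r
  have key : ∀ s t, s < t → |inner ℝ (ouCurve b s) (ouCurve b t)| ≤
      4 * W * W * |t - s| ^ (2 * H - 2) := by
    intro s t hst
    rw [hb.inner_ouCurve (by linarith), ouCov, abs_of_pos (sub_pos.2 hst)]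
    have hin : ∀ r ∈ Set.Ioi (0 : ℝ), |∫ r' in Set.Ioi (0 : ℝ),
        Real.exp (-r') * fbmIncCov H s (s - r') t (t - r)| ≤
        4 * (t - s) ^ (2 * H - 2) * (1 + r ^ 2) * W := by
      intro r hr
      rw [hW, ← integral_const_mul, ← Real.norm_eq_abs]
      refine norm_integral_le_of_norm_le (integrableOn_expWeight.const_mul _) ?_
      refine (ae_restrict_iff' measurableSet_Ioi).2 (ae_of_all _ fun r' hr' => ?_)
      rw [norm_mul, Real.norm_eq_abs, Real.norm_eq_abs, abs_of_pos (Real.exp_pos _), expWeight]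
      calc _ ≤ Real.exp (-r') * (4 * (t - s) ^ (2 * H - 2) * (1 + r ^ 2) * (1 + r' ^ 2)) := by
            gcongr; exact abs_fbmIncCov_le_of_lt hb hH hH1 hst hr hr'
        _ = _ := by ring
    have : 4 * W * W * (t - s) ^ (2 * H - 2) =
        ∫ r in Set.Ioi (0 : ℝ), (4 * (t - s) ^ (2 * H - 2) * W) * expWeight r := by
      rw [integral_const_mul, ← hW]; ring
    rw [this, ← Real.norm_eq_abs]
    refine norm_integral_le_of_norm_le (integrableOn_expWeight.const_mul _) ?_
    refine (ae_restrict_iff' measurableSet_Ioi).2 (ae_of_all _ fun r hr => ?_)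
    rw [norm_mul, Real.norm_eq_abs, Real.norm_eq_abs, abs_of_pos (Real.exp_pos _), expWeight]
    calc _ ≤ Real.exp (-r) * (4 * (t - s) ^ (2 * H - 2) * (1 + r ^ 2) * W) := by
          gcongr; exact hin r hr
      _ = _ := by ring
  refine ⟨4 * W * W, by positivity, fun s t hst => ?_⟩
  rcases lt_or_gt_of_ne hst with h | h
  · exact key s t h
  · rw [real_inner_comm, abs_sub_comm]; exact key t s h

end

/-! ### The Mandelbrot-Van Ness curve -/

/-- The function `x₊^a`. -/
noncomputable def powPos (a x : ℝ) : ℝ := max x 0 ^ a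

section powPos

variable {a : ℝ}

lemma powPos_of_nonpos (ha : a ≠ 0) {x : ℝ} (hx : x ≤ 0) : powPos a x = 0 := by
  rw [powPos, max_eq_right hx, Real.zero_rpow ha]

lemma powPos_of_nonneg {x : ℝ} (hx : 0 ≤ x) : powPos a x = x ^ a := by
  rw [powPos, max_eq_left hx]

lemma powPos_mul {h : ℝ} (hh : 0 ≤ h) (x : ℝ) : powPos a (h * x) = h ^ a * powPos a x := by
  rw [powPos, powPos, ← Real.mul_rpow hh (le_max_right _ _), mul_max_of_nonneg _ _ hh, mul_zero]

lemma measurable_powPos : Measurable (powPos a) := by unfold powPos; fun_prop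

/-- The increments `(t - x)₊^a - (s - x)₊^a`. -/
noncomputable def mvnKer (a s t x : ℝ) : ℝ := powPos a (t - x) - powPos a (s - x)

lemma measurable_mvnKer (s t : ℝ) : Measurable (mvnKer a s t) :=
  (measurable_powPos.comp (measurable_const.sub measurable_id)).sub
    (measurable_powPos.comp (measurable_const.sub measurable_id))

lemma integrableOn_powPos_sq (ha : -(1 / 2) < a) (ha0 : a ≠ 0) (R : ℝ) :
    IntegrableOn (fun x => powPos a x ^ 2) (Set.Iic R) := by
  have h1 : IntegrableOn (fun x => powPos a x ^ 2) (Set.Iic 0) :=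
    integrableOn_zero.congr_fun (fun x hx => by simp [powPos_of_nonpos ha0 hx]) measurableSet_Iic
  rcases le_total R 0 with hR | hR
  · exact h1.mono_set (Set.Iic_subset_Iic.2 hR)
  have h2 := (intervalIntegral.intervalIntegrable_rpow' (a := 0) (b := R)
    (show -1 < 2 * a by linarith)).1
  have h3 : IntegrableOn (fun x => powPos a x ^ 2) (Set.Ioc 0 R) :=
    h2.congr_fun (fun x hx => by
      simp only
      rw [powPos_of_nonneg hx.1.le, ← Real.rpow_mul_natCast hx.1.le]
      congr 1; push_cast; ring) measurableSet_Ioc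
  rw [← Set.Iic_union_Ioc_eq_Iic hR]
  exact h1.union h3

lemma abs_mvnKer_le (ha : a ≤ 1) {s t x : ℝ} (hxs : x < s) (hst : s ≤ t) :
    |mvnKer a s t x| ≤ |a| * (s - x) ^ (a - 1) * (t - s) := by
  rw [mvnKer, powPos_of_nonneg (by linarith), powPos_of_nonneg (by linarith)]
  have := abs_rpow_sub_rpow_le (p := a) (m := s - x) (x := s - x) (y := t - x) ha (by linarith)
    le_rfl (by linarith)
  rwa [sub_sub_sub_cancel_right, abs_of_nonneg (by linarith : 0 ≤ t - s)] at this

/-- The local singularity is square integrable because `2a > -1`; at infinity the increment is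
`O(x^{a-1})` by the mean value theorem, and `2a - 2 < -1`. -/
lemma integrable_mvnKer_zero_one (ha : -(1 / 2) < a) (ha1 : a < 1 / 2) (ha0 : a ≠ 0) :
    Integrable fun x => mvnKer a 0 1 (-x) ^ 2 := by
  rw [← integrableOn_univ, ← Set.Iic_union_Ioi (a := (1 : ℝ))]
  refine IntegrableOn.union ?_ ?_
  · have h1 : IntegrableOn (fun x => powPos a (1 + x) ^ 2) (Set.Iic 1) := by
      have := ((measurePreserving_add_left volume (1 : ℝ)).integrableOn_comp_preimage
        (measurableEmbedding_addLeft 1)).2 (integrableOn_powPos_sq ha ha0 2)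
      refine this.mono_set fun x hx => ?_
      simp only [Set.mem_preimage, Set.mem_Iic] at hx ⊢
      linarith
    refine Integrable.mono' ((h1.add (integrableOn_powPos_sq ha ha0 1)).const_mul 2) ?_ ?_
    · exact (((measurable_mvnKer 0 1).comp measurable_neg).pow_const 2).aestronglyMeasurable
    · refine ae_of_all _ fun x => ?_
      rw [Real.norm_eq_abs, abs_of_nonneg (sq_nonneg _), mvnKer, sub_neg_eq_add, sub_neg_eq_add,
        zero_add]
      simp only [Pi.add_apply]
      nlinarith [sq_nonneg (powPos a (1 + x) + powPos a x)]
  · refine Integrable.mono' ((integrableOn_Ioi_rpow_of_lt (a := 2 * a - 2) (by linarith)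
      one_pos).const_mul (|a| ^ 2)) ?_ ?_
    · exact (((measurable_mvnKer 0 1).comp measurable_neg).pow_const 2).aestronglyMeasurable
    · refine (ae_restrict_iff' measurableSet_Ioi).2 (ae_of_all _ fun x hx => ?_)
      have hx0 : 0 < x := one_pos.trans hx
      have h := abs_mvnKer_le (a := a) (by linarith) (neg_neg_of_pos hx0) zero_le_one
      rw [sub_neg_eq_add, zero_add, sub_zero, mul_one] at h
      rw [norm_pow, Real.norm_eq_abs]
      calc _ ≤ (|a| * x ^ (a - 1)) ^ 2 := pow_le_pow_left₀ (abs_nonneg _) h 2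
        _ = _ := by
          rw [mul_pow, ← Real.rpow_mul_natCast hx0.le]
          congr 2; push_cast; ring

/-- The variance of the unnormalised Mandelbrot-Van Ness process at time one. -/
noncomputable def mvnConst (a : ℝ) : ℝ := ∫ x, mvnKer a 0 1 (-x) ^ 2

lemma mvnConst_pos (ha : -(1 / 2) < a) (ha1 : a < 1 / 2) (ha0 : a ≠ 0) : 0 < mvnConst a := by
  rw [mvnConst, integral_pos_iff_support_of_nonneg (fun x => sq_nonneg _)
    (integrable_mvnKer_zero_one ha ha1 ha0)]
  refine lt_of_lt_of_le (b := volume (Set.Ioo (-1 : ℝ) 0)) (by simp) (measure_mono fun x hx => ?_)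
  rw [Function.mem_support, mvnKer, powPos_of_nonpos ha0 (x := 0 - -x) (by linarith [hx.2]),
    powPos_of_nonneg (by linarith [hx.1]), sub_zero]
  have : 0 < 1 - -x := by linarith [hx.1]
  positivity

lemma mvnKer_eq_of_lt {s t : ℝ} (hst : s < t) (x : ℝ) :
    mvnKer a s t x = (t - s) ^ a * mvnKer a 0 1 (-((s - x) / (t - s))) := by
  have h : 0 < t - s := sub_pos.2 hst
  rw [mvnKer, mvnKer, mul_sub, ← powPos_mul h.le, ← powPos_mul h.le]
  congr 2
  · field_simp; ring
  · field_simp; ring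

lemma mvnKer_swap (s t x : ℝ) : mvnKer a t s x = -mvnKer a s t x := by simp [mvnKer]

/-- Translation and scaling reduce every increment to that of `[0, 1]`; the factor `(t-s)^{2a}`
comes from homogeneity, the remaining `t - s` from the change of variables. -/
lemma integrable_mvnKer_sq (ha : -(1 / 2) < a) (ha1 : a < 1 / 2) (ha0 : a ≠ 0) (s t : ℝ) :
    Integrable (fun x => mvnKer a s t x ^ 2) ∧
      ∫ x, mvnKer a s t x ^ 2 = |t - s| ^ (2 * a + 1) * mvnConst a := by
  have key : ∀ s t : ℝ, s < t → Integrable (fun x => mvnKer a s t x ^ 2) ∧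
      ∫ x, mvnKer a s t x ^ 2 = |t - s| ^ (2 * a + 1) * mvnConst a := by
    intro s t hst
    have h : 0 < t - s := sub_pos.2 hst
    simp only [mvnKer_eq_of_lt hst, mul_pow]
    have hi := ((integrable_mvnKer_zero_one ha ha1 ha0).comp_div h.ne').comp_sub_left s
    refine ⟨hi.const_mul _, ?_⟩
    rw [integral_const_mul, integral_sub_left_eq_self
      (fun x => mvnKer a 0 1 (-(x / (t - s))) ^ 2) volume s,
      Measure.integral_comp_div (fun x => mvnKer a 0 1 (-x) ^ 2), ← mvnConst, smul_eq_mul,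
      ← mul_assoc, abs_of_pos h, Real.rpow_add h, Real.rpow_one, ← Real.rpow_mul_natCast h.le]
    congr 3; push_cast; ring
  rcases lt_trichotomy s t with h | rfl | h
  · exact key s t h
  · have : ∀ x, mvnKer a s s x = 0 := fun x => by simp [mvnKer]
    simp only [this]
    simp [Real.zero_rpow (by linarith : 2 * a + 1 ≠ 0)]
  · have := key t s h
    simp only [mvnKer_swap t s, neg_sq]
    rwa [abs_sub_comm]

lemma memLp_mvnKer (ha : -(1 / 2) < a) (ha1 : a < 1 / 2) (ha0 : a ≠ 0) (s t : ℝ) :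
    MemLp (mvnKer a s t) 2 volume :=
  (memLp_two_iff_integrable_sq (measurable_mvnKer s t).aestronglyMeasurable).2
    (integrable_mvnKer_sq ha ha1 ha0 s t).1

/-- The part of an increment that belongs to the past of an earlier time. -/
lemma integral_indicator_mvnKer_sq_le (ha : -(1 / 2) < a) (ha1 : a < 1 / 2) {s t r : ℝ}
    (hst : s < t) (hr : 0 < r) (hr2 : r ≤ (t - s) / 2) :
    ∫ x, (Set.Iic s).indicator (mvnKer a (t - r) t) x ^ 2 ≤
      (8 / (1 - 2 * a)) * (r * (t - s) ^ (a - 1 / 2)) ^ 2 := by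
  have hτ : 0 < t - s := sub_pos.2 hst
  -- A majorant in the variable `u = t - x`. By the mean value theorem the kernel is at most `r
  -- (u/2)^{a-1}`, and `2^{2-2a} ≤ 8` because `a > -1/2`.
  set g : ℝ → ℝ := (Set.Ici (t - s)).indicator fun u => 8 * r ^ 2 * u ^ (2 * a - 2) with hg
  have hgi : Integrable g := by
    rw [hg, integrable_indicator_iff measurableSet_Ici]
    exact ((integrableOn_Ici_iff_integrableOn_Ioi).2
      (integrableOn_Ioi_rpow_of_lt (by linarith) hτ)).const_mul _
  have hle : ∀ x, (Set.Iic s).indicator (mvnKer a (t - r) t) x ^ 2 ≤ g (t - x) := by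
    intro x
    by_cases hx : x ≤ s
    · rw [Set.indicator_of_mem (Set.mem_Iic.2 hx), hg, Set.indicator_of_mem
        (show t - x ∈ Set.Ici (t - s) by simp only [Set.mem_Ici]; linarith), ← sq_abs]
      have h := abs_mvnKer_le (a := a) (s := t - r) (t := t) (x := x) (by linarith) (by linarith)
        (by linarith)
      rw [sub_sub_cancel] at h
      have hu : 0 < t - x := by linarith
      have h2 : (t - r - x) ^ (a - 1) ≤ ((t - x) / 2) ^ (a - 1) :=
        Real.rpow_le_rpow_of_nonpos (by linarith) (by linarith) (by linarith)
      have h3 : (((t - x) / 2) ^ (a - 1)) ^ 2 ≤ 8 * (t - x) ^ (2 * a - 2) := by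
        rw [← Real.rpow_mul_natCast (by linarith), div_eq_mul_inv,
          Real.mul_rpow hu.le (by norm_num), mul_comm,
          show (a - 1) * ((2 : ℕ) : ℝ) = 2 * a - 2 by push_cast; ring]
        refine mul_le_mul_of_nonneg_right ?_ (Real.rpow_nonneg hu.le _)
        rw [Real.inv_rpow two_pos.le, ← Real.rpow_neg two_pos.le]
        calc (2 : ℝ) ^ (-(2 * a - 2)) ≤ 2 ^ (3 : ℝ) :=
              Real.rpow_le_rpow_of_exponent_le one_le_two (by linarith)
          _ = 8 := by norm_num
      have hab : |a| ≤ 1 := abs_le.2 ⟨by linarith, by linarith⟩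
      have hpos : 0 ≤ (t - r - x) ^ (a - 1) := Real.rpow_nonneg (by linarith) _
      calc |mvnKer a (t - r) t x| ^ 2 ≤ (1 * ((t - x) / 2) ^ (a - 1) * r) ^ 2 := by
            refine pow_le_pow_left₀ (abs_nonneg _) (h.trans ?_) 2
            gcongr
        _ = r ^ 2 * (((t - x) / 2) ^ (a - 1)) ^ 2 := by ring
        _ ≤ r ^ 2 * (8 * (t - x) ^ (2 * a - 2)) := by gcongr
        _ = _ := by ring
    · rw [Set.indicator_of_notMem (by simpa using hx), zero_pow two_ne_zero]
      refine Set.indicator_nonneg (fun u hu => ?_) _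
      have : 0 < u := hτ.trans_le hu
      positivity
  calc _ ≤ ∫ x, g (t - x) := integral_mono_of_nonneg (ae_of_all _ fun x => sq_nonneg _)
        (hgi.comp_sub_left t) (ae_of_all _ hle)
    _ = ∫ u, g u := integral_sub_left_eq_self g volume t
    _ = 8 * r ^ 2 * ((t - s) ^ (2 * a - 1) / (1 - 2 * a)) := by
        rw [hg, integral_indicator measurableSet_Ici, integral_Ici_eq_integral_Ioi,
          integral_const_mul, integral_Ioi_rpow_of_lt (by linarith) hτ,
          show 2 * a - 2 + 1 = 2 * a - 1 by ring, ← neg_sub 1 (2 * a), div_neg, neg_div, neg_neg]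
    _ = _ := by
        rw [mul_pow, ← Real.rpow_mul_natCast hτ.le,
          show (a - 1 / 2) * ((2 : ℕ) : ℝ) = 2 * a - 1 by push_cast; ring]
        ring

end powPos

/-- The normalised Mandelbrot-Van Ness curve in `L²(ℝ)`. -/
noncomputable def mvnCurve (a : ℝ) (ha : ∀ s t, MemLp (mvnKer a s t) 2 volume) (t : ℝ) :
    Lp ℝ 2 (volume : Measure ℝ) := (√(mvnConst a))⁻¹ • (ha 0 t).toLp (mvnKer a 0 t)

section mvnCurve

variable {a : ℝ} (h : ∀ s t, MemLp (mvnKer a s t) 2 volume)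

lemma mvnCurve_sub (s t : ℝ) :
    mvnCurve a h t - mvnCurve a h s = (√(mvnConst a))⁻¹ • (h s t).toLp (mvnKer a s t) := by
  rw [mvnCurve, mvnCurve, ← smul_sub, ← MemLp.toLp_sub]
  congr 1
  refine MemLp.toLp_congr _ _ (ae_of_all _ fun x => ?_)
  simp [mvnKer]

lemma isFBMCurve_mvnCurve (ha : -(1 / 2) < a) (ha1 : a < 1 / 2) (ha0 : a ≠ 0) :
    IsFBMCurve (a + 1 / 2) (mvnCurve a h) := by
  intro s t
  have hc := mvnConst_pos ha ha1 ha0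
  rw [← sq_eq_sq₀ (norm_nonneg _) (by positivity), mvnCurve_sub, norm_smul, mul_pow,
    ← real_inner_self_eq_norm_sq ((h s t).toLp _), Lp.inner_toLp_toLp]
  simp only [← sq]
  rw [(integrable_mvnKer_sq ha ha1 ha0 s t).2, norm_inv, inv_pow, Real.norm_eq_abs, sq_abs,
    Real.sq_sqrt hc.le, ← Real.rpow_mul_natCast (abs_nonneg _),
    show (a + 1 / 2) * ((2 : ℕ) : ℝ) = 2 * a + 1 by push_cast; ring]
  field_simp

/-- The Ornstein-Uhlenbeck transform of the Mandelbrot-Van Ness curve forgets its past. -/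
theorem exists_abs_inner_ouCurve_mvnCurve_le (ha : -(1 / 2) < a) (ha1 : a < 1 / 2) (ha0 : a ≠ 0) :
    ∃ A, 0 ≤ A ∧ ∀ s t, s < t → ∀ w ∈ Submodule.span ℝ (ouCurve (mvnCurve a h) '' Set.Iic s),
      |inner ℝ (ouCurve (mvnCurve a h) t) w| ≤ A * (t - s) ^ (a - 1 / 2) * ‖w‖ := by
  have hb := isFBMCurve_mvnCurve h ha ha1 ha0
  have hH : 0 < a + 1 / 2 := by linarith
  set D := (√(mvnConst a))⁻¹ with hD
  have hD0 : 0 ≤ D := by positivity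
  have h2a : 0 < 1 - 2 * a := by linarith
  set C := D * √(8 / (1 - 2 * a)) + 2 with hC
  set W := ∫ r in Set.Ioi (0 : ℝ), Real.exp (-r) * r ^ (1 : ℝ) with hW
  have hW0 : 0 ≤ W := setIntegral_nonneg measurableSet_Ioi fun r hr =>
    mul_nonneg (Real.exp_pos _).le (Real.rpow_nonneg (le_of_lt hr) _)
  refine ⟨C * W, by positivity, fun s t hst w hw => ?_⟩
  have hτ : 0 < t - s := sub_pos.2 hst
  -- For `r ≤ (t-s)/2` the increment is split into its parts supported before and after `s`: the
  -- later part is orthogonal to `w`, the earlier one is small. For larger `r` Cauchy-Schwarz is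
  -- enough, since `r^{a+1/2} = r^{a-1/2} r` and `a - 1/2 < 0`.
  have key : ∀ r, 0 < r → |inner ℝ w (mvnCurve a h t - mvnCurve a h (t - r))| ≤
      C * (t - s) ^ (a - 1 / 2) * ‖w‖ * r := by
    intro r hr
    rcases le_or_gt r ((t - s) / 2) with hr2 | hr2
    · set F := (Set.Iic s).indicator (mvnKer a (t - r) t) with hF
      set F' := (Set.Ioi s).indicator (mvnKer a (t - r) t) with hF'
      have mF : MemLp F 2 volume := (h _ _).indicator measurableSet_Iic
      have mF' : MemLp F' 2 volume := (h _ _).indicator measurableSet_Ioi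
      have hFF : mvnCurve a h t - mvnCurve a h (t - r) = D • (mF.toLp F + mF'.toLp F') := by
        rw [mvnCurve_sub, ← MemLp.toLp_add]
        congr 1
        refine MemLp.toLp_congr _ _ (ae_of_all _ fun x => ?_)
        rw [hF, hF', ← Set.compl_Iic, Set.indicator_self_add_compl]
      -- The kernels that build the transform at a time `s' ≤ s` vanish beyond `s'`, whereas `F'` is
      -- supported beyond `s`.
      have hw0 : inner ℝ w (mF'.toLp F') = 0 := by
        rw [real_inner_comm]
        induction hw using Submodule.span_induction with
        | mem x hx =>
          obtain ⟨s', hs', rfl⟩ := hx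
          rw [ouCurve, ← integral_inner (hb.integrable_kernel hH s')]
          refine setIntegral_eq_zero_of_forall_eq_zero fun r' hr' => ?_
          rw [mvnCurve_sub, inner_smul_right, inner_smul_right, Lp.inner_toLp_toLp]
          have : ∀ x, F' x * mvnKer a (s' - r') s' x = 0 := by
            intro x
            rw [hF']
            by_cases hx : s < x
            · rw [mvnKer, powPos_of_nonpos ha0 (by linarith [Set.mem_Iic.1 hs']),
                powPos_of_nonpos ha0 (by linarith [Set.mem_Iic.1 hs', Set.mem_Ioi.1 hr']), sub_zero,
                mul_zero]
            · rw [Set.indicator_of_notMem (by simpa using hx), zero_mul]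
          simp [this]
        | zero => simp
        | add x y _ _ hx hy => rw [inner_add_right, hx, hy, add_zero]
        | smul c x _ hx => rw [inner_smul_right, hx, mul_zero]
      have hnF : ‖mF.toLp F‖ ≤ √(8 / (1 - 2 * a)) * (r * (t - s) ^ (a - 1 / 2)) := by
        rw [← sq_le_sq₀ (norm_nonneg _) (by positivity), mul_pow, Real.sq_sqrt (by positivity),
          ← real_inner_self_eq_norm_sq, Lp.inner_toLp_toLp]
        simp only [← sq]
        exact integral_indicator_mvnKer_sq_le ha ha1 hst hr hr2
      rw [hFF, inner_smul_right, inner_add_right, hw0, add_zero, abs_mul, abs_of_nonneg hD0]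
      calc _ ≤ D * (‖w‖ * (√(8 / (1 - 2 * a)) * (r * (t - s) ^ (a - 1 / 2)))) := by
            gcongr; exact (abs_real_inner_le_norm _ _).trans (by gcongr)
        _ = (D * √(8 / (1 - 2 * a))) * (t - s) ^ (a - 1 / 2) * ‖w‖ * r := by ring
        _ ≤ _ := by gcongr; rw [hC]; linarith
    · refine (abs_real_inner_le_norm _ _).trans ?_
      rw [hb, sub_sub_cancel, abs_of_pos hr]
      have e : r ^ (a + 1 / 2) = r ^ (a - 1 / 2) * r := by
        rw [← Real.rpow_add_one hr.ne']; congr 1; ring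
      have h1 : r ^ (a - 1 / 2) ≤ C * (t - s) ^ (a - 1 / 2) := by
        calc r ^ (a - 1 / 2) ≤ ((t - s) / 2) ^ (a - 1 / 2) :=
              Real.rpow_le_rpow_of_nonpos (by linarith) hr2.le (by linarith)
          _ ≤ 2 * (t - s) ^ (a - 1 / 2) := by
              rw [div_eq_mul_inv, Real.mul_rpow hτ.le (by norm_num), mul_comm]
              refine mul_le_mul_of_nonneg_right ?_ (Real.rpow_nonneg hτ.le _)
              rw [Real.inv_rpow two_pos.le, ← Real.rpow_neg two_pos.le]
              calc (2 : ℝ) ^ (-(a - 1 / 2)) ≤ 2 ^ (1 : ℝ) :=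
                    Real.rpow_le_rpow_of_exponent_le one_le_two (by linarith)
                _ = 2 := by norm_num
          _ ≤ _ := by
              refine mul_le_mul_of_nonneg_right ?_ (Real.rpow_nonneg hτ.le _)
              rw [hC]; linarith [mul_nonneg hD0 (Real.sqrt_nonneg (8 / (1 - 2 * a)))]
      rw [e]
      calc ‖w‖ * (r ^ (a - 1 / 2) * r) ≤ ‖w‖ * ((C * (t - s) ^ (a - 1 / 2)) * r) := by gcongr
        _ = _ := by ring
  rw [real_inner_comm, ouCurve, ← integral_inner (hb.integrable_kernel hH t)]
  have e : C * W * (t - s) ^ (a - 1 / 2) * ‖w‖ = ∫ r in Set.Ioi (0 : ℝ),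
      (C * (t - s) ^ (a - 1 / 2) * ‖w‖) * (Real.exp (-r) * r ^ (1 : ℝ)) := by
    rw [integral_const_mul, ← hW]; ring
  rw [e, ← Real.norm_eq_abs]
  refine norm_integral_le_of_norm_le
    ((integrableOn_exp_neg_mul_rpow zero_le_one).const_mul _) ?_
  refine (ae_restrict_iff' measurableSet_Ioi).2 (ae_of_all _ fun r hr => ?_)
  rw [inner_smul_right, norm_mul, Real.norm_eq_abs, Real.norm_eq_abs, abs_of_pos (Real.exp_pos _),
    Real.rpow_one]
  calc _ ≤ Real.exp (-r) * (C * (t - s) ^ (a - 1 / 2) * ‖w‖ * r) := by gcongr; exact key r hr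
    _ = _ := by ring

end mvnCurve

/-! ### The fast fractional Ornstein-Uhlenbeck process -/

section Lp

variable {Ω : Type*} [MeasurableSpace Ω] {P : Measure Ω} [IsProbabilityMeasure P]

lemma MemLp.integral_abs_le_norm_toLp {f : Ω → ℝ} (hf : MemLp f 2 P) :
    ∫ ω, |f ω| ∂P ≤ ‖hf.toLp f‖ := by
  have h1 : MemLp f 1 P := hf.mono_exponent one_le_two
  have h2 := eLpNorm_le_eLpNorm_of_exponent_le (μ := P) one_le_two hf.1
  rw [Lp.norm_toLp]
  refine le_trans (le_of_eq ?_) (ENNReal.toReal_mono hf.2.ne h2)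
  rw [eLpNorm_one_eq_lintegral_enorm, ← integral_norm_eq_lintegral_enorm hf.1]
  rfl

/-- The Bochner integral of a measurable family of square integrable functions is computed
pointwise. -/
lemma integral_toLp_ae_eq {ν : Measure ℝ} [SFinite ν] {X : ℝ → Ω → ℝ}
    (hX : Measurable (Function.uncurry X)) (hm : ∀ r, MemLp (X r) 2 P)
    (hi : Integrable (fun r => (hm r).toLp (X r)) ν) :
    (∀ᵐ ω ∂P, Integrable (fun r => X r ω) ν) ∧
      (∫ r, (hm r).toLp (X r) ∂ν : Lp ℝ 2 P) =ᵐ[P] fun ω => ∫ r, X r ω ∂ν := by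
  have hint : Integrable (Function.uncurry X) (ν.prod P) := by
    refine (integrable_prod_iff hX.aestronglyMeasurable).2
      ⟨ae_of_all _ fun r => (hm r).integrable one_le_two, ?_⟩
    refine hi.norm.mono' ?_ (ae_of_all _ fun r => ?_)
    · exact (hX.norm.stronglyMeasurable.integral_prod_right (ν := P)).aestronglyMeasurable
    · rw [Real.norm_eq_abs, abs_of_nonneg (integral_nonneg fun ω => norm_nonneg _)]
      exact MemLp.integral_abs_le_norm_toLp (hm r)
  refine ⟨hint.prod_left_ae, ?_⟩
  -- Both sides are compared on measurable sets: pairing the Bochner integral with an indicator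
  -- commutes with integration, and Fubini does the same for the pointwise integral.
  refine Integrable.ae_eq_of_forall_setIntegral_eq _ _ ((Lp.memLp _).integrable one_le_two)
    hint.integral_prod_right fun s hs hsP => ?_
  rw [← L2.inner_indicatorConstLp_one (𝕜 := ℝ) hs hsP.ne, ← integral_inner hi]
  have e : ∀ r, inner ℝ (indicatorConstLp 2 hs hsP.ne (1 : ℝ)) ((hm r).toLp (X r)) =
      ∫ ω in s, X r ω ∂P := by
    intro r
    rw [L2.inner_indicatorConstLp_one]
    exact setIntegral_congr_ae hs ((hm r).coeFn_toLp.mono fun ω hω _ => hω)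
  simp only [e]
  exact integral_integral_swap (hint.mono_measure (Measure.prod_mono le_rfl Measure.restrict_le_self))

/-- The square integrable functions with a centred Gaussian law. -/
def centredGaussians (P : Measure Ω) : Set (Lp ℝ 2 P) :=
  {f | ∀ x : ℝ, ∫ ω, Complex.exp (x * f ω * Complex.I) ∂P = Complex.exp (-(‖f‖ ^ 2 * x ^ 2 / 2))}

/-- Convergence in `L²` gives convergence of norms and, along a subsequence, almost everywhere, so
both sides of the characteristic function identity pass to the limit. -/
lemma isClosed_centredGaussians : IsClosed (centredGaussians P) := by
  refine IsSeqClosed.isClosed fun f g hf hg x => ?_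
  obtain ⟨ns, hns, hae⟩ := (tendstoInMeasure_of_tendsto_Lp hg).exists_seq_tendsto_ae
  have h1 : Filter.Tendsto (fun n => ∫ ω, Complex.exp (x * f (ns n) ω * Complex.I) ∂P) Filter.atTop
      (nhds (∫ ω, Complex.exp (x * g ω * Complex.I) ∂P)) := by
    refine tendsto_integral_of_dominated_convergence (fun _ => 1) (fun n => ?_)
      (integrable_const 1) (fun n => ae_of_all _ fun ω => ?_) ?_
    · have : Continuous fun y : ℝ => Complex.exp (x * y * Complex.I) := by fun_prop
      exact this.comp_aestronglyMeasurable (Lp.aestronglyMeasurable _)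
    · rw [← Complex.ofReal_mul, Complex.norm_exp_ofReal_mul_I]
    · filter_upwards [hae] with ω hω
      have : Continuous fun y : ℝ => Complex.exp (x * y * Complex.I) := by fun_prop
      exact (this.tendsto _).comp hω
  have h2 : Filter.Tendsto (fun n => Complex.exp (-(‖f (ns n)‖ ^ 2 * x ^ 2 / 2))) Filter.atTop
      (nhds (Complex.exp (-(‖g‖ ^ 2 * x ^ 2 / 2)))) := by
    have : Continuous fun f : Lp ℝ 2 P => Complex.exp (-((‖f‖ : ℂ) ^ 2 * x ^ 2 / 2)) := by fun_prop
    exact (this.tendsto _).comp (hg.comp hns.tendsto_atTop)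
  simp only [hf (ns _) x] at h1
  exact tendsto_nhds_unique h1 h2

lemma map_eq_of_mem_centredGaussians {f : Lp ℝ 2 P} (hf : f ∈ centredGaussians P) :
    P.map f = gaussianReal 0 (‖f‖₊ ^ 2) := by
  have hm : AEMeasurable f P := (Lp.aestronglyMeasurable f).aemeasurable
  have := Measure.isProbabilityMeasure_map hm
  refine Measure.ext_of_charFun (funext fun x => ?_)
  rw [charFun_apply_real, integral_map hm
    (Continuous.aestronglyMeasurable (by fun_prop)), hf x, charFun_gaussianReal]
  simp

end Lp

section Rep

variable {Ω : Type*} [MeasurableSpace Ω] {P : Measure Ω}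

/-- Only the covariances of the representing vectors matter. -/
lemma IsGaussianRep.of_norm_eq {T E E' : Type*} [NormedAddCommGroup E] [InnerProductSpace ℝ E]
    [NormedAddCommGroup E'] [InnerProductSpace ℝ E'] {Y : T → Ω → ℝ} {v : T → E} {v' : T → E'}
    (h : IsGaussianRep P Y v) (hv : ∀ (s : Finset T) (c : T → ℝ),
      ‖∑ i ∈ s, c i • v i‖ = ‖∑ i ∈ s, c i • v' i‖) : IsGaussianRep P Y v' where
  aemeasurable := h.aemeasurable
  map_sum s c := by
    rw [h.map_sum]
    congr 2
    exact NNReal.eq (hv s c)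

lemma IsGaussianRep.of_ae_eq [IsProbabilityMeasure P] {T : Type*} {Y : T → Ω → ℝ} {v : T → Lp ℝ 2 P}
    {U : Submodule ℝ (Lp ℝ 2 P)} (hU : (U : Set (Lp ℝ 2 P)) ⊆ centredGaussians P)
    (hv : ∀ t, v t ∈ U) (hY : ∀ t, Y t =ᵐ[P] v t) : IsGaussianRep P Y v where
  aemeasurable t := ((Lp.aestronglyMeasurable (v t)).aemeasurable).congr (hY t).symm
  map_sum s c := by
    have h1 := map_eq_of_mem_centredGaussians
      (hU (U.sum_mem fun i (_ : i ∈ s) => U.smul_mem (c i) (hv i)))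
    rw [← h1]
    refine Measure.map_congr ?_
    have h2 : ∀ᵐ ω ∂P, ∀ i ∈ s, Y i ω = v i ω ∧ (c i • v i : Lp ℝ 2 P) ω = c i * v i ω :=
      (Finset.eventually_all s).2 fun i _ => by
        filter_upwards [hY i, Lp.coeFn_smul (c i) (v i)] with ω h3 h4
        exact ⟨h3, by rw [h4]; rfl⟩
    filter_upwards [Lp.coeFn_finsetSum s (fun i => c i • v i), h2] with ω h3 h4
    rw [h3, Finset.sum_apply]
    exact Finset.sum_congr rfl fun i hi => by rw [(h4 i hi).1, (h4 i hi).2]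

end Rep

namespace IsFractionalBrownianMotion

variable {Ω : Type*} [MeasurableSpace Ω] {P : Measure Ω} {H : ℝ} {B : ℝ → Ω → ℝ}

lemma memLp (hB : IsFractionalBrownianMotion H B P) (t : ℝ) : MemLp (B t) 2 P :=
  (hB.gaussian.hasGaussianLaw_eval t).memLp_two

/-- The values of the process as elements of `L²`. -/
noncomputable def toL2 (hB : IsFractionalBrownianMotion H B P) (t : ℝ) : Lp ℝ 2 P :=
  (hB.memLp t).toLp (B t)

lemma isFBMCurve (hB : IsFractionalBrownianMotion H B P) (hH : 0 < H) : IsFBMCurve H hB.toL2 := by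
  intro s t
  rw [← sq_eq_sq₀ (norm_nonneg _) (by positivity), ← real_inner_self_eq_norm_sq]
  simp only [inner_sub_left, inner_sub_right, toL2, Lp.inner_toLp_toLp, hB.covariance, sub_self,
    abs_zero, Real.zero_rpow (by linarith : 2 * H ≠ 0)]
  rw [← Real.rpow_mul_natCast (abs_nonneg _), abs_sub_comm s t, mul_comm H]
  push_cast
  ring

variable [IsProbabilityMeasure P]

/-- The closed linear span of the process. -/
noncomputable def closedSpan (hB : IsFractionalBrownianMotion H B P) : Submodule ℝ (Lp ℝ 2 P) :=
  (Submodule.span ℝ (Set.range hB.toL2)).topologicalClosure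

lemma closedSpan_subset (hB : IsFractionalBrownianMotion H B P) :
    (hB.closedSpan : Set (Lp ℝ 2 P)) ⊆ centredGaussians P := by
  rw [closedSpan, Submodule.topologicalClosure_coe]
  refine closure_minimal (fun f hf x => ?_) isClosed_centredGaussians
  obtain ⟨c, rfl⟩ := Finsupp.mem_span_range_iff_exists_finsupp.1 hf
  set X : Ω → ℝ := fun ω => ∑ i ∈ c.support, c i • B i ω with hX
  have hlaw : HasGaussianLaw X P := (hB.gaussian.smul c).hasGaussianLaw_fun_sum
  set f : Lp ℝ 2 P := c.sum fun i a => a • hB.toL2 i with hf'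
  have hfX : f =ᵐ[P] X := by
    have h2 : ∀ᵐ ω ∂P, ∀ i ∈ c.support, (c i • hB.toL2 i : Lp ℝ 2 P) ω = c i * B i ω :=
      (Finset.eventually_all _).2 fun i _ => by
        filter_upwards [(hB.memLp i).coeFn_toLp, Lp.coeFn_smul (c i) (hB.toL2 i)] with ω h3 h4
        rw [h4, Pi.smul_apply, smul_eq_mul]
        exact congrArg _ h3
    filter_upwards [Lp.coeFn_finsetSum c.support (fun i => c i • hB.toL2 i), h2] with ω h3 h4
    rw [hf', Finsupp.sum, h3, Finset.sum_apply]
    exact Finset.sum_congr rfl h4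
  have hmean : ∫ ω, X ω ∂P = 0 := by
    have e : ∫ ω, X ω ∂P = ∑ i ∈ c.support, ∫ ω, c i • B i ω ∂P :=
      integral_finsetSum _ fun i _ => ((hB.memLp i).integrable one_le_two).smul (c i)
    rw [e]
    refine Finset.sum_eq_zero fun i _ => ?_
    rw [integral_smul, hB.mean_zero, smul_zero]
  have hvar : Var[X; P] = ‖f‖ ^ 2 := by
    rw [variance_of_integral_eq_zero hlaw.aemeasurable hmean, ← real_inner_self_eq_norm_sq,
      L2.inner_def]
    refine integral_congr_ae ?_
    filter_upwards [hfX] with ω hω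
    rw [hω]; simp [sq]
  have h3 := congrFun (congrArg charFun hlaw.map_eq_gaussianReal) x
  rw [charFun_apply_real, integral_map hlaw.aemeasurable
    (Continuous.aestronglyMeasurable (by fun_prop)), charFun_gaussianReal, hmean, hvar,
    Real.coe_toNNReal _ (sq_nonneg _)] at h3
  rw [integral_congr_ae (g := fun ω => Complex.exp (x * X ω * Complex.I))
    (hfX.mono fun ω hω => by simp only [hω]), h3]
  simp

end IsFractionalBrownianMotion

/-- The closure is the double orthogonal complement; against a vector orthogonal to `U` the
integrand vanishes. -/
lemma ouCurve_mem_closure {E : Type*} [NormedAddCommGroup E] [InnerProductSpace ℝ E]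
    [CompleteSpace E] {U : Submodule ℝ E} {H : ℝ} {b : ℝ → E} (hb : IsFBMCurve H b) (hH : 0 < H)
    (hU : ∀ t, b t ∈ U) (t : ℝ) : ouCurve b t ∈ U.topologicalClosure := by
  rw [← Submodule.orthogonal_orthogonal_eq_closure, Submodule.mem_orthogonal]
  intro u hu
  rw [ouCurve, ← integral_inner (hb.integrable_kernel hH t)]
  refine integral_eq_zero_of_ae (ae_of_all _ fun r => ?_)
  simp only [Pi.zero_apply]
  rw [inner_smul_right, (Submodule.mem_orthogonal' U u).1 hu _ (U.sub_mem (hU _) (hU _)), mul_zero]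

lemma IsFBMCurve.scale {E : Type*} [NormedAddCommGroup E] [InnerProductSpace ℝ E] {H : ℝ}
    {b : ℝ → E} (hb : IsFBMCurve H b) {ε : ℝ} (hε : 0 < ε) (d : ℝ) :
    IsFBMCurve H fun t => (ε ^ H)⁻¹ • b (ε * t + d) := by
  intro s t
  rw [← smul_sub, norm_smul, hb, add_sub_add_right_eq_sub, ← mul_sub, abs_mul, abs_of_pos hε,
    Real.mul_rpow hε.le (abs_nonneg _), Real.norm_eq_abs, abs_of_pos (by positivity)]
  field_simp

/-! ### Time change to unit speed -/

section fastFOU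

variable {Ω : Type*} {H σ ε : ℝ} {B : ℝ → Ω → ℝ}

lemma continuous_fastFOU (hB : ∀ ω, Continuous fun t => B t ω) (ω : Ω) :
    Continuous fun t => fastFOU H σ ε B t ω := by
  set Φ : ℝ → ℝ := fun s => Real.exp (s / ε) * B s ω with hΦ
  have hΦc : Continuous Φ := by have := hB ω; fun_prop
  have e : ∀ t, ∫ s in Set.Iic t, Real.exp (-(t - s) / ε) * B s ω =
      Real.exp (-t / ε) * ∫ s in Set.Iic t, Φ s := by
    intro t
    rw [← integral_const_mul]
    refine integral_congr_ae (ae_of_all _ fun s => ?_)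
    simp only [hΦ]
    rw [← mul_assoc, ← Real.exp_add]
    congr 2; ring
  have hc : Continuous fun t => ∫ s in Set.Iic t, Φ s := by
    by_cases hi : IntegrableOn Φ (Set.Iic 0)
    · have hit : ∀ t, IntegrableOn Φ (Set.Iic t) := by
        intro t
        refine (hi.union (hΦc.integrableOn_Icc (a := 0) (b := t))).mono_set fun x hx => ?_
        rcases le_or_gt x 0 with h | h
        · exact Or.inl h
        · exact Or.inr ⟨h.le, hx⟩
      have : (fun t => ∫ s in Set.Iic t, Φ s) =
          fun t => (∫ s in Set.Iic 0, Φ s) + ∫ s in 0..t, Φ s := by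
        ext t
        rw [← intervalIntegral.integral_Iic_sub_Iic hi (hit t)]
        ring
      rw [this]
      exact continuous_const.add (continuous_primitive' hΦc 0)
    -- Nothing is known about an individual path near `-∞`. If the integral diverges for one `t` it
    -- diverges for all, and its default value `0` is continuous as well.
    · have hit : ∀ t, ¬ IntegrableOn Φ (Set.Iic t) := by
        intro t ht
        refine hi ((ht.union (hΦc.integrableOn_Icc (a := t) (b := 0))).mono_set fun x hx => ?_)
        rcases le_or_gt x t with h | h
        · exact Or.inl h
        · exact Or.inr ⟨h.le, hx⟩
      simp only [fun t => integral_undef (hit t)]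
      exact continuous_const
  have := hB ω
  simp only [fastFOU, e]
  fun_prop

lemma fastFOU_eq (hε : 0 < ε) (t : ℝ) (ω : Ω) :
    fastFOU H σ ε B t ω = σ / ε ^ H *
      (B t ω - ∫ r in Set.Ioi (0 : ℝ), Real.exp (-r) * B (t - ε * r) ω) := by
  set f : ℝ → ℝ := fun s => Real.exp (-(t - s) / ε) * B s ω with hf
  have h1 : ∫ u in Set.Ioi (0 : ℝ), f (t - u) = ∫ s in Set.Iic t, f s := by
    rw [← integral_indicator measurableSet_Iic, ← integral_sub_left_eq_self _ volume t,
      ← integral_Ici_eq_integral_Ioi, ← integral_indicator measurableSet_Ici]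
    refine integral_congr_ae (ae_of_all _ fun u => ?_)
    simp only [Set.indicator, Set.mem_Ici, Set.mem_Iic, sub_le_self_iff]
  have h2 := integral_comp_mul_left_Ioi (fun u => f (t - u)) 0 hε
  rw [mul_zero, h1, smul_eq_mul] at h2
  rw [fastFOU, one_div, ← h2]
  congr 2
  refine integral_congr_ae (ae_of_all _ fun r => ?_)
  simp only [hf]
  congr 2
  field_simp; ring

variable [MeasurableSpace Ω] {P : Measure Ω} [IsProbabilityMeasure P]

/-- Since `∫ e^{-r} dr = 1`, the value `B_t` may be moved under the integral, which becomes an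
average of increments; the substitution `s = t - ε r` makes it the transform of the rescaled curve.
The pointwise and the `L²` integral agree almost surely. -/
lemma fastFOU_ae_eq (hB : IsFractionalBrownianMotion H B P) (hH : 0 < H) (hε : 0 < ε) (d t : ℝ) :
    (fun ω => fastFOU H σ ε B (ε * t + d) ω) =ᵐ[P]
      (σ • ouCurve (fun t => (ε ^ H)⁻¹ • hB.toL2 (ε * t + d)) t : Lp ℝ 2 P) := by
  set b : ℝ → Lp ℝ 2 P := fun t => (ε ^ H)⁻¹ • hB.toL2 (ε * t + d) with hb
  have hbc : IsFBMCurve H b := (hB.isFBMCurve hH).scale hε d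
  set X : ℝ → Ω → ℝ := fun r ω => Real.exp (-r) *
    ((ε ^ H)⁻¹ * (B (ε * t + d) ω - B (ε * (t - r) + d) ω)) with hX
  have hXm : Measurable (Function.uncurry X) := by
    refine measurable_uncurry_of_continuous_of_measurable (fun ω => ?_) fun r => ?_
    · have := hB.continuous ω
      simp only [hX]; fun_prop
    · exact (((hB.measurable _).sub (hB.measurable _)).const_mul _).const_mul _
  have hm : ∀ r, MemLp (X r) 2 P := fun r =>
    (((hB.memLp _).sub (hB.memLp _)).const_mul _).const_mul _
  have hto : ∀ r, (hm r).toLp (X r) = Real.exp (-r) • (b t - b (t - r)) := by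
    intro r
    rw [hb]
    simp only [IsFractionalBrownianMotion.toL2]
    rw [← smul_sub, ← MemLp.toLp_sub, ← MemLp.toLp_const_smul, ← MemLp.toLp_const_smul]
    rfl
  have hi : Integrable (fun r => (hm r).toLp (X r)) (volume.restrict (Set.Ioi 0)) := by
    simp only [hto]; exact hbc.integrable_kernel hH t
  obtain ⟨h1, h2⟩ := integral_toLp_ae_eq hXm hm hi
  simp only [hto] at h2
  filter_upwards [h1, h2, Lp.coeFn_smul σ (ouCurve b t)] with ω h1 h2 h3
  rw [h3, Pi.smul_apply, ouCurve, h2, smul_eq_mul, fastFOU_eq hε]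
  have hexp : IntegrableOn (fun r => Real.exp (-r)) (Set.Ioi 0) := by
    simpa using integrableOn_exp_neg_mul_rpow le_rfl
  have hone : ∫ r in Set.Ioi (0 : ℝ), Real.exp (-r) = 1 := integral_exp_neg_Ioi_zero
  have hpos : ε ^ H ≠ 0 := (Real.rpow_pos_of_pos hε H).ne'
  have h4 : ∫ r in Set.Ioi (0 : ℝ), Real.exp (-r) * B (ε * t + d - ε * r) ω =
      B (ε * t + d) ω - ε ^ H * ∫ r in Set.Ioi (0 : ℝ), X r ω := by
    rw [← one_mul (B (ε * t + d) ω), ← hone, ← integral_mul_const, ← integral_const_mul]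
    rw [← integral_sub (hexp.mul_const _) (h1.const_mul _)]
    refine integral_congr_ae (ae_of_all _ fun r => ?_)
    simp only [hX]
    rw [show ε * (t - r) + d = ε * t + d - ε * r by ring]
    field_simp; ring
  rw [h4]
  field_simp; ring

/-- The fast fractional Ornstein-Uhlenbeck process, seen at unit speed. -/
theorem exists_isFOULike_fastFOU (hH0 : 0 < H) (hH1 : H < 1) (hH : H ≠ 1 / 2)
    (hB : IsFractionalBrownianMotion H B P)
    (hσ : HasLaw (fastFOU H σ 1 B 0) (gaussianReal 0 1) P) :
    ∃ (A : ℝ) (v : ℝ → Lp ℝ 2 (volume : Measure ℝ)), 0 ≤ A ∧ ∀ ε : ℝ, 0 < ε → ∀ d : ℝ,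
      IsFOULike P H A v fun t => fastFOU H σ ε B (ε * t + d) := by
  set a := H - 1 / 2 with ha
  have ha1 : -(1 / 2) < a := by linarith
  have ha2 : a < 1 / 2 := by linarith
  have ha0 : a ≠ 0 := sub_ne_zero.2 hH
  have hmem : ∀ s t, MemLp (mvnKer a s t) 2 volume := memLp_mvnKer ha1 ha2 ha0
  have hβ := isFBMCurve_mvnCurve hmem ha1 ha2 ha0
  rw [show a + 1 / 2 = H by rw [ha]; ring] at hβ
  set β := mvnCurve a hmem with hβdef
  -- The rescaled curve in `L²(P)` again has the increments of fractional Brownian motion, so only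
  -- its Gram matrix matters and one representing curve in `L²(ℝ)` serves all `ε` and `d`.
  have hrep : ∀ ε : ℝ, 0 < ε → ∀ d : ℝ,
      IsGaussianRep P (fun t => fastFOU H σ ε B (ε * t + d)) fun t => σ • ouCurve β t := by
    intro ε hε d
    have hb := (hB.isFBMCurve hH0).scale hε d
    have h1 : IsGaussianRep P (fun t => fastFOU H σ ε B (ε * t + d))
        fun t => σ • ouCurve (fun t => (ε ^ H)⁻¹ • hB.toL2 (ε * t + d)) t := by
      refine IsGaussianRep.of_ae_eq hB.closedSpan_subset (fun t => ?_)
        fun t => fastFOU_ae_eq hB hH0 hε d t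
      refine Submodule.smul_mem _ _ (ouCurve_mem_closure hb hH0 (fun t => ?_) t)
      exact Submodule.smul_mem _ _ (Submodule.subset_span ⟨_, rfl⟩)
    refine h1.of_norm_eq fun s c => ?_
    simp only [smul_smul]
    exact hb.norm_sum_ouCurve hH0 hβ s (fun i => c i * σ) id
  have hnorm : ∀ t, ‖σ • ouCurve β t‖ = 1 := by
    intro t
    rw [norm_smul, hβ.norm_ouCurve hH0, ← norm_smul]
    -- The normalisation of `σ` is read off from the law of `y^1_0`.
    have h1 := (hrep 1 one_pos 0).map_sum {0} fun _ => 1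
    simp only [Finset.sum_singleton, one_mul, one_smul, add_zero] at h1
    have h2 : gaussianReal 0 1 = gaussianReal 0 (‖σ • ouCurve β 0‖₊ ^ 2) :=
      hσ.map_eq.symm.trans h1
    have h3 := (gaussianReal_ext_iff.1 h2).2
    have h4 : ‖σ • ouCurve β 0‖ ^ 2 = 1 := by
      have := congrArg NNReal.toReal h3
      simpa using this.symm
    exact (pow_eq_one_iff_of_nonneg (norm_nonneg _) two_ne_zero).1 h4
  obtain ⟨A₁, hA₁, hpast⟩ := exists_abs_inner_ouCurve_mvnCurve_le hmem ha1 ha2 ha0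
  obtain ⟨A₂, hA₂, hcorr⟩ : ∃ A, 0 ≤ A ∧ (1 / 2 < H → ∀ s t, s ≠ t →
      |inner ℝ (ouCurve β s) (ouCurve β t)| ≤ A * |t - s| ^ (2 * H - 2)) := by
    by_cases h : 1 / 2 < H
    · obtain ⟨A, hA, h'⟩ := hβ.exists_abs_inner_ouCurve_le h hH1
      exact ⟨A, hA, fun _ => h'⟩
    · exact ⟨0, le_rfl, fun h' => absurd h' h⟩
  refine ⟨|σ| * A₁ + σ ^ 2 * A₂, fun t => σ • ouCurve β t, by positivity, fun ε hε d => ?_⟩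
  refine ⟨fun ω => ?_, hrep ε hε d, hnorm, fun s t hst w hw => ?_, fun h s t hst => ?_⟩
  · exact (continuous_fastFOU hB.continuous ω).comp (by fun_prop)
  · have hw' : w ∈ Submodule.span ℝ (ouCurve β '' Set.Iic s) := by
      refine Submodule.span_le.2 ?_ hw
      rintro _ ⟨x, hx, rfl⟩
      exact Submodule.smul_mem _ _ (Submodule.subset_span ⟨x, hx, rfl⟩)
    have h1 := hpast s t hst w hw'
    rw [show a - 1 / 2 = H - 1 by rw [ha]; ring] at h1
    have hp : 0 ≤ (t - s) ^ (H - 1) := Real.rpow_nonneg (by linarith) _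
    rw [real_inner_smul_left, abs_mul]
    calc _ ≤ |σ| * (A₁ * (t - s) ^ (H - 1) * ‖w‖) := by gcongr
      _ = |σ| * A₁ * ((t - s) ^ (H - 1) * ‖w‖) := by ring
      _ ≤ (|σ| * A₁ + σ ^ 2 * A₂) * ((t - s) ^ (H - 1) * ‖w‖) := by
          gcongr; exact le_add_of_nonneg_right (by positivity)
      _ = _ := by ring
  · have h1 := hcorr h s t hst
    rw [real_inner_smul_left, real_inner_smul_right, abs_mul, abs_mul]
    calc _ = σ ^ 2 * |inner ℝ (ouCurve β s) (ouCurve β t)| := by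
          rw [← sq_abs σ]; ring
      _ ≤ σ ^ 2 * (A₂ * |t - s| ^ (2 * H - 2)) := by gcongr
      _ = σ ^ 2 * A₂ * |t - s| ^ (2 * H - 2) := by ring
      _ ≤ _ := by gcongr; exact le_add_of_nonneg_left (by positivity)

end fastFOU

/-! ### Dyadic chaining -/

/-- An interval of at most `2^{l+1}` steps of level `M + 1` is trimmed to its longest subinterval
with endpoints of level `M`, which has at most `2^l` steps. The trimming costs two elementary
increments and the defect of subadditivity, measured by `e`. For a path `e = 0` and `κ = ρ`; for the
area `κ = ρ²` and `e` accounts for the products in Chen's relation. -/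
lemma dyadic_chain {Δ : ℝ → ℝ → ℝ} {T κ ρ a e : ℝ} (ha : 0 ≤ a) (he : 0 ≤ e) (hκ : 0 < κ)
    (hκρ : κ ≤ ρ) (h0 : ∀ s, Δ s s ≤ 0)
    (h1 : ∀ M i : ℕ, i < 2 ^ M → Δ (i * (T / 2 ^ M)) ((i + 1 : ℕ) * (T / 2 ^ M)) ≤ a * κ ^ M)
    (h2 : ∀ M l i j i' j' : ℕ, l ≤ M → i ≤ 2 * i' → 2 * i' ≤ i + 1 → i' ≤ j' → 2 * j' ≤ j →
      j ≤ 2 * j' + 1 → j ≤ 2 ^ (M + 1) → j - i ≤ 2 ^ (l + 1) →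
      Δ (i * (T / 2 ^ (M + 1))) (j * (T / 2 ^ (M + 1))) ≤
        Δ (i * (T / 2 ^ (M + 1))) ((2 * i' : ℕ) * (T / 2 ^ (M + 1))) +
        Δ ((2 * i' : ℕ) * (T / 2 ^ (M + 1))) ((2 * j' : ℕ) * (T / 2 ^ (M + 1))) +
        Δ ((2 * j' : ℕ) * (T / 2 ^ (M + 1))) (j * (T / 2 ^ (M + 1))) +
        e * κ ^ (M - l) * ρ ^ (l + 1)) (l : ℕ) :
    ∀ M i j : ℕ, l ≤ M → i ≤ j → j ≤ 2 ^ M → j - i ≤ 2 ^ l →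
      Δ (i * (T / 2 ^ M)) (j * (T / 2 ^ M)) ≤
        (a + (2 * a + e) * ∑ k ∈ Finset.range l, ρ ^ (k + 1)) * κ ^ (M - l) := by
  have hρ : 0 < ρ := hκ.trans_le hκρ
  have hsmall : ∀ M i j : ℕ, i ≤ j → j ≤ i + 1 → j ≤ 2 ^ M →
      Δ (i * (T / 2 ^ M)) (j * (T / 2 ^ M)) ≤ a * κ ^ M := by
    intro M i j hij hji hj
    rcases Nat.eq_or_lt_of_le hij with rfl | hlt
    · exact (h0 _).trans (by positivity)
    · obtain rfl : j = i + 1 := by omega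
      exact h1 M i hj
  induction l with
  | zero =>
    intro M i j _ hij hj hd
    simpa using hsmall M i j hij (by rw [pow_zero] at hd; omega) hj
  | succ l ih =>
    intro M i j hlM hij hj hd
    obtain ⟨M, rfl⟩ : ∃ M', M = M' + 1 := ⟨M - 1, by omega⟩
    have hb : 0 ≤ (a + (2 * a + e) * ∑ k ∈ Finset.range (l + 1), ρ ^ (k + 1)) := by positivity
    -- Without a point of the coarser grid between `i` and `j` the interval is degenerate.
    rcases lt_or_ge (j / 2) ((i + 1) / 2) with hlt | hle
    · obtain rfl : i = j := by omega
      exact (h0 _).trans (by positivity)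
    · have h3 := h2 M l i j ((i + 1) / 2) (j / 2) (by omega) (by omega) (by omega) hle (by omega)
        (by omega) hj hd
      have hmid := ih M ((i + 1) / 2) (j / 2) (by omega) hle (by rw [pow_succ] at hj; omega)
        (by rw [pow_succ] at hd; omega)
      have e1 : ∀ n : ℕ, ((2 * n : ℕ) : ℝ) * (T / 2 ^ (M + 1)) = n * (T / 2 ^ M) := by
        intro n; push_cast; rw [pow_succ]; field_simp
      have hl := hsmall (M + 1) i (2 * ((i + 1) / 2)) (by omega) (by omega) (by omega)
      have hr := hsmall (M + 1) (2 * (j / 2)) j (by omega) (by omega) hj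
      rw [e1 ((i + 1) / 2), e1 (j / 2)] at h3
      rw [e1 ((i + 1) / 2)] at hl
      rw [e1 (j / 2)] at hr
      have hpow : κ ^ (M + 1) ≤ κ ^ (M - l) * ρ ^ (l + 1) := by
        have : M + 1 = (M - l) + (l + 1) := by omega
        rw [this, pow_add]
        gcongr
      rw [Finset.sum_range_succ, show M + 1 - (l + 1) = M - l by omega]
      have h4 : a * κ ^ (M + 1) ≤ a * (κ ^ (M - l) * ρ ^ (l + 1)) := by gcongr
      linear_combination h3 + hmid + hl + hr + 2 * h4

lemma sum_pow_succ_le {ρ : ℝ} (hρ : 0 ≤ ρ) (hρ1 : ρ < 1) (n : ℕ) :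
    ∑ k ∈ Finset.range n, ρ ^ (k + 1) ≤ 1 / (1 - ρ) := by
  have h := (summable_geometric_of_lt_one hρ hρ1).sum_le_tsum (Finset.range n)
    fun k _ => pow_nonneg hρ k
  rw [tsum_geometric_of_lt_one hρ hρ1] at h
  rw [one_div]
  refine le_trans (Finset.sum_le_sum fun k _ => ?_) h
  exact pow_le_pow_of_le_one hρ hρ1.le (Nat.le_succ k)

lemma exists_pow_two_le (M d : ℕ) (hd : d ≤ 2 ^ M) : ∃ l ≤ M, d ≤ 2 ^ l ∧ 2 ^ l ≤ 2 * d + 1 := by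
  induction M with
  | zero => exact ⟨0, le_rfl, hd, by omega⟩
  | succ M ih =>
    rcases le_or_gt d (2 ^ M) with h | h
    · obtain ⟨l, hl, h1, h2⟩ := ih h
      exact ⟨l, by omega, h1, h2⟩
    · exact ⟨M + 1, le_rfl, hd, by rw [pow_succ]; omega⟩

/-- The endpoints are approximated by dyadic floors. Once `η 2^M ≥ 1` these are at most `η 2^M + 1`
steps apart, and the least suitable `2^l` is at most `2 (η 2^M + 1) + 1 ≤ 5 η 2^M`, which explains
the `5`. -/
lemma le_rpow_of_dyadic {Δ : ℝ → ℝ → ℝ} {T c g : ℝ} (hT : 0 < T) (hg : 0 < g) (hc : 0 ≤ c)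
    (hΔ : Continuous fun p : ℝ × ℝ => Δ p.1 p.2) (h0 : ∀ s, Δ s s ≤ 0)
    (h : ∀ l M i j : ℕ, l ≤ M → i ≤ j → j ≤ 2 ^ M → j - i ≤ 2 ^ l →
      Δ (i * (T / 2 ^ M)) (j * (T / 2 ^ M)) ≤ c * ((1 / 2 : ℝ) ^ g) ^ (M - l))
    {s t : ℝ} (hs : 0 ≤ s) (hst : s ≤ t) (ht : t ≤ T) : Δ s t ≤ c * (5 * ((t - s) / T)) ^ g := by
  rcases hst.eq_or_lt with rfl | hst
  · exact (h0 s).trans (by rw [sub_self, zero_div, mul_zero]; positivity)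
  set η := (t - s) / T with hη
  have hη0 : 0 < η := div_pos (by linarith) hT
  have hpt : Filter.Tendsto (fun M : ℕ => (2 : ℝ) ^ M) Filter.atTop Filter.atTop :=
    tendsto_pow_atTop_atTop_of_one_lt one_lt_two
  have happ : ∀ x : ℝ, 0 ≤ x → Filter.Tendsto
      (fun M : ℕ => (⌊x / T * 2 ^ M⌋₊ : ℝ) * (T / 2 ^ M)) Filter.atTop (nhds x) := by
    intro x hx
    have h1 := ((tendsto_nat_floor_mul_div_atTop (R := ℝ) (a := x / T) (by positivity)).comp
      hpt).mul_const T
    rw [div_mul_cancel₀ _ hT.ne'] at h1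
    refine h1.congr fun M => ?_
    simp only [Function.comp]
    field_simp
  have hlim := (hΔ.tendsto (s, t)).comp ((happ s hs).prodMk_nhds (happ t (by linarith)))
  refine le_of_tendsto hlim ?_
  filter_upwards [hpt.eventually_ge_atTop (1 / η)] with M hM
  have hM1 : 1 ≤ η * 2 ^ M := by rwa [div_le_iff₀ hη0, mul_comm] at hM
  have hmono : ⌊s / T * 2 ^ M⌋₊ ≤ ⌊t / T * 2 ^ M⌋₊ := Nat.floor_mono (by gcongr)
  have htop : ⌊t / T * 2 ^ M⌋₊ ≤ 2 ^ M := by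
    refine Nat.floor_le_of_le ?_
    push_cast
    exact mul_le_of_le_one_left (by positivity) ((div_le_one hT).2 ht)
  obtain ⟨l, hl, hd, hl2⟩ := exists_pow_two_le M (⌊t / T * 2 ^ M⌋₊ - ⌊s / T * 2 ^ M⌋₊) (by omega)
  refine (h l M _ _ hl hmono htop hd).trans (mul_le_mul_of_nonneg_left ?_ hc)
  have ht0 : 0 ≤ t := hs.trans hst.le
  have h1 : (⌊t / T * 2 ^ M⌋₊ : ℝ) ≤ t / T * 2 ^ M := Nat.floor_le (by positivity)
  have h2 : s / T * 2 ^ M < (⌊s / T * 2 ^ M⌋₊ : ℝ) + 1 := Nat.lt_floor_add_one _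
  have h3 : ((⌊t / T * 2 ^ M⌋₊ - ⌊s / T * 2 ^ M⌋₊ : ℕ) : ℝ) ≤ η * 2 ^ M + 1 := by
    rw [Nat.cast_sub hmono, hη, sub_div, sub_mul]; linarith
  have h4 : (2 : ℝ) ^ l ≤ 2 * ((⌊t / T * 2 ^ M⌋₊ - ⌊s / T * 2 ^ M⌋₊ : ℕ) : ℝ) + 1 := by
    exact_mod_cast hl2
  have h5 : ((1 / 2 : ℝ) ^ g) ^ (M - l) = (2 ^ l / 2 ^ M) ^ g := by
    rw [← Real.rpow_natCast, ← Real.rpow_mul (by norm_num), mul_comm, Real.rpow_mul (by norm_num),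
      Real.rpow_natCast]
    congr 1
    rw [one_div, inv_pow, pow_sub₀ _ two_ne_zero hl, mul_inv, inv_inv, mul_comm, div_eq_mul_inv]
  rw [h5]
  refine Real.rpow_le_rpow (by positivity) ?_ hg.le
  rw [div_le_iff₀ (by positivity)]
  linarith

/-- Hölder bounds for a path and its iterated integral from bounds at dyadic times. -/
theorem holder_of_dyadic {x y : ℝ → ℝ} {z : ℝ → ℝ → ℝ} {T a g : ℝ} (hT : 0 < T) (hg : 0 < g)
    (ha : 0 ≤ a) (hx : Continuous x)
    (hz : Continuous fun p : ℝ × ℝ => z p.1 p.2)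
    (hchen : ∀ s u t, z s t = z s u + z u t + (x u - x s) * (y t - y u))
    (dx : ∀ M i : ℕ, i < 2 ^ M →
      |x ((i + 1 : ℕ) * (T / 2 ^ M)) - x (i * (T / 2 ^ M))| ≤ a * ((1 / 2 : ℝ) ^ g) ^ M)
    (dy : ∀ M i : ℕ, i < 2 ^ M →
      |y ((i + 1 : ℕ) * (T / 2 ^ M)) - y (i * (T / 2 ^ M))| ≤ a * ((1 / 2 : ℝ) ^ g) ^ M)
    (dz : ∀ M i : ℕ, i < 2 ^ M →
      |z (i * (T / 2 ^ M)) ((i + 1 : ℕ) * (T / 2 ^ M))| ≤ a * ((1 / 2 : ℝ) ^ (2 * g)) ^ M) :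
    ∀ s t, 0 ≤ s → s ≤ t → t ≤ T →
      |x t - x s| ≤ a * (1 + 2 / (1 - (1 / 2 : ℝ) ^ g)) * (5 * ((t - s) / T)) ^ g ∧
      |z s t| ≤ (a + (2 * a + 2 * a ^ 2 * (1 + 2 / (1 - (1 / 2 : ℝ) ^ g))) / (1 - (1 / 2 : ℝ) ^ g)) *
        (5 * ((t - s) / T)) ^ (2 * g) := by
  set ρ := (1 / 2 : ℝ) ^ g with hρ
  have hρ0 : 0 < ρ := by positivity
  have hρ1 : ρ < 1 := Real.rpow_lt_one (by norm_num) (by norm_num) hg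
  have h1ρ : 0 < 1 - ρ := by linarith
  have hρ2 : (1 / 2 : ℝ) ^ (2 * g) = ρ ^ 2 := by
    rw [hρ, ← Real.rpow_mul_natCast (by norm_num)]; congr 1; push_cast; ring
  set b := a * (1 + 2 / (1 - ρ)) with hb
  have hb0 : 0 ≤ b := by positivity
  have hzz : ∀ s, z s s = 0 := fun s => by have := hchen s s s; simp at this; exact this
  have one : ∀ {w : ℝ → ℝ}, (∀ M i : ℕ, i < 2 ^ M →
      |w ((i + 1 : ℕ) * (T / 2 ^ M)) - w (i * (T / 2 ^ M))| ≤ a * ρ ^ M) →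
      ∀ l M i j : ℕ, l ≤ M → i ≤ j → j ≤ 2 ^ M → j - i ≤ 2 ^ l →
        |w (j * (T / 2 ^ M)) - w (i * (T / 2 ^ M))| ≤ b * ρ ^ (M - l) := by
    intro w dw l M i j hl hij hj hd
    have h := dyadic_chain (Δ := fun s t => |w t - w s|) (T := T) (e := 0) ha le_rfl hρ0 le_rfl
      (fun s => by simp) dw (fun M l i j i' j' _ _ _ _ _ _ _ _ => ?_) l M i j hl hij hj hd
    · refine h.trans ?_
      gcongr
      rw [hb, add_zero]
      have := mul_le_mul_of_nonneg_left (sum_pow_succ_le hρ0.le hρ1 l) (by positivity : 0 ≤ 2 * a)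
      linear_combination this
    · simp only [zero_mul, add_zero]
      linarith [abs_sub_le (w (j * (T / 2 ^ (M + 1)))) (w ((2 * j' : ℕ) * (T / 2 ^ (M + 1))))
        (w (i * (T / 2 ^ (M + 1)))), abs_sub_le (w ((2 * j' : ℕ) * (T / 2 ^ (M + 1))))
        (w ((2 * i' : ℕ) * (T / 2 ^ (M + 1)))) (w (i * (T / 2 ^ (M + 1))))]
  have cx := one dx
  have cy := one dy
  intro s t hs hst ht
  constructor
  · exact le_rpow_of_dyadic (Δ := fun s t => |x t - x s|) hT hg hb0 (by fun_prop)
      (fun s => by simp) cx hs hst ht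
  · set e := 2 * a ^ 2 * (1 + 2 / (1 - ρ)) with he
    have he0 : 0 ≤ e := by positivity
    refine le_rpow_of_dyadic (Δ := fun s t => |z s t|) hT (by positivity) (by positivity)
      (by fun_prop) (fun s => by simp [hzz]) (fun l M i j hl hij hj hd => ?_) hs hst ht
    rw [hρ2] at dz ⊢
    have h := dyadic_chain (Δ := fun s t => |z s t|) (T := T) (e := e) ha he0
      (by positivity : 0 < ρ ^ 2) (by nlinarith : ρ ^ 2 ≤ ρ) (fun s => by simp [hzz]) dz
      (fun M l i j i' j' hlM h1 h2 h3 h4 h5 h6 h7 => ?_) l M i j hl hij hj hd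
    · refine h.trans ?_
      gcongr
      rw [div_eq_mul_one_div]
      gcongr
      exact sum_pow_succ_le hρ0.le hρ1 l
    · set p : ℕ → ℝ := fun n => (n : ℝ) * (T / 2 ^ (M + 1)) with hp
      have hsmall : ∀ {w : ℝ → ℝ}, (∀ M i : ℕ, i < 2 ^ M →
          |w ((i + 1 : ℕ) * (T / 2 ^ M)) - w (i * (T / 2 ^ M))| ≤ a * ρ ^ M) →
          ∀ i j : ℕ, i ≤ j → j ≤ i + 1 → j ≤ 2 ^ (M + 1) →
            |w (p j) - w (p i)| ≤ a * ρ ^ (M + 1) := by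
        intro w dw i j hij hji hj
        rcases Nat.eq_or_lt_of_le hij with rfl | hlt
        · simp; positivity
        · obtain rfl : j = i + 1 := by omega
          exact dw (M + 1) i hj
      -- Chen's relation at the two trimming points. Each cross term is an elementary increment
      -- times an increment over at most `2^{l+1}` steps, the latter controlled by the chaining for
      -- paths.
      have e1 : z (p i) (p j) = z (p i) (p (2 * i')) + z (p (2 * i')) (p (2 * j')) +
          z (p (2 * j')) (p j) + (x (p (2 * i')) - x (p i)) * (y (p j) - y (p (2 * i'))) +
          (x (p (2 * j')) - x (p (2 * i'))) * (y (p j) - y (p (2 * j'))) := by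
        rw [hchen (p i) (p (2 * i')) (p j), hchen (p (2 * i')) (p (2 * j')) (p j)]
        ring
      have hL := cy (l + 1) (M + 1) (2 * i') j (by omega) (by omega) h6 (by omega)
      have hR := cx (l + 1) (M + 1) (2 * i') (2 * j') (by omega) (by omega) (by omega) (by omega)
      rw [show M + 1 - (l + 1) = M - l by omega] at hL hR
      have h8 : |(x (p (2 * i')) - x (p i)) * (y (p j) - y (p (2 * i')))| ≤
          (a * ρ ^ (M + 1)) * (b * ρ ^ (M - l)) := by
        rw [abs_mul]
        gcongr
        exact hsmall dx i (2 * i') h1 h2 (by omega)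
      have h9 : |(x (p (2 * j')) - x (p (2 * i'))) * (y (p j) - y (p (2 * j')))| ≤
          (b * ρ ^ (M - l)) * (a * ρ ^ (M + 1)) := by
        rw [abs_mul]
        gcongr
        exact hsmall dy (2 * j') j h4 h5 h6
      have e2 : e * (ρ ^ 2) ^ (M - l) * ρ ^ (l + 1) =
          (a * ρ ^ (M + 1)) * (b * ρ ^ (M - l)) + (b * ρ ^ (M - l)) * (a * ρ ^ (M + 1)) := by
        rw [he, hb, show M + 1 = (M - l) + (l + 1) by omega, pow_add ρ (M - l) (l + 1), ← pow_mul,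
          mul_comm 2, pow_mul]
        ring
      change |z (p i) (p j)| ≤ |z (p i) (p (2 * i'))| + |z (p (2 * i')) (p (2 * j'))| +
        |z (p (2 * j')) (p j)| + e * (ρ ^ 2) ^ (M - l) * ρ ^ (l + 1)
      rw [e1, e2]
      refine (abs_add_le _ _).trans ?_
      rw [← add_assoc]
      refine add_le_add ((abs_add_le _ _).trans (add_le_add ?_ h8)) h9
      exact abs_add_three _ _ _

/-! ### Markov's inequality over dyadic increments -/

section Markov

variable {Ω : Type*} [MeasurableSpace Ω]

/-- Moment bounds on increments imply bounds at all dyadic times, with high probability. -/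
theorem exists_measure_dyadic_le (P : Measure Ω) {p : ℕ} (hp : 1 ≤ p) {T C β g : ℝ} (hT : 0 < T)
    (hC : 0 ≤ C) (hβ : g + 1 / p < β) : ∃ D : ℝ, 0 ≤ D ∧ ∀ Z : ℝ → ℝ → Ω → ℝ,
      (∀ s t, 0 ≤ s → s ≤ t → LpBdd P p (C * (t - s) ^ β) (Z s t)) → ∀ a : ℝ, 1 ≤ a →
      P {ω | ¬ ∀ M i : ℕ, i < 2 ^ M →
        |Z (i * (T / 2 ^ M)) ((i + 1 : ℕ) * (T / 2 ^ M)) ω| ≤ a * ((1 / 2 : ℝ) ^ g) ^ M} ≤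
        ENNReal.ofReal (D / a) := by
  have hp0 : (0 : ℝ) < p := by exact_mod_cast hp
  set r := (1 / 2 : ℝ) ^ ((β - g) * p - 1) with hr
  have hexp : 0 < (β - g) * p - 1 := by
    have : 1 / (p : ℝ) * p < (β - g) * p := by
      refine mul_lt_mul_of_pos_right ?_ hp0
      linarith
    rw [one_div_mul_cancel hp0.ne'] at this
    linarith
  have hr0 : 0 ≤ r := by positivity
  have hr1 : r < 1 := Real.rpow_lt_one (by norm_num) (by norm_num) hexp
  have h1r : 0 < 1 - r := by linarith
  refine ⟨(C * T ^ β) ^ p / (1 - r), by positivity, fun Z hZ a ha => ?_⟩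
  have ha0 : 0 < a := by linarith
  set κ := (1 / 2 : ℝ) ^ g with hκ
  have hκ0 : 0 < κ := by positivity
  set S : ℕ → ℕ → Set Ω := fun M i =>
    {ω | a * κ ^ M ≤ |Z (i * (T / 2 ^ M)) ((i + 1 : ℕ) * (T / 2 ^ M)) ω|} with hS
  -- The `2^M` intervals of level `M` cancel the factor `2^{-M}`, leaving `r^M`. The hypothesis `g +
  -- 1/p < β` is exactly `r < 1`.
  have hPS : ∀ M i, P (S M i) ≤ ENNReal.ofReal ((C * T ^ β) ^ p / a * r ^ M * (1 / 2) ^ M) := by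
    intro M i
    have hb := hZ (i * (T / 2 ^ M)) ((i + 1 : ℕ) * (T / 2 ^ M)) (by positivity)
      (by push_cast; gcongr; linarith)
    have hmk := meas_ge_le_mul_pow_eLpNorm_enorm P (p := (p : ℝ≥0∞)) (by exact_mod_cast hp0.ne')
      (by simp) hb.aesm (ε := ENNReal.ofReal (a * κ ^ M))
      (by simpa using by positivity) (by simp)
    have hset : S M i = {x | ENNReal.ofReal (a * κ ^ M) ≤
        ‖Z (i * (T / 2 ^ M)) ((i + 1 : ℕ) * (T / 2 ^ M)) x‖ₑ} := by
      ext ω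
      simp only [hS, Set.mem_ofPred_eq]
      rw [← ofReal_norm, Real.norm_eq_abs, ENNReal.ofReal_le_ofReal_iff (abs_nonneg _)]
    rw [hset]
    refine hmk.trans ?_
    rw [ENNReal.toReal_natCast, ← ENNReal.ofReal_inv_of_pos (by positivity), ENNReal.rpow_natCast,
      ENNReal.rpow_natCast]
    refine (mul_le_mul_right (pow_le_pow_left₀ (by simp) hb.le p) _).trans ?_
    rw [← ENNReal.ofReal_pow (by positivity), ← ENNReal.ofReal_pow hb.nonneg,
      ← ENNReal.ofReal_mul (by positivity)]
    refine ENNReal.ofReal_le_ofReal ?_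
    have e1 : ((i + 1 : ℕ) : ℝ) * (T / 2 ^ M) - i * (T / 2 ^ M) = T * (1 / 2) ^ M := by
      push_cast; rw [one_div, inv_pow]; ring
    have e2 : (T * (1 / 2) ^ M) ^ β = T ^ β * ((1 / 2 : ℝ) ^ β) ^ M := by
      rw [Real.mul_rpow hT.le (by positivity), ← Real.rpow_natCast, ← Real.rpow_natCast,
        ← Real.rpow_mul (by norm_num), ← Real.rpow_mul (by norm_num), mul_comm β]
    have e3 : (((1 / 2 : ℝ) ^ β) ^ M) ^ p = (κ ^ M) ^ p * (r ^ M * (1 / 2) ^ M) := by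
      rw [← mul_pow, ← pow_mul, mul_comm M p, pow_mul, ← pow_mul κ, mul_comm M p, pow_mul κ,
        ← mul_pow]
      congr 1
      rw [hκ, hr, ← Real.rpow_natCast, ← Real.rpow_natCast, ← Real.rpow_mul (by norm_num),
        ← Real.rpow_mul (by norm_num), ← Real.rpow_add_one (by norm_num),
        ← Real.rpow_add (by norm_num)]
      congr 1; ring
    rw [e1, e2, ← mul_assoc C, mul_pow _ (((1 / 2 : ℝ) ^ β) ^ M), e3, inv_pow, mul_pow a]
    have hap : a ≤ a ^ p := le_self_pow₀ ha (by omega)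
    calc _ = (C * T ^ β) ^ p / a ^ p * (r ^ M * (1 / 2) ^ M) := by field_simp
      _ ≤ (C * T ^ β) ^ p / a * (r ^ M * (1 / 2) ^ M) := by gcongr
      _ = _ := by ring
  have hsub : {ω | ¬ ∀ M i : ℕ, i < 2 ^ M →
      |Z (i * (T / 2 ^ M)) ((i + 1 : ℕ) * (T / 2 ^ M)) ω| ≤ a * κ ^ M} ⊆
      ⋃ M : ℕ, ⋃ i ∈ Finset.range (2 ^ M), S M i := by
    intro ω hω
    simp only [Set.mem_ofPred_eq, not_forall, not_le] at hω
    obtain ⟨M, i, hi, h⟩ := hω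
    simp only [Set.mem_iUnion]
    exact ⟨M, i, Finset.mem_range.2 hi, h.le⟩
  calc _ ≤ P (⋃ M : ℕ, ⋃ i ∈ Finset.range (2 ^ M), S M i) := measure_mono hsub
    _ ≤ ∑' M : ℕ, P (⋃ i ∈ Finset.range (2 ^ M), S M i) := measure_iUnion_le _
    _ ≤ ∑' M : ℕ, ENNReal.ofReal ((C * T ^ β) ^ p / a * r ^ M) := by
        refine ENNReal.tsum_le_tsum fun M => (measure_biUnion_finset_le _ _).trans ?_
        refine (Finset.sum_le_sum fun i _ => hPS M i).trans (le_of_eq ?_)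
        rw [Finset.sum_const, Finset.card_range, nsmul_eq_mul, ← ENNReal.ofReal_natCast,
          ← ENNReal.ofReal_mul (by positivity)]
        congr 1
        push_cast
        rw [one_div, inv_pow]; field_simp
    _ = _ := by
        rw [← ENNReal.ofReal_tsum_of_nonneg (fun M => by positivity)
          ((summable_geometric_of_lt_one hr0 hr1).mul_left _), tsum_mul_left,
          tsum_geometric_of_lt_one hr0 hr1]
        congr 1; field_simp

end Markov

/-! ### Compact sets of rough paths -/

namespace RoughPath

variable {N : ℕ} {T γ : ℝ}

/-- The rough paths that start at zero and are bounded by `R` in the `g`-Hölder sense. -/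
def holderBall (N : ℕ) (T γ g R : ℝ) : Set (RoughPath N T γ) :=
  {X | (∀ s : Set.Icc (0 : ℝ) T, (s : ℝ) = 0 → X.path s = 0) ∧
    (∀ s t, ‖X.path t - X.path s‖ ≤ R * |(t : ℝ) - s| ^ g) ∧
    ∀ s t, ‖X.area s t‖ ≤ R * |(t : ℝ) - s| ^ (2 * g)}

/-- By compactness it suffices to argue near one point of the square. Near the diagonal both terms
are `O(|t-s|^g)`, and the spare factor `|t-s|^{g-c}` is small. Away from it `|t-s|^c` is bounded
below, and equicontinuity spreads the convergence at one point to a neighbourhood. -/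
lemma eventually_forall_norm_sub_le {V : Type*} [NormedAddCommGroup V]
    {D : RoughPath N T γ → Set.Icc (0 : ℝ) T → Set.Icc (0 : ℝ) T → V} {K : Set (RoughPath N T γ)}
    {L : RoughPath N T γ} {F : Filter (RoughPath N T γ)} (hK : K ∈ F) (hL : L ∈ K) {R g c : ℝ}
    (hc : 0 < c) (hcg : c < g)
    (hbdd : ∀ X ∈ K, ∀ s t, ‖D X s t‖ ≤ R * |(t : ℝ) - s| ^ g)
    (hequi : ∀ p : Set.Icc (0 : ℝ) T × Set.Icc (0 : ℝ) T, ∀ η > 0, ∀ᶠ p' in nhds p,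
      ∀ X ∈ K, ‖D X p'.1 p'.2 - D X p.1 p.2‖ ≤ η)
    (hlim : ∀ s t, Filter.Tendsto (fun X => D X s t) F (nhds (D L s t))) {η : ℝ} (hη : 0 < η) :
    ∀ᶠ X in F, ∀ s t, ‖D X s t - D L s t‖ ≤ η * |(t : ℝ) - s| ^ c := by
  have key : ∀ᶠ X in F, ∀ p ∈ (Set.univ : Set (Set.Icc (0 : ℝ) T × Set.Icc (0 : ℝ) T)),
      ‖D X p.1 p.2 - D L p.1 p.2‖ ≤ η * |(p.2 : ℝ) - p.1| ^ c := by
    refine isCompact_univ.induction_on (p := fun S => ∀ᶠ X in F, ∀ p : Set.Icc (0 : ℝ) T × Set.Icc (0 : ℝ) T, p ∈ S →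
      ‖D X p.1 p.2 - D L p.1 p.2‖ ≤ η * |(p.2 : ℝ) - p.1| ^ c) ?_ ?_ ?_ ?_
    · simp
    · exact fun s t hst ht => ht.mono fun X hX p hp => hX p (hst hp)
    · intro s t hs ht
      filter_upwards [hs, ht] with X h1 h2 p hp
      exact hp.elim (h1 p) (h2 p)
    · intro p _
      have hdc : Continuous fun p : Set.Icc (0 : ℝ) T × Set.Icc (0 : ℝ) T => |(p.2 : ℝ) - p.1| := by
        fun_prop
      rw [nhdsWithin_univ]
      by_cases hd : |(p.2 : ℝ) - p.1| = 0
      · have h1 : Filter.Tendsto (fun p : Set.Icc (0 : ℝ) T × Set.Icc (0 : ℝ) T =>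
            2 * R * |(p.2 : ℝ) - p.1| ^ (g - c)) (nhds p) (nhds 0) := by
          have : Continuous fun p : Set.Icc (0 : ℝ) T × Set.Icc (0 : ℝ) T =>
              2 * R * |(p.2 : ℝ) - p.1| ^ (g - c) :=
            continuous_const.mul (hdc.rpow_const fun _ => Or.inr (by linarith))
          have h2 := this.tendsto p
          rwa [hd, Real.zero_rpow (by linarith), mul_zero] at h2
        refine ⟨_, h1.eventually (eventually_le_nhds hη), ?_⟩
        filter_upwards [hK] with X hX p' hp'
        have e : |(p'.2 : ℝ) - p'.1| ^ g = |(p'.2 : ℝ) - p'.1| ^ (g - c) * |(p'.2 : ℝ) - p'.1| ^ c := by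
          rw [← Real.rpow_add_of_nonneg (abs_nonneg _) (by linarith) hc.le, sub_add_cancel]
        calc _ ≤ R * |(p'.2 : ℝ) - p'.1| ^ g + R * |(p'.2 : ℝ) - p'.1| ^ g :=
              (norm_sub_le _ _).trans (add_le_add (hbdd X hX _ _) (hbdd L hL _ _))
          _ = 2 * R * |(p'.2 : ℝ) - p'.1| ^ (g - c) * |(p'.2 : ℝ) - p'.1| ^ c := by rw [e]; ring
          _ ≤ _ := mul_le_mul_of_nonneg_right hp' (by positivity)
      · have hd0 : 0 < |(p.2 : ℝ) - p.1| := lt_of_le_of_ne (abs_nonneg _) (Ne.symm hd)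
        set δ := η * (|(p.2 : ℝ) - p.1| / 2) ^ c / 3 with hδ
        have hδ0 : 0 < δ := by positivity
        have h1 := (hdc.tendsto p).eventually (eventually_ge_nhds (half_lt_self hd0))
        refine ⟨_, (hequi p δ hδ0).and h1, ?_⟩
        filter_upwards [hK, (hlim p.1 p.2).eventually (Metric.closedBall_mem_nhds _ hδ0)]
          with X hX hXL p' hp'
        rw [dist_eq_norm] at hXL
        have h2 := hp'.1 X hX
        have h3 := hp'.1 L hL
        rw [norm_sub_rev] at h3
        have e : D X p'.1 p'.2 - D L p'.1 p'.2 = (D X p'.1 p'.2 - D X p.1 p.2) +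
          (D X p.1 p.2 - D L p.1 p.2) + (D L p.1 p.2 - D L p'.1 p'.2) := by abel
        rw [e]
        calc _ ≤ δ + δ + δ := norm_add₃_le.trans (by gcongr)
          _ = η * (|(p.2 : ℝ) - p.1| / 2) ^ c := by rw [hδ]; ring
          _ ≤ _ := by gcongr; exact hp'.2
  filter_upwards [key] with X hX s t using hX (s, t) trivial

lemma edist_le_of_forall {X Y : RoughPath N T γ} {η : ℝ} (hη : 0 ≤ η)
    (h0 : ∀ s : Set.Icc (0 : ℝ) T, (s : ℝ) = 0 → X.path s = Y.path s)
    (h1 : ∀ s t, ‖(X.path t - X.path s) - (Y.path t - Y.path s)‖ ≤ η * |(t : ℝ) - s| ^ γ)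
    (h2 : ∀ s t, ‖X.area s t - Y.area s t‖ ≤ η * |(t : ℝ) - s| ^ (2 * γ)) :
    edist X Y ≤ ENNReal.ofReal (2 * η) := by
  have hdiv : ∀ {V : Type} [NormedAddCommGroup V] (a b : V) (d : ℝ), ‖a - b‖ ≤ η * d →
      0 < d → edist a b / ENNReal.ofReal d ≤ ENNReal.ofReal η := by
    intro V _ a b d h hd
    refine ENNReal.div_le_of_le_mul ?_
    rw [← ENNReal.ofReal_mul hη, edist_dist, dist_eq_norm]
    exact ENNReal.ofReal_le_ofReal h
  have hpos : ∀ {s t : Set.Icc (0 : ℝ) T} (c : ℝ), s ≠ t → 0 < |(t : ℝ) - s| ^ c := fun c hst =>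
    Real.rpow_pos_of_pos (abs_pos.2 (sub_ne_zero.2 fun e => hst (Subtype.ext e.symm))) c
  change roughDist X Y ≤ _
  have hz : (⨆ (s : Set.Icc (0 : ℝ) T) (_ : (s : ℝ) = 0), edist (X.path s) (Y.path s)) = 0 := by
    simp only [ENNReal.iSup_eq_zero, edist_eq_zero]
    exact h0
  rw [roughDist, hz, zero_add, show 2 * η = η + η from two_mul η, ENNReal.ofReal_add hη hη]
  refine add_le_add ?_ ?_
  · exact iSup_le fun s => iSup₂_le fun t hst => hdiv _ _ _ (h1 s t) (hpos γ hst)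
  · exact iSup_le fun s => iSup₂_le fun t hst => hdiv _ _ _ (h2 s t) (hpos (2 * γ) hst)

lemma norm_path_sub_le {g R : ℝ} (hg : 0 ≤ g) (hR : 0 ≤ R) {X : RoughPath N T γ}
    (hX : X ∈ holderBall N T γ g R) (s t : Set.Icc (0 : ℝ) T) : ‖X.path t - X.path s‖ ≤ R * T ^ g := by
  refine (hX.2.1 s t).trans ?_
  gcongr
  rw [abs_le]
  exact ⟨by linarith [s.2.2, t.2.1], by linarith [s.2.1, t.2.2]⟩

/-- Applying Chen's relation twice moves one endpoint at a time. This is the equicontinuity of the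
areas. -/
lemma norm_area_sub_le {g R : ℝ} (hg : 0 ≤ g) (hR : 0 ≤ R) {X : RoughPath N T γ}
    (hX : X ∈ holderBall N T γ g R) (s t s' t' : Set.Icc (0 : ℝ) T) :
    ‖X.area s' t' - X.area s t‖ ≤ R * |(s : ℝ) - s'| ^ (2 * g) + R * |(t' : ℝ) - t| ^ (2 * g) +
      R * |(s : ℝ) - s'| ^ g * (R * T ^ g) + R * T ^ g * (R * |(t' : ℝ) - t| ^ g) := by
  have hT : 0 ≤ T := s.2.1.trans s.2.2
  have hcomp : ∀ (v : Fin N → ℝ) i, |v i| ≤ ‖v‖ := fun v i => norm_le_pi_norm v i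
  refine (pi_norm_le_iff_of_nonneg (by positivity)).2 fun i =>
    (pi_norm_le_iff_of_nonneg (by positivity)).2 fun j => ?_
  have c1 := X.chen s' s t' i j
  have c2 := X.chen s t t' i j
  have e : (X.area s' t' - X.area s t) i j = X.area s' s i j + X.area t t' i j +
      (X.path s - X.path s') i * (X.path t' - X.path s) j +
      (X.path t - X.path s) i * (X.path t' - X.path t) j := by
    simp only [Pi.sub_apply]; linarith
  rw [e, Real.norm_eq_abs]
  refine (abs_add_le _ _).trans (add_le_add ((abs_add_le _ _).trans (add_le_add
    ((abs_add_le _ _).trans (add_le_add ?_ ?_)) ?_)) ?_)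
  · exact (hcomp _ j).trans ((norm_le_pi_norm (X.area s' s) i).trans (hX.2.2 s' s))
  · exact (hcomp _ j).trans ((norm_le_pi_norm (X.area t t') i).trans (hX.2.2 t t'))
  · rw [abs_mul]
    gcongr
    · exact (hcomp _ i).trans (hX.2.1 s' s)
    · exact (hcomp _ j).trans (norm_path_sub_le hg hR hX s t')
  · rw [abs_mul]
    gcongr
    · exact (hcomp _ i).trans (norm_path_sub_le hg hR hX s t)
    · exact (hcomp _ j).trans (hX.2.1 t t')

/-- Arzelà-Ascoli with ultrafilters. Values at fixed times lie in compact balls of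
finite-dimensional spaces, so they converge; the limit inherits Chen's relation and the `g`-Hölder
bounds, and the gap between `γ` and `g` upgrades pointwise convergence to the rough path distance.
-/
theorem isCompact_holderBall {g R : ℝ} (hγ : 0 < γ) (hγg : γ < g) (hR : 0 ≤ R) :
    IsCompact (holderBall N T γ g R) := by
  have hg : 0 < g := hγ.trans hγg
  rw [isCompact_iff_ultrafilter_le_nhds']
  intro F hF
  have hlim : ∀ {V : Type} [NormedAddCommGroup V] [ProperSpace V] (f : RoughPath N T γ → V) (M : ℝ),
      (∀ X ∈ holderBall N T γ g R, ‖f X‖ ≤ M) → ∃ l, Filter.Tendsto f F (nhds l) := by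
    intro V _ _ f M hf
    obtain ⟨l, -, hl⟩ := (isCompact_closedBall (0 : V) M).ultrafilter_le_nhds (F.map f) (by
      rw [Filter.le_principal_iff]
      refine Ultrafilter.mem_map.2 (Filter.mem_of_superset hF fun X hX => ?_)
      simpa using hf X hX)
    exact ⟨l, hl⟩
  have hp : ∀ s : Set.Icc (0 : ℝ) T, ∃ l, Filter.Tendsto (fun X : RoughPath N T γ => X.path s) F
      (nhds l) := by
    intro s
    refine hlim _ (R * T ^ g) fun X hX => ?_
    have h0 : (0 : ℝ) ∈ Set.Icc (0 : ℝ) T := ⟨le_rfl, s.2.1.trans s.2.2⟩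
    have := norm_path_sub_le hg.le hR hX ⟨0, h0⟩ s
    rwa [hX.1 ⟨0, h0⟩ rfl, sub_zero] at this
  have hA : ∀ s t : Set.Icc (0 : ℝ) T, ∃ l, Filter.Tendsto (fun X : RoughPath N T γ => X.area s t) F
      (nhds l) := fun s t => hlim _ _ fun X hX => hX.2.2 s t
  choose x hx using hp
  choose A hA using hA
  have hpb : ∀ s t, ‖x t - x s‖ ≤ R * |(t : ℝ) - s| ^ g := fun s t =>
    le_of_tendsto ((hx t).sub (hx s)).norm (Filter.mem_of_superset hF fun X hX => hX.2.1 s t)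
  have hab : ∀ s t, ‖A s t‖ ≤ R * |(t : ℝ) - s| ^ (2 * g) := fun s t =>
    le_of_tendsto (hA s t).norm (Filter.mem_of_superset hF fun X hX => hX.2.2 s t)
  have hholder : ∀ {c d : ℝ}, 0 < c → c < d → ∀ s t : Set.Icc (0 : ℝ) T,
      R * |(t : ℝ) - s| ^ d ≤ R * T ^ (d - c) * |(t : ℝ) - s| ^ c := by
    intro c d hc hcd s t
    rw [mul_assoc]
    refine mul_le_mul_of_nonneg_left ?_ hR
    have e : |(t : ℝ) - s| ^ d = |(t : ℝ) - s| ^ (d - c) * |(t : ℝ) - s| ^ c := by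
      rw [← Real.rpow_add_of_nonneg (abs_nonneg _) (by linarith) hc.le, sub_add_cancel]
    rw [e]
    gcongr
    rw [abs_le]
    exact ⟨by linarith [s.2.2, t.2.1], by linarith [s.2.1, t.2.2]⟩
  have hpc : ∀ s k, Filter.Tendsto (fun X : RoughPath N T γ => X.path s k) F (nhds (x s k)) :=
    fun s k => tendsto_pi_nhds.1 (hx s) k
  have hac : ∀ s t i j, Filter.Tendsto (fun X : RoughPath N T γ => X.area s t i j) F
      (nhds (A s t i j)) := fun s t i j => tendsto_pi_nhds.1 (tendsto_pi_nhds.1 (hA s t) i) j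
  set L : RoughPath N T γ :=
    { path := x
      area := A
      chen := fun s u t i j => tendsto_nhds_unique
        (((hac s t i j).sub (hac s u i j)).sub (hac u t i j))
        (((((hpc u i).sub (hpc s i)).mul ((hpc t j).sub (hpc u j)))).congr fun X =>
          (X.chen s u t i j).symm)
      holder_path := ⟨_, fun s t => (hpb s t).trans (hholder hγ hγg s t)⟩
      holder_area := ⟨_, fun s t => (hab s t).trans (hholder (by positivity) (by linarith) s t)⟩ }
    with hLdef
  have hL : L ∈ holderBall N T γ g R := by
    refine ⟨fun s hs => ?_, hpb, hab⟩
    refine tendsto_nhds_unique (hx s) (tendsto_const_nhds.congr' ?_)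
    filter_upwards [hF] with X hX
    exact (hX.1 s hs).symm
  refine ⟨L, hL, ?_⟩
  have hcd : ∀ (c : ℝ), 0 < c → ∀ t : Set.Icc (0 : ℝ) T,
      Continuous fun t' : Set.Icc (0 : ℝ) T => |(t' : ℝ) - t| ^ c := fun c hc t =>
    Continuous.rpow_const (by fun_prop) fun _ => Or.inr hc.le
  have hcd' : ∀ (c : ℝ), 0 < c → ∀ t : Set.Icc (0 : ℝ) T,
      Continuous fun t' : Set.Icc (0 : ℝ) T => |(t : ℝ) - t'| ^ c := fun c hc t =>
    Continuous.rpow_const (by fun_prop) fun _ => Or.inr hc.le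
  refine Metric.nhds_basis_closedEBall.ge_iff.2 fun η hη => ?_
  obtain ⟨r, hr0, hr⟩ : ∃ r : ℝ, 0 < r ∧ ENNReal.ofReal (2 * r) ≤ η := by
    obtain ⟨q, hq0, hq⟩ := ENNReal.lt_iff_exists_nnreal_btwn.1 hη
    refine ⟨q / 2, by simpa using hq0, ?_⟩
    rw [mul_div_cancel₀ _ two_ne_zero, ENNReal.ofReal_coe_nnreal]
    exact hq.le
  have e1 := eventually_forall_norm_sub_le (D := fun X s t => X.path t - X.path s) hF hL hγ hγg
    (fun X hX => hX.2.1) (fun p δ hδ => ?_) (fun s t => (hx t).sub (hx s)) hr0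
  · have e2 := eventually_forall_norm_sub_le (D := fun X s t => X.area s t) (c := 2 * γ) hF hL
      (by linarith) (by linarith : 2 * γ < 2 * g) (fun X hX => hX.2.2) (fun p δ hδ => ?_) hA hr0
    · filter_upwards [e1, e2, hF] with X h1 h2 hX
      refine (edist_le_of_forall hr0.le (fun s hs => ?_) h1 h2).trans hr
      rw [hX.1 s hs, hL.1 s hs]
    · have hc : Continuous fun p' : Set.Icc (0 : ℝ) T × Set.Icc (0 : ℝ) T =>
          R * |(p.1 : ℝ) - p'.1| ^ (2 * g) + R * |(p'.2 : ℝ) - p.2| ^ (2 * g) +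
          R * |(p.1 : ℝ) - p'.1| ^ g * (R * T ^ g) + R * T ^ g * (R * |(p'.2 : ℝ) - p.2| ^ g) := by
        have c1 := (hcd' (2 * g) (by positivity) p.1).comp
          (continuous_fst (X := Set.Icc (0 : ℝ) T) (Y := Set.Icc (0 : ℝ) T))
        have c2 := (hcd (2 * g) (by positivity) p.2).comp
          (continuous_snd (X := Set.Icc (0 : ℝ) T) (Y := Set.Icc (0 : ℝ) T))
        have c3 := (hcd' g hg p.1).comp
          (continuous_fst (X := Set.Icc (0 : ℝ) T) (Y := Set.Icc (0 : ℝ) T))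
        have c4 := (hcd g hg p.2).comp
          (continuous_snd (X := Set.Icc (0 : ℝ) T) (Y := Set.Icc (0 : ℝ) T))
        simp only [Function.comp_def] at c1 c2 c3 c4
        fun_prop
      have h0 := hc.tendsto p
      simp only [sub_self, abs_zero, Real.zero_rpow hg.ne', Real.zero_rpow
        (by positivity : 2 * g ≠ 0), mul_zero, zero_mul, add_zero] at h0
      filter_upwards [h0.eventually (eventually_le_nhds hδ)] with p' hp' X hX
      exact (norm_area_sub_le hg.le hR hX p.1 p.2 p'.1 p'.2).trans hp'
  · have hc : Continuous fun p' : Set.Icc (0 : ℝ) T × Set.Icc (0 : ℝ) T =>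
        R * |(p'.2 : ℝ) - p.2| ^ g + R * |(p.1 : ℝ) - p'.1| ^ g := by
      have c3 := (hcd' g hg p.1).comp
        (continuous_fst (X := Set.Icc (0 : ℝ) T) (Y := Set.Icc (0 : ℝ) T))
      have c4 := (hcd g hg p.2).comp
        (continuous_snd (X := Set.Icc (0 : ℝ) T) (Y := Set.Icc (0 : ℝ) T))
      simp only [Function.comp_def] at c3 c4
      fun_prop
    have h0 := hc.tendsto p
    simp only [sub_self, abs_zero, Real.zero_rpow hg.ne', mul_zero, add_zero] at h0
    filter_upwards [h0.eventually (eventually_le_nhds hδ)] with p' hp' X hX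
    refine le_trans ?_ hp'
    have e : X.path p'.2 - X.path p'.1 - (X.path p.2 - X.path p.1) =
        (X.path p'.2 - X.path p.2) + (X.path p.1 - X.path p'.1) := by abel
    rw [e]
    exact (norm_add_le _ _).trans (add_le_add (hX.2.1 _ _) (hX.2.1 _ _))

end RoughPath

/-! ### Scaling -/

lemma one_half_le_thetaOf (H : ℝ) (g : ℝ → ℝ) : 1 / 2 ≤ thetaOf H g := le_max_right _ _

lemma thetaOf_le_one {H : ℝ} (hH : H < 1) (g : ℝ → ℝ) : thetaOf H g ≤ 1 := by
  refine max_le ?_ (by norm_num)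
  rw [hStar]
  nlinarith [(Nat.cast_nonneg (hermiteRank g) : (0 : ℝ) ≤ hermiteRank g)]

lemma alphaOf_eq {H : ℝ} {g : ℝ → ℝ}
    (hg : hStar H (hermiteRank g) < 0 ∨ 1 / 2 < hStar H (hermiteRank g)) {ε : ℝ} (hε : 0 < ε) :
    alphaOf H g ε = ε ^ (thetaOf H g - 1) := by
  rw [alphaOf, thetaOf, scalingConst]
  rcases hg with h | h
  · rw [if_pos (by linarith), max_eq_right (by linarith), Real.sqrt_eq_rpow, one_div,
      ← Real.rpow_neg hε.le]
    norm_num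
  · rw [if_neg (by linarith), if_neg (by linarith), max_eq_left h.le]

/-- The scaling balance: an integral over length `x` at speed `1/ε` is `ε` times a unit-speed
integral over length `x / ε`, whose norm grows with exponent `θ`. -/
lemma alphaOf_mul_rpow {H : ℝ} {g : ℝ → ℝ}
    (hg : hStar H (hermiteRank g) < 0 ∨ 1 / 2 < hStar H (hermiteRank g)) {ε : ℝ} (hε : 0 < ε)
    {x : ℝ} (hx : 0 ≤ x) : alphaOf H g ε * ε * (x / ε) ^ thetaOf H g = x ^ thetaOf H g := by
  rw [alphaOf_eq hg hε, Real.div_rpow hx hε.le, Real.rpow_sub_one hε.ne']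
  have : ε ^ thetaOf H g ≠ 0 := (Real.rpow_pos_of_pos hε _).ne'
  field_simp

lemma alphaOf_nonneg {H : ℝ} {g : ℝ → ℝ}
    (hg : hStar H (hermiteRank g) < 0 ∨ 1 / 2 < hStar H (hermiteRank g)) {ε : ℝ} (hε : 0 < ε) :
    0 ≤ alphaOf H g ε := by
  rw [alphaOf_eq hg hε]; positivity

lemma iterInt_comp_mul_add (f g : ℝ → ℝ) {ε : ℝ} (hε : ε ≠ 0) (d a b : ℝ) :
    ε ^ 2 * iterInt (fun s => f (ε * s + d)) (fun s => g (ε * s + d)) a b =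
      iterInt f g (ε * a + d) (ε * b + d) := by
  have h : ∀ s, ∫ u in a..s, g (ε * u + d) = ε⁻¹ * ∫ u in (ε * a + d)..(ε * s + d), g u := fun s =>
    intervalIntegral.integral_comp_mul_add g hε d
  simp only [iterInt, h]
  have h2 := intervalIntegral.integral_comp_mul_add (a := a) (b := b)
    (fun s => f s * (ε⁻¹ * ∫ u in (ε * a + d)..s, g u)) hε d
  rw [h2, smul_eq_mul]
  have e : ∀ s, f s * (ε⁻¹ * ∫ u in (ε * a + d)..s, g u) =
      ε⁻¹ * (f s * ∫ u in (ε * a + d)..s, g u) := fun s => by ring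
  simp only [e, intervalIntegral.integral_const_mul]
  field_simp

namespace MultiScaleAssumption

variable {Ω : Type*} [MeasurableSpace Ω] {P : Measure Ω} [IsProbabilityMeasure P] {H σ : ℝ}
  {B : ℝ → Ω → ℝ} {N : ℕ} {G : Fin N → ℝ → ℝ} {r : Fin N → ℝ≥0∞} {q : ℕ}

/-- Moments of the increments of the rescaled integrals. -/
theorem exists_lpBdd_path (hG : MultiScaleAssumption H G r q) (hH0 : 0 < H) (hH1 : H < 1)
    (hH : H ≠ 1 / 2) (hB : IsFractionalBrownianMotion H B P)
    (hσ : HasLaw (fastFOU H σ 1 B 0) (gaussianReal 0 1) P) (k : Fin N) :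
    ∃ C, 0 ≤ C ∧ ∀ ε : ℝ, 0 < ε → ∀ s t : ℝ, s ≤ t →
      LpBdd P (2 * q : ℕ) (C * (t - s) ^ thetaOf H (G k))
        (fun ω => alphaOf H (G k) ε * ∫ u in s..t, G k (fastFOU H σ ε B u ω)) := by
  have hq : 1 ≤ q := by have := hG.four_le; omega
  obtain ⟨A, v, hA, hY⟩ := exists_isFOULike_fastFOU hH0 hH1 hH hB hσ
  obtain ⟨K, hK⟩ := (hG.decay k).exists_hasChaosDecay hq (hG.continuous k)
  obtain ⟨C, hC, h⟩ := IsFOULike.exists_lpBdd_integral P (Lp ℝ 2 (volume : Measure ℝ)) hH1 hA hq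
    (hG.one_le_rank k) (hG.gap k) hK
  refine ⟨C, hC, fun ε hε s t hst => ?_⟩
  have h1 := (h v _ (hY ε hε s) ((t - s) / ε) (div_nonneg (by linarith) hε.le)).const_mul
    (alphaOf H (G k) ε * ε)
  refine (h1.congr (ae_of_all _ fun ω => ?_)).mono (le_of_eq ?_)
  · simp only
    rw [intervalIntegral.integral_comp_mul_add (fun u => G k (fastFOU H σ ε B u ω)) hε.ne' s,
      mul_zero, zero_add, mul_div_cancel₀ _ hε.ne', sub_add_cancel, smul_eq_mul]
    field_simp
  · have h2 := alphaOf_mul_rpow (hG.gap k) hε (sub_nonneg.2 hst)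
    rw [abs_of_nonneg (mul_nonneg (alphaOf_nonneg (hG.gap k) hε) hε.le), ← h2]
    change _ * (C * ((t - s) / ε) ^ thetaOf H (G k)) = _
    ring

/-- Moments of the rescaled iterated integrals. -/
theorem exists_lpBdd_area (hG : MultiScaleAssumption H G r q) (hH0 : 0 < H) (hH1 : H < 1)
    (hH : H ≠ 1 / 2) (hB : IsFractionalBrownianMotion H B P)
    (hσ : HasLaw (fastFOU H σ 1 B 0) (gaussianReal 0 1) P) (i j : Fin N) :
    ∃ C, 0 ≤ C ∧ ∀ ε : ℝ, 0 < ε → ∀ s t : ℝ, s ≤ t →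
      LpBdd P q (C * (t - s) ^ (thetaOf H (G i) + thetaOf H (G j)))
        (fun ω => alphaOf H (G i) ε * alphaOf H (G j) ε *
          iterInt (fun u => G i (fastFOU H σ ε B u ω)) (fun u => G j (fastFOU H σ ε B u ω)) s t) := by
  have hq : 1 ≤ q := by have := hG.four_le; omega
  obtain ⟨A, v, hA, hY⟩ := exists_isFOULike_fastFOU hH0 hH1 hH hB hσ
  obtain ⟨K, hK⟩ := (hG.decay i).exists_hasChaosDecay hq (hG.continuous i)
  obtain ⟨K', hK'⟩ := (hG.decay j).exists_hasChaosDecay hq (hG.continuous j)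
  obtain ⟨C, hC, h⟩ := IsFOULike.exists_lpBdd_iterInt P (Lp ℝ 2 (volume : Measure ℝ)) hH1 hA
    (by have := hG.four_le; omega) (hG.one_le_rank i) (hG.one_le_rank j) (hG.gap i) (hG.gap j) hK hK'
  refine ⟨C, hC, fun ε hε s t hst => ?_⟩
  have hd : 0 ≤ (t - s) / ε := div_nonneg (by linarith) hε.le
  have h1 := (h v _ (hY ε hε s) ((t - s) / ε) hd).const_mul
    (alphaOf H (G i) ε * ε * (alphaOf H (G j) ε * ε))
  refine (h1.congr (ae_of_all _ fun ω => ?_)).mono (le_of_eq ?_)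
  · have h2 := iterInt_comp_mul_add (fun u => G i (fastFOU H σ ε B u ω))
      (fun u => G j (fastFOU H σ ε B u ω)) hε.ne' s 0 ((t - s) / ε)
    rw [mul_zero, zero_add, mul_div_cancel₀ _ hε.ne', sub_add_cancel] at h2
    simp only
    rw [← h2]
    ring
  · have hi := alphaOf_mul_rpow (hG.gap i) hε (sub_nonneg.2 hst)
    have hj := alphaOf_mul_rpow (hG.gap j) hε (sub_nonneg.2 hst)
    have hθi := one_half_le_thetaOf H (G i)
    have hθj := one_half_le_thetaOf H (G j)
    rw [abs_of_nonneg (mul_nonneg (mul_nonneg (alphaOf_nonneg (hG.gap i) hε) hε.le)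
      (mul_nonneg (alphaOf_nonneg (hG.gap j) hε) hε.le)),
      Real.rpow_add_of_nonneg (sub_nonneg.2 hst) (by linarith) (by linarith), ← hi, ← hj]
    change _ * (C * ((t - s) / ε) ^ (thetaOf H (G i) + thetaOf H (G j))) = _
    rw [Real.rpow_add_of_nonneg hd (by linarith) (by linarith)]
    ring

end MultiScaleAssumption

section Path

variable {f g : ℝ → ℝ}

lemma abs_integral_le_mul {M T s t : ℝ} (hM : ∀ u ∈ Set.Icc 0 T, |f u| ≤ M)
    (hs : s ∈ Set.Icc 0 T) (ht : t ∈ Set.Icc 0 T) : |∫ u in s..t, f u| ≤ M * |t - s| := by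
  rw [← Real.norm_eq_abs]
  refine intervalIntegral.norm_integral_le_of_norm_le_const fun u hu => hM u ?_
  exact Set.uIcc_subset_Icc hs ht (Set.uIoc_subset_uIcc hu)

lemma abs_iterInt_le {M M' T s t : ℝ} (hM : ∀ u ∈ Set.Icc 0 T, |f u| ≤ M)
    (hM' : ∀ u ∈ Set.Icc 0 T, |g u| ≤ M') (hs : s ∈ Set.Icc 0 T) (ht : t ∈ Set.Icc 0 T) :
    |iterInt f g s t| ≤ M * M' * |t - s| ^ 2 := by
  have hM0 : 0 ≤ M := (abs_nonneg _).trans (hM s hs)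
  have hM0' : 0 ≤ M' := (abs_nonneg _).trans (hM' s hs)
  have h : |iterInt f g s t| ≤ M * (M' * |t - s|) * |t - s| := by
    rw [← Real.norm_eq_abs]
    refine intervalIntegral.norm_integral_le_of_norm_le_const fun u hu => ?_
    have hu' := Set.uIoc_subset_uIcc hu
    have huT := Set.uIcc_subset_Icc hs ht hu'
    rw [norm_mul]
    refine mul_le_mul (hM u huT) ((abs_integral_le_mul hM' hs huT).trans ?_) (norm_nonneg _) hM0
    exact mul_le_mul_of_nonneg_left (Set.abs_sub_left_of_mem_uIcc hu') hM0'
  exact h.trans (le_of_eq (by ring))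

/-- Chen's relation with base point `0` expresses the two-parameter integral through one-parameter
primitives. -/
lemma continuous_iterInt (hf : Continuous f) (hg : Continuous g) :
    Continuous fun p : ℝ × ℝ => iterInt f g p.1 p.2 := by
  have e : (fun p : ℝ × ℝ => iterInt f g p.1 p.2) = fun p => iterInt f g 0 p.2 - iterInt f g 0 p.1 -
      ((∫ s in 0..p.2, f s) - ∫ s in 0..p.1, f s) * ∫ u in 0..p.1, g u := by
    ext p
    rw [iterInt_chen hf hg 0 p.1 p.2, integral_sub_primitive hf 0 p.1 p.2]
    ring
  have h1 := continuous_primitive' hf 0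
  have h2 := continuous_primitive' hg 0
  have h3 : Continuous fun t => iterInt f g 0 t := continuous_primitive' (hf.mul h2) 0
  have h4 := h1.comp (continuous_snd (X := ℝ) (Y := ℝ))
  have h5 := h1.comp (continuous_fst (X := ℝ) (Y := ℝ))
  have h6 := h2.comp (continuous_fst (X := ℝ) (Y := ℝ))
  have h7 := h3.comp (continuous_snd (X := ℝ) (Y := ℝ))
  have h8 := h3.comp (continuous_fst (X := ℝ) (Y := ℝ))
  rw [e]
  exact (h7.sub h8).sub ((h4.sub h5).mul h6)

end Path

/-! ### Tightness -/

lemma iterInt_eq_integral_integral (f g : ℝ → ℝ) (a b : ℝ) :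
    iterInt f g a b = ∫ s in a..b, ∫ u in a..s, g u * f s := by
  refine intervalIntegral.integral_congr fun s _ => ?_
  simp only [intervalIntegral.integral_mul_const]
  ring

lemma iterInt_eq_integral_integral' (f g : ℝ → ℝ) (a b : ℝ) :
    iterInt f g a b = ∫ s in a..b, ∫ u in a..s, f s * g u := by
  simp only [iterInt, intervalIntegral.integral_const_mul]

namespace RoughPath

variable {N : ℕ} {T γ : ℝ}

lemma pow_le_mul_rpow {x T c : ℝ} (hx : 0 ≤ x) (hxT : x ≤ T) {n : ℕ} (hc : 0 ≤ c) (hn : c ≤ n) :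
    x ^ n ≤ T ^ (n - c) * x ^ c := by
  have e : x ^ n = x ^ (n - c) * x ^ c := by
    rw [← Real.rpow_add_of_nonneg hx (by linarith) hc, sub_add_cancel, Real.rpow_natCast]
  rw [e]
  gcongr

/-- The rough path of iterated integrals of continuous functions. -/
noncomputable def ofContinuous (a : Fin N → ℝ) (f : Fin N → ℝ → ℝ) (hf : ∀ k, Continuous (f k))
    (hγ0 : 0 < γ) (hγ : Fin N → γ ≤ 1) : RoughPath N T γ where
  path t k := a k * ∫ u in (0 : ℝ)..t, f k u
  -- The inner integral carries `i` and the outer one `j`, so the arguments of `iterInt` are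
  -- exchanged.
  area s t i j := a i * a j * iterInt (f j) (f i) s t
  chen s u t i j := by
    rw [iterInt_chen (hf j) (hf i) s u t, integral_sub_primitive (hf i) 0 s u,
      integral_sub_primitive (hf j) 0 u t]
    ring
  holder_path := by
    choose M hM using fun k => isCompact_Icc.exists_bound_of_continuousOn
      (s := Set.Icc (0 : ℝ) T) (hf k).continuousOn
    refine ⟨∑ k, |a k| * (|M k| * T ^ (1 - γ)), fun s t => ?_⟩
    have hT : 0 ≤ T := s.2.1.trans s.2.2
    have hd : |(t : ℝ) - s| ≤ T := abs_le.2 ⟨by linarith [s.2.2, t.2.1], by linarith [s.2.1, t.2.2]⟩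
    refine (pi_norm_le_iff_of_nonneg (by positivity)).2 fun k => ?_
    have h1 := abs_integral_le_mul (f := f k) (M := |M k|)
      (fun u hu => (hM k u hu).trans (le_abs_self _)) s.2 t.2
    have h2 := pow_le_mul_rpow (n := 1) (abs_nonneg _) hd hγ0.le (by simpa using hγ k)
    rw [pow_one, Nat.cast_one] at h2
    have e : a k * (∫ u in (0 : ℝ)..t, f k u) - a k * ∫ u in (0 : ℝ)..s, f k u =
        a k * ∫ u in (s : ℝ)..t, f k u := by
      rw [integral_sub_primitive (hf k) 0 s t]; ring
    rw [Pi.sub_apply, e, norm_mul, Real.norm_eq_abs, Real.norm_eq_abs]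
    calc _ ≤ |a k| * (|M k| * (T ^ (1 - γ) * |(t : ℝ) - s| ^ γ)) := by
          gcongr; exact h1.trans (by gcongr)
      _ = |a k| * (|M k| * T ^ (1 - γ)) * |(t : ℝ) - s| ^ γ := by ring
      _ ≤ _ := by
          gcongr
          exact Finset.single_le_sum (f := fun k => |a k| * (|M k| * T ^ (1 - γ)))
            (fun k _ => by positivity) (Finset.mem_univ k)
  holder_area := by
    choose M hM using fun k => isCompact_Icc.exists_bound_of_continuousOn
      (s := Set.Icc (0 : ℝ) T) (hf k).continuousOn
    refine ⟨∑ i, ∑ j, |a i * a j| * (|M j| * |M i| * T ^ (2 - 2 * γ)), fun s t => ?_⟩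
    have hT : 0 ≤ T := s.2.1.trans s.2.2
    have hd : |(t : ℝ) - s| ≤ T := abs_le.2 ⟨by linarith [s.2.2, t.2.1], by linarith [s.2.1, t.2.2]⟩
    refine (pi_norm_le_iff_of_nonneg (by positivity)).2 fun i =>
      (pi_norm_le_iff_of_nonneg (by positivity)).2 fun j => ?_
    have h1 := abs_iterInt_le (f := f j) (g := f i) (M := |M j|) (M' := |M i|)
      (fun u hu => (hM j u hu).trans (le_abs_self _))
      (fun u hu => (hM i u hu).trans (le_abs_self _)) s.2 t.2
    have h2 := pow_le_mul_rpow (n := 2) (c := 2 * γ) (abs_nonneg _) hd (by positivity)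
      (by push_cast; linarith [hγ i])
    rw [Nat.cast_two] at h2
    rw [norm_mul, Real.norm_eq_abs, Real.norm_eq_abs]
    calc _ ≤ |a i * a j| * (|M j| * |M i| * (T ^ (2 - 2 * γ) * |(t : ℝ) - s| ^ (2 * γ))) := by
          gcongr; exact h1.trans (by gcongr)
      _ = |a i * a j| * (|M j| * |M i| * T ^ (2 - 2 * γ)) * |(t : ℝ) - s| ^ (2 * γ) := by ring
      _ ≤ _ := by
          gcongr
          refine le_trans ?_ (Finset.single_le_sum (f := fun i => ∑ j, |a i * a j| *
            (|M j| * |M i| * T ^ (2 - 2 * γ))) (fun i _ => by positivity) (Finset.mem_univ i))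
          exact Finset.single_le_sum (f := fun j => |a i * a j| * (|M j| * |M i| * T ^ (2 - 2 * γ)))
            (fun j _ => by positivity) (Finset.mem_univ j)

/-- Bounds at dyadic times place the rough path in a compact set. -/
theorem exists_ofContinuous_mem_holderBall (N : ℕ) (γ : ℝ) (hT : 0 < T) {g b : ℝ} (hg : 0 < g)
    (hb : 0 ≤ b) : ∃ R, 0 ≤ R ∧ ∀ (a : Fin N → ℝ) (f : Fin N → ℝ → ℝ)
      (hf : ∀ k, Continuous (f k)) (hγ0 : 0 < γ) (hγ : Fin N → γ ≤ 1),
      (∀ k, ∀ M i : ℕ, i < 2 ^ M →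
        |a k * ∫ u in (i * (T / 2 ^ M))..((i + 1 : ℕ) * (T / 2 ^ M)), f k u| ≤
          b * ((1 / 2 : ℝ) ^ g) ^ M) →
      (∀ k l, ∀ M i : ℕ, i < 2 ^ M →
        |a k * a l * iterInt (f k) (f l) (i * (T / 2 ^ M)) ((i + 1 : ℕ) * (T / 2 ^ M))| ≤
          b * ((1 / 2 : ℝ) ^ (2 * g)) ^ M) →
      ofContinuous a f hf hγ0 hγ ∈ holderBall N T γ g R := by
  set ρ := (1 / 2 : ℝ) ^ g with hρ
  have hρ1 : 0 < 1 - ρ := sub_pos.2 (Real.rpow_lt_one (by norm_num) (by norm_num) hg)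
  set c₁ := b * (1 + 2 / (1 - ρ)) * (5 / T) ^ g with hc₁
  set c₂ := (b + (2 * b + 2 * b ^ 2 * (1 + 2 / (1 - ρ))) / (1 - ρ)) * (5 / T) ^ (2 * g) with hc₂
  have hc₁0 : 0 ≤ c₁ := by positivity
  have hc₂0 : 0 ≤ c₂ := by positivity
  refine ⟨c₁ + (c₂ + c₁ ^ 2), by positivity, fun a f hf hγ0 hγ dx dz => ?_⟩
  have hx : ∀ k, Continuous fun t : ℝ => a k * ∫ u in (0 : ℝ)..t, f k u := fun k =>
    continuous_const.mul (continuous_primitive' (hf k) 0)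
  have hxs : ∀ k s t, (a k * ∫ u in (0 : ℝ)..t, f k u) - a k * ∫ u in (0 : ℝ)..s, f k u =
      a k * ∫ u in s..t, f k u := fun k s t => by
    rw [integral_sub_primitive (hf k) 0 s t]; ring
  have key : ∀ i j : Fin N, ∀ s t : ℝ, 0 ≤ s → s ≤ t → t ≤ T →
      |a i * ∫ u in s..t, f i u| ≤ c₁ * (t - s) ^ g ∧
        |a i * a j * iterInt (f j) (f i) s t| ≤ c₂ * (t - s) ^ (2 * g) := by
    intro i j s t hs hst ht
    have h := holder_of_dyadic (x := fun t : ℝ => a i * ∫ u in (0 : ℝ)..t, f i u)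
      (y := fun t : ℝ => a j * ∫ u in (0 : ℝ)..t, f j u)
      (z := fun s t => a i * a j * iterInt (f j) (f i) s t) (a := b) hT hg hb (hx i)
      (continuous_const.mul (continuous_iterInt (hf j) (hf i)))
      (fun s u t => by
        rw [hxs, hxs, iterInt_chen (hf j) (hf i) s u t]; ring)
      (fun M n hn => by rw [hxs]; exact dx i M n hn) (fun M n hn => by rw [hxs]; exact dx j M n hn)
      (fun M n hn => by rw [mul_comm (a i)]; exact dz j i M n hn) s t hs hst ht
    have e : ∀ c : ℝ, (5 * ((t - s) / T)) ^ c = (5 / T) ^ c * (t - s) ^ c := fun c => by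
      rw [← Real.mul_rpow (by positivity) (by linarith)]; congr 1; ring
    simp only [hxs, e, ← mul_assoc] at h
    exact h
  have hpath : ∀ k, ∀ s t : Set.Icc (0 : ℝ) T,
      |a k * ∫ u in (s : ℝ)..t, f k u| ≤ c₁ * |(t : ℝ) - s| ^ g := by
    intro k s t
    rcases le_total (s : ℝ) t with h | h
    · rw [abs_of_nonneg (sub_nonneg.2 h)]
      exact (key k k s t s.2.1 h t.2.2).1
    · rw [abs_sub_comm, abs_of_nonneg (sub_nonneg.2 h), intervalIntegral.integral_symm, mul_neg,
        abs_neg]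
      exact (key k k t s t.2.1 h s.2.2).1
  refine ⟨fun s hs => ?_, fun s t => ?_, fun s t => ?_⟩
  · funext k
    simp [ofContinuous, hs]
  · refine (pi_norm_le_iff_of_nonneg (by positivity)).2 fun k => ?_
    rw [Pi.sub_apply, Real.norm_eq_abs]
    simp only [ofContinuous]
    rw [hxs]
    refine (hpath k s t).trans ?_
    gcongr
    exact le_add_of_nonneg_right (by positivity)
  · refine (pi_norm_le_iff_of_nonneg (by positivity)).2 fun i =>
      (pi_norm_le_iff_of_nonneg (by positivity)).2 fun j => ?_
    rw [Real.norm_eq_abs]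
    simp only [ofContinuous]
    have hpow : 0 ≤ |(t : ℝ) - s| ^ (2 * g) := by positivity
    rcases le_total (s : ℝ) t with h | h
    · rw [abs_of_nonneg (sub_nonneg.2 h)] at hpow ⊢
      refine (key i j s t s.2.1 h t.2.2).2.trans (mul_le_mul_of_nonneg_right ?_ hpow)
      nlinarith
    -- For reversed times Chen's relation on the degenerate triple `s, t, s` expresses the area
    -- through the forward one and a product of increments; this is the origin of `c₁ ^ 2`.
    · have h1 := (key i j t s t.2.1 h s.2.2).2
      have h2 := hpath i s t
      have h3 := hpath j t s
      rw [abs_sub_comm] at h3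
      have hc := iterInt_chen (hf j) (hf i) s t s
      rw [iterInt_self] at hc
      have e : a i * a j * iterInt (f j) (f i) s t = -(a i * a j * iterInt (f j) (f i) t s) +
          -((a i * ∫ u in (s : ℝ)..t, f i u) * (a j * ∫ u in (t : ℝ)..s, f j u)) := by
        linear_combination (-(a i * a j)) * hc
      rw [e]
      refine (abs_add_le _ _).trans ?_
      rw [abs_neg, abs_neg]
      have e2 : |(t : ℝ) - s| ^ (2 * g) = |(t : ℝ) - s| ^ g * |(t : ℝ) - s| ^ g := by
        rw [← Real.rpow_add_of_nonneg (abs_nonneg _) hg.le hg.le]; congr 1; ring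
      have e3 : |(t : ℝ) - s| = s - t := by rw [abs_sub_comm, abs_of_nonneg (sub_nonneg.2 h)]
      rw [← e3] at h1
      calc _ ≤ c₂ * |(t : ℝ) - s| ^ (2 * g) +
            (c₁ * |(t : ℝ) - s| ^ g) * (c₁ * |(t : ℝ) - s| ^ g) := add_le_add h1 (by
              rw [abs_mul]; exact mul_le_mul h2 h3 (abs_nonneg _) (by positivity))
        _ = (c₂ + c₁ ^ 2) * |(t : ℝ) - s| ^ (2 * g) := by rw [e2]; ring
        _ ≤ _ := mul_le_mul_of_nonneg_right (le_add_of_nonneg_left hc₁0) hpow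

end RoughPath

lemma exists_one_le_ofReal_div_le (D : ℝ) {δ : ℝ≥0∞} (hδ : 0 < δ) :
    ∃ a : ℝ, 1 ≤ a ∧ ENNReal.ofReal (D / a) ≤ δ := by
  rcases eq_or_ne δ ⊤ with rfl | htop
  · exact ⟨1, le_rfl, le_top⟩
  · have hd : 0 < δ.toReal := ENNReal.toReal_pos hδ.ne' htop
    refine ⟨|D| / δ.toReal + 1, le_add_of_nonneg_left (by positivity),
      ENNReal.ofReal_le_of_le_toReal ?_⟩
    rw [div_le_iff₀ (by positivity)]
    have : δ.toReal * (|D| / δ.toReal + 1) = |D| + δ.toReal := by field_simp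
    rw [this]
    linarith [le_abs_self D]

theorem mainTheorem8 {Ω : Type*} [MeasurableSpace Ω] (P : Measure Ω) [IsProbabilityMeasure P]
    (H : ℝ) (hH0 : 0 < H) (hH1 : H < 1) (hH : H ≠ 1 / 2)
    (B : ℝ → Ω → ℝ) (hB : IsFractionalBrownianMotion H B P)
    (σ : ℝ) (hσ : HasLaw (fastFOU H σ 1 B 0) (gaussianReal 0 1) P)
    (N : ℕ) (G : Fin N → ℝ → ℝ) (r : Fin N → ℝ≥0∞) (q : ℕ)
    (hG : MultiScaleAssumption H G r q) :
    (∀ p : ℝ≥0∞, 1 ≤ p → p ≤ q → ∀ i j : Fin N, ∃ C : ℝ,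
      ∀ ε : ℝ, 0 < ε → ε ≤ 1 → ∀ t : ℝ, 0 ≤ t →
        MemLp (fun ω => alphaOf H (G i) ε * alphaOf H (G j) ε *
          ∫ s in (0 : ℝ)..t, ∫ u in (0 : ℝ)..s,
            G i (fastFOU H σ ε B s ω) * G j (fastFOU H σ ε B u ω)) p P ∧
        eLpNorm (fun ω => alphaOf H (G i) ε * alphaOf H (G j) ε *
          ∫ s in (0 : ℝ)..t, ∫ u in (0 : ℝ)..s,
            G i (fastFOU H σ ε B s ω) * G j (fastFOU H σ ε B u ω)) p P
          ≤ ENNReal.ofReal (C * t ^ (thetaOf H (G i) + thetaOf H (G j)))) ∧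
    (∀ T : ℝ, 0 < T → ∀ γ : ℝ, 1 / 3 < γ →
      (∀ k, γ < thetaOf H (G k) - 1 / (2 * (q : ℝ))) →
      ∃ X : Set.Ioc (0 : ℝ) 1 → Ω → RoughPath N T γ,
        (∀ ε ω t k, (X ε ω).path t k =
          alphaOf H (G k) ε * ∫ s in (0 : ℝ)..t, G k (fastFOU H σ ε B s ω)) ∧
        (∀ ε ω s t i j, (X ε ω).area s t i j =
          alphaOf H (G i) ε * alphaOf H (G j) ε *
            ∫ v in (s : ℝ)..t, ∫ u in (s : ℝ)..v,
              G i (fastFOU H σ ε B u ω) * G j (fastFOU H σ ε B v ω)) ∧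
        IsTightFamily P X) := by
  have hq4 := hG.four_le
  constructor
  · intro p _ hp i j
    obtain ⟨C, -, h⟩ := hG.exists_lpBdd_area hH0 hH1 hH hB hσ i j
    refine ⟨C, fun ε hε _ t ht => ?_⟩
    have h1 := (h ε hε 0 t ht).mono_exponent hp
    simp only [iterInt_eq_integral_integral', sub_zero] at h1
    exact ⟨h1.memLp, h1.le⟩
  · intro T hT γ hγ hγθ
    have hγ0 : 0 < γ := by linarith
    have hq0 : (0 : ℝ) < q := by exact_mod_cast (by omega : 0 < q)
    -- The bound on `γ` comes from some index `k`, so for `N = 0` it is not available.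
    have hγ1 : Fin N → γ ≤ 1 := fun k => by
      have h1 := thetaOf_le_one hH1 (G k)
      have h2 := hγθ k
      have h3 : 0 < 1 / (2 * (q : ℝ)) := by positivity
      linarith
    have hf : ∀ (ε : ℝ) ω k, Continuous fun u => G k (fastFOU H σ ε B u ω) := fun ε ω k =>
      (hG.continuous k).comp (continuous_fastFOU hB.continuous ω)
    refine ⟨fun ε ω => RoughPath.ofContinuous (fun k => alphaOf H (G k) ε)
      (fun k u => G k (fastFOU H σ ε B u ω)) (hf ε ω) hγ0 hγ1, fun ε ω t k => rfl,
      fun ε ω s t i j => ?_, fun δ hδ => ?_⟩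
    · simp only [RoughPath.ofContinuous, iterInt_eq_integral_integral]
    -- A slightly larger Hölder exponent is needed for compactness in the `γ`-distance; finitely
    -- many strict inequalities leave room for it.
    obtain ⟨g, hγg, hgθ⟩ : ∃ g, γ < g ∧ ∀ k, g < thetaOf H (G k) - 1 / (2 * (q : ℝ)) := by
      have h1 : ∀ᶠ g in nhdsWithin γ (Set.Ioi γ), ∀ k, g < thetaOf H (G k) - 1 / (2 * (q : ℝ)) :=
        Filter.eventually_all.2 fun k => by
          filter_upwards [Ioo_mem_nhdsGT (hγθ k)] with g hg using hg.2
      obtain ⟨g, hg2, hg1⟩ := (h1.and eventually_mem_nhdsWithin).exists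
      exact ⟨g, hg1, hg2⟩
    have hg0 : 0 < g := hγ0.trans hγg
    choose C hC hpath using hG.exists_lpBdd_path hH0 hH1 hH hB hσ
    choose C' hC' harea using hG.exists_lpBdd_area hH0 hH1 hH hB hσ
    have hdx := fun k => exists_measure_dyadic_le P (p := 2 * q) (by omega) hT (hC k)
      (show g + 1 / ((2 * q : ℕ) : ℝ) < thetaOf H (G k) by push_cast; linarith [hgθ k])
    -- The area has only `q` moments but twice the regularity: its condition is the sum of the
    -- conditions `g + 1/(2q) < θ` for the two paths.
    have hdz := fun k l => exists_measure_dyadic_le P (p := q) (by omega) hT (hC' k l)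
      (show 2 * g + 1 / (q : ℝ) < thetaOf H (G k) + thetaOf H (G l) by
        have e : 1 / (q : ℝ) = 1 / (2 * q) + 1 / (2 * q) := by field_simp; norm_num
        linarith [hgθ k, hgθ l])
    choose D hD hDx using hdx
    choose D' hD' hDz using hdz
    -- One threshold for all components: the exceptional probabilities, each at most a constant over
    -- `b`, add up to at most `δ`, and none of the constants depends on `ε`.
    obtain ⟨b, hb1, hb⟩ := exists_one_le_ofReal_div_le (∑ k, D k + ∑ k, ∑ l, D' k l) hδ
    obtain ⟨R, hR, hmem⟩ := RoughPath.exists_ofContinuous_mem_holderBall N γ hT hg0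
      (show 0 ≤ b by linarith)
    refine ⟨_, RoughPath.isCompact_holderBall hγ0 hγg hR, fun ε => ?_⟩
    set Sx : Fin N → Set Ω := fun k => {ω | ¬ ∀ M i : ℕ, i < 2 ^ M →
      |alphaOf H (G k) ε * ∫ u in (i * (T / 2 ^ M))..((i + 1 : ℕ) * (T / 2 ^ M)),
        G k (fastFOU H σ ε B u ω)| ≤ b * ((1 / 2 : ℝ) ^ g) ^ M} with hSx
    set Sz : Fin N → Fin N → Set Ω := fun k l => {ω | ¬ ∀ M i : ℕ, i < 2 ^ M →
      |alphaOf H (G k) ε * alphaOf H (G l) ε * iterInt (fun u => G k (fastFOU H σ ε B u ω))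
        (fun u => G l (fastFOU H σ ε B u ω)) (i * (T / 2 ^ M)) ((i + 1 : ℕ) * (T / 2 ^ M))| ≤
        b * ((1 / 2 : ℝ) ^ (2 * g)) ^ M} with hSz
    have hsub : {ω | RoughPath.ofContinuous (fun k => alphaOf H (G k) ε)
        (fun k u => G k (fastFOU H σ ε B u ω)) (hf ε ω) hγ0 hγ1 ∉
        RoughPath.holderBall N T γ g R} ⊆ (⋃ k, Sx k) ∪ ⋃ k, ⋃ l, Sz k l := by
      intro ω hω
      by_contra hcon
      simp only [Set.mem_union, Set.mem_iUnion, not_or, not_exists] at hcon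
      refine hω (hmem _ _ (hf ε ω) hγ0 hγ1 (fun k => ?_) fun k l => ?_)
      · exact not_not.1 (hcon.1 k)
      · exact not_not.1 (hcon.2 k l)
    refine (measure_mono hsub).trans ((measure_union_le _ _).trans (le_trans ?_ hb))
    have hb0 : 0 < b := by linarith
    have hx : ∀ k, P (Sx k) ≤ ENNReal.ofReal (D k / b) := fun k =>
      hDx k (fun s t ω => alphaOf H (G k) ε * ∫ u in s..t, G k (fastFOU H σ ε B u ω))
        (fun s t _ hst => hpath k ε ε.2.1 s t hst) b hb1
    have hz : ∀ k l, P (Sz k l) ≤ ENNReal.ofReal (D' k l / b) := fun k l =>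
      hDz k l (fun s t ω => alphaOf H (G k) ε * alphaOf H (G l) ε *
        iterInt (fun u => G k (fastFOU H σ ε B u ω)) (fun u => G l (fastFOU H σ ε B u ω)) s t)
        (fun s t _ hst => harea k l ε ε.2.1 s t hst) b hb1
    rw [add_div, ENNReal.ofReal_add (div_nonneg (Finset.sum_nonneg fun k _ => hD k) hb0.le)
      (div_nonneg (Finset.sum_nonneg fun k _ => Finset.sum_nonneg fun l _ => hD' k l) hb0.le),
      Finset.sum_div, Finset.sum_div,
      ENNReal.ofReal_sum_of_nonneg fun k _ => div_nonneg (hD k) hb0.le,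
      ENNReal.ofReal_sum_of_nonneg fun k _ => div_nonneg
        (Finset.sum_nonneg fun l _ => hD' k l) hb0.le]
    refine add_le_add ((measure_iUnion_fintype_le _ _).trans (Finset.sum_le_sum fun k _ => hx k))
      ((measure_iUnion_fintype_le _ _).trans (Finset.sum_le_sum fun k _ => ?_))
    rw [Finset.sum_div, ENNReal.ofReal_sum_of_nonneg fun l _ => div_nonneg (hD' k l) hb0.le]
    exact (measure_iUnion_fintype_le _ _).trans (Finset.sum_le_sum fun l _ => hz k l)
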